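/- **Setting.** Let $\mathfrak{X}$ be a Cantor space (a topological space homeomorphic to the Cantor set) and let $G$ be the group of all self-homeomorphisms of $\mathfrak{X}$. For a clopen subset $\mathfrak{A}\subset\mathfrak{X}$ let $G\{\mathfrak{A}\}=\{g\in G: g\mathfrak{A}=\mathfrak{A}\}$, and give $G$ the topology in which the finite intersections $G\{\mathfrak{A}_1\}\cap\cdots\cap G\{\mathfrak{A}_n\}$, with all $\mathfrak{A}_i$ clopen, form a neighbourhood basis of the identity. By a *$G$-set* we mean a set with an action of $G$ that has open stabilizers and finitely many orbits. For a finite set $A$ with the discrete topology, let $Y(A)$ be the $G$-set of all continuous maps $\mathfrak{X}\to A$ and $X(A)\subset Y(A)$ the $G$-subset of surjective ones; put $X(n)=X(\{1,\dots,n\})$. A map $f\colon A\to B$ of finite sets induces $Y(f)\colon Y(A)\to Y(B)$, $\varphi\mapsto f\circ\varphi$. A *measure* for $G$ with values in a commutative ring $k$ assigns to each map $f\colon X\to Y$ of $G$-sets with $Y$ transitive an element $\mu(f)\in k$ such that: (a) $\mu(f)=1$ if $f$ is an isomorphism; (b) $\mu(f)=\mu(f|_{X_1})+\mu(f|_{X_2})$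 if $X=X_1\amalg X_2$ as $G$-sets; (c) $\mu(g\circ f)=\mu(g)\mu(f)$ if $g\colon Y\to Z$ is a map of transitive $G$-sets; (d) $\mu(f')=\mu(f)$ if $f'$ is the base change of $f$ along a map $Y'\to Y$ of transitive $G$-sets. It is *regular* if $\mu(f)$ is a unit whenever $f$ is a map of transitive $G$-sets. Put $\mu(X)=\mu(X\to\mathrm{pt})$. Let $\mathcal{F}(X)$ be the $k$-module of $G$-invariant functions $X\to k$. For a map $f\colon X\to Y$ of $G$-sets, the push-forward $f_*\colon\mathcal{F}(X)\to\mathcal{F}(Y)$ is the $k$-linear map with $f_*(1_W)=\mu(W\to f(W))\cdot 1_{f(W)}$ for each orbit $W\subset X$. Let $\underline{\mathrm{Perm}}_k(G;\mu)$ be the following $k$-linear symmetric monoidal category. Its objects are symbols $\mathrm{Vec}_X$, one for each $G$-set $X$; $\mathrm{Hom}(\mathrm{Vec}_X,\mathrm{Vec}_Y)=\mathcal{F}(Y\times X)$; the composition of $A\in\mathcal{F}(Y\times X)$ and $B\in\mathcal{F}(Z\times Y)$ is $BA=(p_{13})_*(p_{12}^*B\cdot p_{23}^*A)$, where $p_{12}$,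 $p_{23}$, $p_{13}$ are the projections from $Z\times Y\times X$ to $Z\times Y$, $Y\times X$, $Z\times X$; the tensor product is $\mathrm{Vec}_X\otimes\mathrm{Vec}_Y=\mathrm{Vec}_{X\times Y}$ on objects and the Kronecker product on morphisms, with unit $\mathrm{Vec}_{\mathrm{pt}}$ and the evident constraints. Let $\underline{\mathrm{Perm}}_k(G;\mu)^{\mathrm{kar}}$ be its Karoubi envelope (idempotent completion). Let $\mathcal{V}$ be the category with objects $V(A)$, for $A$ a finite set, with $\mathrm{Hom}(V(A),V(B))$ the set of $B\times A$ matrices over $\mathbf{F}_2$, composition the matrix product, $V(A)\otimes V(B)=V(A\times B)$, and the Kronecker product on morphisms; it is equivalent to the category of finite-dimensional $\mathbf{F}_2$-vector spaces. For a field $k$ let $k[\mathcal{V}]$ be its $k$-linearization (with objects $[V(A)]$, whose morphism spaces are the free $k$-modules on the morphism sets of $\mathcal{V}$), and let $k[\mathcal{V}]^\sharp$ be the additive-Karoubi envelope of $k[\mathcal{V}]$. The zero matrices induce on every object $X$ of $k[\mathcal{V}]^\sharp$ an idempotent endomorphism $[0]$; let $X_1$ be the image of $1-[0]$, and let $k[\mathcal{V}]^\sharp_1$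 be the full subcategory of those $X$ with $X=X_1$, that is, $[0]=0$ on $X$. It is closed under the tensor product and is symmetric monoidal with unit $[V(\mathrm{pt})]_1$. **Theorem.** Let $k$ be a field of characteristic $0$. 1. There is a unique regular $\mathbf{Q}$-valued measure $\mu$ for $G$ such that $\mu(X(n))=(-2)^{n-1}$ for all $n\ge 1$. Regard $\mu$ as a $k$-valued measure via $\mathbf{Q}\subset k$. 2. There is an equivalence of tensor categories (a $k$-linear symmetric monoidal functor that is an equivalence of categories) $$\underline{\mathrm{Perm}}_k(G;\mu)^{\mathrm{kar}}\;\cong\;k[\mathcal{V}]^\sharp_1$$ which sends $\mathrm{Vec}_{Y(A)}$ to an object isomorphic to $[V(A)]_1$, for every finite set $A$. 3. For every map $f\colon A\to B$ of finite sets, $Y(f)_*(1_{Y(A)})=1_{Y(D)}$, where $D=\{b\in B: \#f^{-1}(b)\text{ is odd}\}$ and $Y(D)$ is identified with the set of those $\psi\in Y(B)$ that have image in $D$. -/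

import Mathlib

open CategoryTheory MonoidalCategory

universe v u w

namespace CategoryTheory.Free
section
variable {R : Type w} [CommRing R] {C : Type u} [Category.{v} C]

/-- The basis element `[f]` of a morphism space of the `R`-linearization. -/
noncomputable def bas (R : Type w) [CommRing R] {X Y : C} (f : X ⟶ Y) : Free.of R X ⟶ Free.of R Y :=
  (Finsupp.single f 1 : (X ⟶ Y) →₀ R)

theorem bas_id (X : C) : bas R (𝟙 X) = 𝟙 (Free.of R X) := rfl

theorem bas_comp {X Y Z : C} (f : X ⟶ Y) (g : Y ⟶ Z) : bas R f ≫ bas R g = bas R (f ≫ g) := by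
  have h := Free.single_comp_single (C := C) R f g 1 1
  rw [one_mul] at h
  exact h

theorem hom_induction {X Y : C} {P : (Free.of R X ⟶ Free.of R Y) → Prop}
    (f : Free.of R X ⟶ Free.of R Y) (zero : P 0) (add : ∀ f g, P f → P g → P (f + g))
    (smul : ∀ (r : R) (f : X ⟶ Y), P (r • bas R f)) : P f := by
  refine Finsupp.induction_linear (motive := fun f : (X ⟶ Y) →₀ R => P f) f zero
    (fun f g hf hg => add f g hf hg) (fun g r => ?_)
  have h := smul r g
  have e : (r • (Finsupp.single g 1 : (X ⟶ Y) →₀ R)) = Finsupp.single g r := by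
    rw [Finsupp.smul_single, smul_eq_mul, mul_one]
  rw [← e]
  exact h

variable [MonoidalCategory C]

/-- The tensor product of morphisms of the linearization: the bilinear extension of the tensor
product of `C`. -/
noncomputable def tens {X₁ Y₁ X₂ Y₂ : C} :
    (Free.of R X₁ ⟶ Free.of R Y₁) →ₗ[R] (Free.of R X₂ ⟶ Free.of R Y₂) →ₗ[R]
      (Free.of R (X₁ ⊗ X₂) ⟶ Free.of R (Y₁ ⊗ Y₂)) :=
  (Finsupp.linearCombination R fun f : X₁ ⟶ Y₁ =>
    Finsupp.lmapDomain R R fun g : X₂ ⟶ Y₂ => f ⊗ₘ g :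
    ((X₁ ⟶ Y₁) →₀ R) →ₗ[R] ((X₂ ⟶ Y₂) →₀ R) →ₗ[R] ((X₁ ⊗ X₂ ⟶ Y₁ ⊗ Y₂) →₀ R))

theorem tens_bas {X₁ Y₁ X₂ Y₂ : C} (f : X₁ ⟶ Y₁) (g : X₂ ⟶ Y₂) :
    tens (bas R f) (bas R g) = bas R (f ⊗ₘ g) := by
  have : (Finsupp.linearCombination R (fun f : X₁ ⟶ Y₁ =>
    Finsupp.lmapDomain R R fun g : X₂ ⟶ Y₂ => f ⊗ₘ g) (Finsupp.single f 1)) (Finsupp.single g 1) =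
    (Finsupp.single (f ⊗ₘ g) (1:R)) := by simp
  exact this

/-- The isomorphism of the linearization given by an isomorphism of `C`. -/
noncomputable def basIso {X Y : C} (e : X ≅ Y) : Free.of R X ≅ Free.of R Y where
  hom := bas R e.hom
  inv := bas R e.inv
  hom_inv_id := by rw [bas_comp, e.hom_inv_id, bas_id]
  inv_hom_id := by rw [bas_comp, e.inv_hom_id, bas_id]

noncomputable instance : MonoidalCategoryStruct.{max v w, u} (Free R C) where
  tensorObj := fun (X Y : C) => Free.of R (X ⊗ Y)
  tensorHom := fun {_ _ _ _ : C} f g => tens (C := C) f g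
  whiskerLeft := fun (X : C) {_ _ : C} f => tens (C := C) (𝟙 (Free.of R X)) f
  whiskerRight := fun {_ _ : C} f (Y : C) => tens (C := C) f (𝟙 (Free.of R Y))
  tensorUnit := Free.of R (𝟙_ C)
  associator := fun (X Y Z : C) => basIso (α_ X Y Z)
  leftUnitor := fun (X : C) => basIso (λ_ X)
  rightUnitor := fun (X : C) => basIso (ρ_ X)

theorem tens_comp {X₁ Y₁ Z₁ X₂ Y₂ Z₂ : C} (f₁ : Free.of R X₁ ⟶ Free.of R Y₁)
    (f₂ : Free.of R X₂ ⟶ Free.of R Y₂) (g₁ : Free.of R Y₁ ⟶ Free.of R Z₁)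
    (g₂ : Free.of R Y₂ ⟶ Free.of R Z₂) :
    tens f₁ f₂ ≫ tens g₁ g₂ = tens (f₁ ≫ g₁) (f₂ ≫ g₂) := by
  induction f₁ using hom_induction with
  | zero => simp
  | add f g hf hg => simp [hf, hg]
  | smul r f₁ =>
  induction f₂ using hom_induction with
  | zero => simp
  | add f g hf hg => simp only [map_add, Preadditive.add_comp, hf, hg]
  | smul r f₂ =>
  induction g₁ using hom_induction with
  | zero => simp
  | add f g hf hg => simp only [map_add, LinearMap.add_apply, Preadditive.comp_add, hf, hg]
  | smul r g₁ =>
  induction g₂ using hom_induction with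
  | zero => simp
  | add f g hf hg => simp only [map_add, LinearMap.add_apply, Preadditive.comp_add, hf, hg]
  | smul r g₂ =>
  simp only [map_smul, LinearMap.smul_apply, Linear.smul_comp, Linear.comp_smul, tens_bas, bas_comp,
    tensorHom_comp_tensorHom, smul_smul]
  congr 1
  ring

theorem tens_id (X Y : C) : tens (𝟙 (Free.of R X)) (𝟙 (Free.of R Y)) = 𝟙 (Free.of R (X ⊗ Y)) := by
  rw [← bas_id, ← bas_id, tens_bas, ← bas_id]; simp

theorem assoc_nat {X₁ X₂ X₃ Y₁ Y₂ Y₃ : C} (f₁ : Free.of R X₁ ⟶ Free.of R Y₁)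
    (f₂ : Free.of R X₂ ⟶ Free.of R Y₂) (f₃ : Free.of R X₃ ⟶ Free.of R Y₃) :
    tens (tens f₁ f₂) f₃ ≫ bas R (α_ Y₁ Y₂ Y₃).hom =
      bas R (α_ X₁ X₂ X₃).hom ≫ tens f₁ (tens f₂ f₃) := by
  induction f₁ using hom_induction with
  | zero => simp
  | add f g hf hg => simp [hf, hg]
  | smul r f₁ =>
  induction f₂ using hom_induction with
  | zero => simp
  | add f g hf hg =>
    simp only [map_add, LinearMap.add_apply, Preadditive.add_comp, Preadditive.comp_add, hf, hg]
  | smul r f₂ =>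
  induction f₃ using hom_induction with
  | zero => simp
  | add f g hf hg =>
    simp only [map_add, LinearMap.add_apply, Preadditive.add_comp, Preadditive.comp_add, hf, hg]
  | smul r f₃ =>
  simp only [map_smul, LinearMap.smul_apply, Linear.smul_comp, Linear.comp_smul, tens_bas, bas_comp,
    associator_naturality]

theorem left_nat {X Y : C} (f : Free.of R X ⟶ Free.of R Y) :
    tens (𝟙 (Free.of R (𝟙_ C))) f ≫ bas R (λ_ Y).hom = bas R (λ_ X).hom ≫ f := by
  induction f using hom_induction with
  | zero => simp
  | add f g hf hg => simp only [map_add, Preadditive.add_comp, Preadditive.comp_add, hf, hg]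
  | smul r f =>
  rw [← bas_id]
  simp only [map_smul, Linear.smul_comp, Linear.comp_smul, tens_bas, bas_comp, id_tensorHom,
    leftUnitor_naturality]

theorem right_nat {X Y : C} (f : Free.of R X ⟶ Free.of R Y) :
    tens f (𝟙 (Free.of R (𝟙_ C))) ≫ bas R (ρ_ Y).hom = bas R (ρ_ X).hom ≫ f := by
  induction f using hom_induction with
  | zero => simp
  | add f g hf hg => simp only [map_add, LinearMap.add_apply, Preadditive.add_comp,
      Preadditive.comp_add, hf, hg]
  | smul r f =>
  rw [← bas_id]
  simp only [map_smul, LinearMap.smul_apply, Linear.smul_comp, Linear.comp_smul, tens_bas, bas_comp,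
    tensorHom_id, rightUnitor_naturality]

noncomputable instance : MonoidalCategory.{max v w, u} (Free R C) :=
  MonoidalCategory.ofTensorHom
    (id_tensorHom_id := tens_id (C := C))
    (id_tensorHom := fun _ _ _ _ => rfl)
    (tensorHom_id := fun _ _ => rfl)
    (tensorHom_comp_tensorHom := tens_comp (C := C))
    (associator_naturality := assoc_nat (C := C))
    (leftUnitor_naturality := left_nat (C := C))
    (rightUnitor_naturality := right_nat (C := C))
    (pentagon := fun (W X Y Z : C) => by
      change tens (bas R (α_ W X Y).hom) (bas R (𝟙 Z)) ≫ bas R (α_ W (X ⊗ Y) Z).hom ≫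
        tens (bas R (𝟙 W)) (bas R (α_ X Y Z).hom) =
        bas R (α_ (W ⊗ X) Y Z).hom ≫ bas R (α_ W X (Y ⊗ Z)).hom
      simp only [tens_bas, bas_comp, tensorHom_id, id_tensorHom, MonoidalCategory.pentagon])
    (triangle := fun (X Y : C) => by
      change bas R (α_ X (𝟙_ C) Y).hom ≫ tens (bas R (𝟙 X)) (bas R (λ_ Y).hom) =
        tens (bas R (ρ_ X).hom) (bas R (𝟙 Y))
      simp only [tens_bas, bas_comp, tensorHom_id, id_tensorHom, MonoidalCategory.triangle])

instance : MonoidalPreadditive (Free R C) where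
  whiskerLeft_zero := fun {X Y Z : C} => map_zero (tens (C := C) (𝟙 (Free.of R X)))
  zero_whiskerRight := fun {X Y Z : C} => LinearMap.map_zero₂ (tens (C := C)) _
  whiskerLeft_add := fun {X Y Z : C} (f g : Free.of R Y ⟶ Free.of R Z) => map_add (tens (C := C) (𝟙 (Free.of R X))) f g
  add_whiskerRight := fun {X Y Z : C} (f g : Free.of R Y ⟶ Free.of R Z) => LinearMap.map_add₂ (tens (C := C)) f g _

theorem braid_nat [BraidedCategory C] {X₁ X₂ Y₁ Y₂ : C} (f : Free.of R X₁ ⟶ Free.of R Y₁)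
    (g : Free.of R X₂ ⟶ Free.of R Y₂) :
    tens f g ≫ bas R (β_ Y₁ Y₂).hom = bas R (β_ X₁ X₂).hom ≫ tens g f := by
  induction f using hom_induction with
  | zero => simp
  | add f g hf hg =>
    simp only [map_add, LinearMap.add_apply, Preadditive.add_comp, Preadditive.comp_add, hf, hg]
  | smul r f =>
  induction g using hom_induction with
  | zero => simp
  | add f g hf hg =>
    simp only [map_add, LinearMap.add_apply, Preadditive.add_comp, Preadditive.comp_add, hf, hg]
  | smul r g =>
  simp only [map_smul, LinearMap.smul_apply, Linear.smul_comp, Linear.comp_smul, tens_bas, bas_comp,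
    BraidedCategory.braiding_naturality, smul_smul]
  rw [mul_comm]

noncomputable instance [SymmetricCategory C] : SymmetricCategory (Free R C) where
  braiding := fun (X Y : C) => basIso (β_ X Y)
  braiding_naturality_right := fun (X _ _ : C) f => braid_nat (𝟙 (Free.of R X)) f
  braiding_naturality_left := fun {_ _ : C} f (Z : C) => braid_nat f (𝟙 (Free.of R Z))
  hexagon_forward := fun (X Y Z : C) => by
    change bas R (α_ X Y Z).hom ≫ bas R (β_ X (Y ⊗ Z)).hom ≫ bas R (α_ Y Z X).hom =
      tens (bas R (β_ X Y).hom) (bas R (𝟙 Z)) ≫ bas R (α_ Y X Z).hom ≫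
      tens (bas R (𝟙 Y)) (bas R (β_ X Z).hom)
    simp only [tens_bas, bas_comp, tensorHom_id, id_tensorHom, BraidedCategory.hexagon_forward]
  hexagon_reverse := fun (X Y Z : C) => by
    change bas R (α_ X Y Z).inv ≫ bas R (β_ (X ⊗ Y) Z).hom ≫ bas R (α_ Z X Y).inv =
      tens (bas R (𝟙 X)) (bas R (β_ Y Z).hom) ≫ bas R (α_ X Z Y).inv ≫
      tens (bas R (β_ X Z).hom) (bas R (𝟙 Y))
    simp only [tens_bas, bas_comp, tensorHom_id, id_tensorHom, BraidedCategory.hexagon_reverse]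
  symmetry := fun (X Y : C) => by
    change bas R (β_ X Y).hom ≫ bas R (β_ Y X).hom = bas R (𝟙 _)
    rw [bas_comp, SymmetricCategory.symmetry]
end
end CategoryTheory.Free
namespace CategoryTheory.Mat_
section
variable {C : Type u} [Category.{v} C] [Preadditive C]

open scoped Classical in
/-- The matrix of morphisms supported on the graph of a map of index sets. -/
noncomputable def ofMap {M N : Mat_ C} (e : M.ι → N.ι) (t : ∀ i, M.X i ⟶ N.X (e i)) : M ⟶ N :=
  fun i j => if h : e i = j then t i ≫ eqToHom (congrArg N.X h) else 0

theorem ofMap_apply {M N : Mat_ C} (e : M.ι → N.ι) (t : ∀ i, M.X i ⟶ N.X (e i)) (i : M.ι) :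
    ofMap e t i (e i) = t i := by
  simp [ofMap]

theorem ofMap_apply_ne {M N : Mat_ C} (e : M.ι → N.ι) (t : ∀ i, M.X i ⟶ N.X (e i)) {i : M.ι}
    {j : N.ι} (h : e i ≠ j) : ofMap e t i j = 0 := by
  simp [ofMap, h]

theorem ofMap_comp {M N K : Mat_ C} (e : M.ι → N.ι) (t : ∀ i, M.X i ⟶ N.X (e i)) (f : N ⟶ K)
    (i : M.ι) (k : K.ι) : (ofMap e t ≫ f) i k = t i ≫ f (e i) k := by
  rw [comp_apply, Finset.sum_eq_single (e i), ofMap_apply]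
  · intro j _ h
    rw [ofMap_apply_ne e t (Ne.symm h), Limits.zero_comp]
  · simp

theorem comp_ofMap {M N K : Mat_ C} (e : M.ι → N.ι) (he : Function.Injective e)
    (t : ∀ i, M.X i ⟶ N.X (e i)) (f : K ⟶ M) (k : K.ι) (i : M.ι) :
    (f ≫ ofMap e t) k (e i) = f k i ≫ t i := by
  rw [comp_apply, Finset.sum_eq_single i, ofMap_apply]
  · intro j _ h
    rw [ofMap_apply_ne e t (fun h' => h (he h')), Limits.comp_zero]
  · simp

theorem id_eq_ofMap (M : Mat_ C) : 𝟙 M = ofMap (fun i => i) fun i => 𝟙 (M.X i) := by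
  ext i j
  by_cases h : i = j
  · subst h
    rw [id_apply_self, ofMap_apply (fun i : M.ι => i)]
  · rw [id_apply_of_ne _ _ _ h, ofMap_apply_ne (fun i : M.ι => i) _ h]

theorem ofMap_comp_ofMap {M N K : Mat_ C} (e : M.ι → N.ι) (t : ∀ i, M.X i ⟶ N.X (e i))
    (e' : N.ι → K.ι) (t' : ∀ i, N.X i ⟶ K.X (e' i)) :
    ofMap e t ≫ ofMap e' t' = ofMap (fun i => e' (e i)) fun i => t i ≫ t' (e i) := by
  ext i k
  rw [ofMap_comp]
  by_cases h : e' (e i) = k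
  · subst h
    rw [ofMap_apply, ofMap_apply (fun i => e' (e i))]
  · rw [ofMap_apply_ne _ _ h, ofMap_apply_ne (fun i => e' (e i)) _ h, Limits.comp_zero]

variable [MonoidalCategory C]

/-- The tensor product of families of objects. -/
abbrev tensObj (M N : Mat_ C) : Mat_ C where
  ι := M.ι × N.ι
  X i := M.X i.1 ⊗ N.X i.2

/-- The tensor product of matrices of morphisms: the Kronecker product. -/
def tensHom {M N M' N' : Mat_ C} (f : M ⟶ N) (g : M' ⟶ N') : tensObj M M' ⟶ tensObj N N' :=
  fun i j => f i.1 j.1 ⊗ₘ g i.2 j.2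

/-- The unit object: the one-term family consisting of the unit object. -/
abbrev tensUnit : Mat_ C where
  ι := PUnit
  X _ := 𝟙_ C

/-- The associativity constraint. -/
noncomputable def assoc (M N K : Mat_ C) :
    tensObj (tensObj M N) K ≅ tensObj M (tensObj N K) where
  hom := ofMap (fun i => (i.1.1, (i.1.2, i.2))) fun i => (α_ (M.X i.1.1) (N.X i.1.2) (K.X i.2)).hom
  inv := ofMap (fun i => ((i.1, i.2.1), i.2.2)) fun i => (α_ (M.X i.1) (N.X i.2.1) (K.X i.2.2)).inv
  hom_inv_id := by
    rw [ofMap_comp_ofMap, id_eq_ofMap]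
    exact congrArg (ofMap _) (funext fun i => Iso.hom_inv_id _)
  inv_hom_id := by
    rw [ofMap_comp_ofMap, id_eq_ofMap]
    exact congrArg (ofMap _) (funext fun i => Iso.inv_hom_id _)

/-- The left unit constraint. -/
noncomputable def left (M : Mat_ C) : tensObj tensUnit M ≅ M where
  hom := ofMap (fun i => i.2) fun i => (λ_ (M.X i.2)).hom
  inv := ofMap (fun i => (PUnit.unit, i)) fun i => (λ_ (M.X i)).inv
  hom_inv_id := by
    rw [ofMap_comp_ofMap, id_eq_ofMap]
    exact congrArg (ofMap _) (funext fun i => Iso.hom_inv_id _)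
  inv_hom_id := by
    rw [ofMap_comp_ofMap, id_eq_ofMap]
    exact congrArg (ofMap _) (funext fun i => Iso.inv_hom_id _)

/-- The right unit constraint. -/
noncomputable def right (M : Mat_ C) : tensObj M tensUnit ≅ M where
  hom := ofMap (fun i => i.1) fun i => (ρ_ (M.X i.1)).hom
  inv := ofMap (fun i => (i, PUnit.unit)) fun i => (ρ_ (M.X i)).inv
  hom_inv_id := by
    rw [ofMap_comp_ofMap, id_eq_ofMap]
    exact congrArg (ofMap _) (funext fun i => Iso.hom_inv_id _)
  inv_hom_id := by
    rw [ofMap_comp_ofMap, id_eq_ofMap]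
    exact congrArg (ofMap _) (funext fun i => Iso.inv_hom_id _)

noncomputable instance : MonoidalCategoryStruct (Mat_ C) where
  tensorObj := tensObj
  tensorHom := tensHom
  whiskerLeft M _ _ f := tensHom (𝟙 M) f
  whiskerRight f M := tensHom f (𝟙 M)
  tensorUnit := tensUnit
  associator := assoc
  leftUnitor := left
  rightUnitor := right

variable [MonoidalPreadditive C]

theorem tensHom_ofMap {M N M' N' : Mat_ C} (e : M.ι → N.ι) (t : ∀ i, M.X i ⟶ N.X (e i))
    (e' : M'.ι → N'.ι) (t' : ∀ i, M'.X i ⟶ N'.X (e' i)) :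
    tensHom (ofMap e t) (ofMap e' t') =
      ofMap (M := tensObj M M') (N := tensObj N N') (fun i => (e i.1, e' i.2))
        fun i => t i.1 ⊗ₘ t' i.2 := by
  ext i j
  obtain ⟨i, i'⟩ := i
  obtain ⟨j, j'⟩ := j
  change ofMap e t i j ⊗ₘ ofMap e' t' i' j' = _
  by_cases h : e i = j
  · by_cases h' : e' i' = j'
    · subst h
      subst h'
      rw [ofMap_apply, ofMap_apply]
      exact (ofMap_apply (M := tensObj M M') (N := tensObj N N') (fun i => (e i.1, e' i.2))
        (fun i => t i.1 ⊗ₘ t' i.2) (i, i')).symm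
    · rw [ofMap_apply_ne _ _ h', MonoidalPreadditive.tensor_zero, ofMap_apply_ne]
      intro h2
      exact h' (Prod.ext_iff.1 h2).2
  · rw [ofMap_apply_ne _ _ h, MonoidalPreadditive.zero_tensor, ofMap_apply_ne]
    intro h2
    exact h (Prod.ext_iff.1 h2).1

theorem tensHom_id (M N : Mat_ C) : tensHom (𝟙 M) (𝟙 N) = 𝟙 (tensObj M N) := by
  rw [id_eq_ofMap, id_eq_ofMap, id_eq_ofMap, tensHom_ofMap]
  exact congrArg (ofMap _) (funext fun i => by simp)

theorem tensHom_comp {X₁ Y₁ Z₁ X₂ Y₂ Z₂ : Mat_ C} (f₁ : X₁ ⟶ Y₁) (f₂ : X₂ ⟶ Y₂) (g₁ : Y₁ ⟶ Z₁)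
    (g₂ : Y₂ ⟶ Z₂) : tensHom f₁ f₂ ≫ tensHom g₁ g₂ = tensHom (f₁ ≫ g₁) (f₂ ≫ g₂) := by
  ext i j
  change ∑ k : Y₁.ι × Y₂.ι, (f₁ i.1 k.1 ⊗ₘ f₂ i.2 k.2) ≫ (g₁ k.1 j.1 ⊗ₘ g₂ k.2 j.2) =
    (∑ k, f₁ i.1 k ≫ g₁ k j.1) ⊗ₘ (∑ k, f₂ i.2 k ≫ g₂ k j.2)
  rw [sum_tensor]
  simp only [tensor_sum, tensorHom_comp_tensorHom, Fintype.sum_prod_type]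

theorem pentagon_aux (W X Y Z : Mat_ C) :
    tensHom (assoc W X Y).hom (𝟙 Z) ≫ (assoc W (tensObj X Y) Z).hom ≫
      tensHom (𝟙 W) (assoc X Y Z).hom =
    (assoc (tensObj W X) Y Z).hom ≫ (assoc W X (tensObj Y Z)).hom := by
  simp only [assoc, id_eq_ofMap, tensHom_ofMap, ofMap_comp_ofMap, tensorHom_id, id_tensorHom]
  refine congrArg (ofMap _) (funext fun i => ?_)
  exact MonoidalCategory.pentagon _ _ _ _

theorem triangle_aux (X Y : Mat_ C) :
    (assoc X tensUnit Y).hom ≫ tensHom (𝟙 X) (left Y).hom = tensHom (right X).hom (𝟙 Y) := by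
  simp only [assoc, left, right, id_eq_ofMap, tensHom_ofMap, ofMap_comp_ofMap, tensorHom_id,
    id_tensorHom]
  refine congrArg (ofMap _) (funext fun i => ?_)
  exact MonoidalCategory.triangle _ _

noncomputable instance : MonoidalCategory (Mat_ C) :=
  MonoidalCategory.ofTensorHom
    (id_tensorHom_id := tensHom_id)
    (id_tensorHom := fun _ _ _ _ => rfl)
    (tensorHom_id := fun _ _ => rfl)
    (tensorHom_comp_tensorHom := tensHom_comp)
    (associator_naturality := fun {X₁ X₂ X₃ Y₁ Y₂ Y₃} f₁ f₂ f₃ => by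
      ext i j
      refine (comp_ofMap (M := tensObj (tensObj Y₁ Y₂) Y₃) (N := tensObj Y₁ (tensObj Y₂ Y₃)) _
        (fun a b h => ?_) _ _ i ((j.1, j.2.1), j.2.2)).trans
        (Eq.trans ?_ (ofMap_comp _ _ _ i j).symm)
      · simp only [Prod.mk.injEq] at h
        exact Prod.ext (Prod.ext h.1 h.2.1) h.2.2
      · exact associator_naturality _ _ _)
    (leftUnitor_naturality := fun {X Y} f => by
      ext i j
      refine (comp_ofMap (M := tensObj tensUnit Y) (N := Y) _
        (fun a b h => Prod.ext rfl h) _ _ i (PUnit.unit, j)).trans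
        (Eq.trans ?_ (ofMap_comp _ _ _ i j).symm)
      change ((𝟙 (tensUnit : Mat_ C) : Hom tensUnit tensUnit) PUnit.unit PUnit.unit ⊗ₘ f i.2 j) ≫
        (λ_ (Y.X j)).hom = (λ_ (X.X i.2)).hom ≫ f i.2 j
      rw [id_apply_self]
      exact (congrArg (· ≫ _) (id_tensorHom _ _)).trans (leftUnitor_naturality _))
    (rightUnitor_naturality := fun {X Y} f => by
      ext i j
      refine (comp_ofMap (M := tensObj Y tensUnit) (N := Y) _
        (fun a b h => Prod.ext h rfl) _ _ i (j, PUnit.unit)).trans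
        (Eq.trans ?_ (ofMap_comp _ _ _ i j).symm)
      change (f i.1 j ⊗ₘ (𝟙 (tensUnit : Mat_ C) : Hom tensUnit tensUnit) PUnit.unit PUnit.unit) ≫
        (ρ_ (Y.X j)).hom = (ρ_ (X.X i.1)).hom ≫ f i.1 j
      rw [id_apply_self]
      exact (congrArg (· ≫ _) (tensorHom_id _ _)).trans (rightUnitor_naturality _))
    (pentagon := pentagon_aux)
    (triangle := triangle_aux)

instance : MonoidalPreadditive (Mat_ C) where
  whiskerLeft_zero {X Y Z} := by
    ext i j
    exact MonoidalPreadditive.tensor_zero ((𝟙 X : Hom X X) i.1 j.1)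
  zero_whiskerRight {X Y Z} := by
    ext i j
    exact MonoidalPreadditive.zero_tensor ((𝟙 X : Hom X X) i.2 j.2)
  whiskerLeft_add {X Y Z} f g := by
    ext i j
    exact MonoidalPreadditive.tensor_add ((𝟙 X : Hom X X) i.1 j.1) (f i.2 j.2) (g i.2 j.2)
  add_whiskerRight {X Y Z} f g := by
    ext i j
    exact MonoidalPreadditive.add_tensor (f i.1 j.1) (g i.1 j.1) ((𝟙 X : Hom X X) i.2 j.2)

/-- The symmetry constraint. -/
noncomputable def braid [BraidedCategory C] (M N : Mat_ C) : tensObj M N ⟶ tensObj N M :=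
  ofMap (fun i => (i.2, i.1)) fun i => (β_ (M.X i.1) (N.X i.2)).hom

theorem braid_nat [BraidedCategory C] {X₁ X₂ Y₁ Y₂ : Mat_ C} (f : X₁ ⟶ Y₁) (g : X₂ ⟶ Y₂) :
    tensHom f g ≫ braid Y₁ Y₂ = braid X₁ X₂ ≫ tensHom g f := by
  ext i j
  refine (comp_ofMap (M := tensObj Y₁ Y₂) (N := tensObj Y₂ Y₁) _
        (fun a b h => Prod.ext (Prod.ext_iff.1 h).2 (Prod.ext_iff.1 h).1) _ _ i (j.2, j.1)).trans
        (Eq.trans ?_ (ofMap_comp _ _ _ i j).symm)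
  exact BraidedCategory.braiding_naturality _ _

theorem braid_symm [SymmetricCategory C] (M N : Mat_ C) : braid M N ≫ braid N M = 𝟙 _ := by
  rw [braid, braid, ofMap_comp_ofMap, id_eq_ofMap]
  exact congrArg (ofMap _) (funext fun i => SymmetricCategory.symmetry _ _)

theorem hex_aux [BraidedCategory C] (X Y Z : Mat_ C) :
    (assoc X Y Z).hom ≫ braid X (tensObj Y Z) ≫ (assoc Y Z X).hom =
      tensHom (braid X Y) (𝟙 Z) ≫ (assoc Y X Z).hom ≫ tensHom (𝟙 Y) (braid X Z) := by
  simp only [assoc, braid, id_eq_ofMap, tensHom_ofMap, ofMap_comp_ofMap, tensorHom_id,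
    id_tensorHom]
  refine congrArg (ofMap _) (funext fun i => ?_)
  exact BraidedCategory.hexagon_forward _ _ _

theorem hex_aux' [BraidedCategory C] (X Y Z : Mat_ C) :
    (assoc X Y Z).inv ≫ braid (tensObj X Y) Z ≫ (assoc Z X Y).inv =
      tensHom (𝟙 X) (braid Y Z) ≫ (assoc X Z Y).inv ≫ tensHom (braid X Z) (𝟙 Y) := by
  simp only [assoc, braid, id_eq_ofMap, tensHom_ofMap, ofMap_comp_ofMap, tensorHom_id,
    id_tensorHom]
  refine congrArg (ofMap _) (funext fun i => ?_)
  exact BraidedCategory.hexagon_reverse _ _ _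

noncomputable instance [SymmetricCategory C] : SymmetricCategory (Mat_ C) where
  braiding M N := ⟨braid M N, braid N M, braid_symm M N, braid_symm N M⟩
  braiding_naturality_right X _ _ f := braid_nat (𝟙 X) f
  braiding_naturality_left f Z := braid_nat f (𝟙 Z)
  hexagon_forward := hex_aux
  hexagon_reverse := hex_aux'
  symmetry := braid_symm

/-- Matrices of morphisms of an `R`-linear category are added and scaled entrywise. -/
instance (R : Type w) [Ring R] (C : Type u) [Category.{v} C] [Preadditive C] [Linear R C] :
    Linear R (Mat_ C) where
  homModule M N := inferInstanceAs (Module R (∀ (i : M.ι) (j : N.ι), M.X i ⟶ N.X j))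
  smul_comp M N K r f g := by
    ext i k
    change ∑ j, (r • f i j) ≫ g j k = r • ∑ j, f i j ≫ g j k
    simp [Finset.smul_sum]
  comp_smul M N K f r g := by
    ext i k
    change ∑ j, f i j ≫ (r • g j k) = r • ∑ j, f i j ≫ g j k
    simp [Finset.smul_sum]
end
end CategoryTheory.Mat_
namespace CategoryTheory.Idempotents.Karoubi
section
variable {C : Type u} [Category.{v} C]

/-- Morphisms of the Karoubi envelope of a linear category are scaled as those of the category. -/
instance (R : Type w) [Semiring R] [Preadditive C] [Linear R C] : Linear R (Karoubi C) where
  homModule P Q :=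
    { smul := fun r f => ⟨r • f.f, by rw [Linear.smul_comp, Linear.comp_smul, f.comm]⟩
      one_smul := fun f => hom_ext _ _ (one_smul R f.f)
      mul_smul := fun r s f => hom_ext _ _ (mul_smul r s f.f)
      smul_zero := fun r => hom_ext _ _ (smul_zero r)
      smul_add := fun r f g => hom_ext _ _ (smul_add r f.f g.f)
      add_smul := fun r s f => hom_ext _ _ (add_smul r s f.f)
      zero_smul := fun f => hom_ext _ _ (zero_smul R f.f) }
  smul_comp _ _ _ r f g := hom_ext _ _ (Linear.smul_comp _ _ _ r f.f g.f)
  comp_smul _ _ _ f r g := hom_ext _ _ (Linear.comp_smul _ _ _ f.f r g.f)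

variable [MonoidalCategory C]

/-- The tensor product of two formal images of idempotents. -/
abbrev tensObj (P Q : Karoubi C) : Karoubi C where
  X := P.X ⊗ Q.X
  p := P.p ⊗ₘ Q.p
  idem := by rw [tensorHom_comp_tensorHom, P.idem, Q.idem]

/-- The tensor product of morphisms. -/
abbrev tensHom {P Q P' Q' : Karoubi C} (f : P ⟶ Q) (g : P' ⟶ Q') :
    tensObj P P' ⟶ tensObj Q Q' where
  f := f.f ⊗ₘ g.f
  comm := by rw [tensorHom_comp_tensorHom, tensorHom_comp_tensorHom, f.comm, g.comm]

/-- The unit object. -/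
abbrev tensUnit : Karoubi C where
  X := 𝟙_ C
  p := 𝟙 _

/-- The associativity constraint. -/
def assoc (P Q R : Karoubi C) : tensObj (tensObj P Q) R ≅ tensObj P (tensObj Q R) where
  hom :=
    { f := (α_ P.X Q.X R.X).hom ≫ (P.p ⊗ₘ (Q.p ⊗ₘ R.p))
      comm := by
        simp only [associator_naturality_assoc, Category.assoc, tensorHom_comp_tensorHom, idem] }
  inv :=
    { f := (α_ P.X Q.X R.X).inv ≫ ((P.p ⊗ₘ Q.p) ⊗ₘ R.p)
      comm := by
        simp only [associator_inv_naturality_assoc, Category.assoc, tensorHom_comp_tensorHom, idem] }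
  hom_inv_id := by
    ext
    simp only [comp_f, id_f, Category.assoc, associator_inv_naturality_assoc,
      Iso.hom_inv_id_assoc, tensorHom_comp_tensorHom, idem]
  inv_hom_id := by
    ext
    simp only [comp_f, id_f, Category.assoc, associator_naturality_assoc,
      Iso.inv_hom_id_assoc, tensorHom_comp_tensorHom, idem]

/-- The left unit constraint. -/
def left (P : Karoubi C) : tensObj tensUnit P ≅ P where
  hom :=
    { f := (λ_ P.X).hom ≫ P.p
      comm := by simp }
  inv :=
    { f := P.p ≫ (λ_ P.X).inv
      comm := by simp }
  hom_inv_id := by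
    ext
    simp
  inv_hom_id := by
    ext
    simp

/-- The right unit constraint. -/
def right (P : Karoubi C) : tensObj P tensUnit ≅ P where
  hom :=
    { f := (ρ_ P.X).hom ≫ P.p
      comm := by simp }
  inv :=
    { f := P.p ≫ (ρ_ P.X).inv
      comm := by simp }
  hom_inv_id := by
    ext
    simp
  inv_hom_id := by
    ext
    simp

instance : MonoidalCategoryStruct (Karoubi C) where
  tensorObj := tensObj
  tensorHom := tensHom
  whiskerLeft P _ _ f := tensHom (𝟙 P) f
  whiskerRight f P := tensHom f (𝟙 P)
  tensorUnit := tensUnit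
  associator := assoc
  leftUnitor := left
  rightUnitor := right

theorem pentagon_aux (W X Y Z : Karoubi C) :
    tensHom (assoc W X Y).hom (𝟙 Z) ≫ (assoc W (tensObj X Y) Z).hom ≫
      tensHom (𝟙 W) (assoc X Y Z).hom =
    (assoc (tensObj W X) Y Z).hom ≫ (assoc W X (tensObj Y Z)).hom := by
  ext
  have h1 : (α_ W.X X.X Y.X).hom ≫ (W.p ⊗ₘ (X.p ⊗ₘ Y.p)) ⊗ₘ Z.p =
    ((α_ W.X X.X Y.X).hom ▷ Z.X) ≫ ((W.p ⊗ₘ (X.p ⊗ₘ Y.p)) ⊗ₘ Z.p) := by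
    rw [← tensorHom_id, tensorHom_comp_tensorHom, Category.id_comp]
  have h2 : W.p ⊗ₘ ((α_ X.X Y.X Z.X).hom ≫ (X.p ⊗ₘ (Y.p ⊗ₘ Z.p))) =
    (W.X ◁ (α_ X.X Y.X Z.X).hom) ≫ (W.p ⊗ₘ (X.p ⊗ₘ (Y.p ⊗ₘ Z.p))) := by
    rw [← id_tensorHom, tensorHom_comp_tensorHom, Category.id_comp]
  have h3 : (W.p ⊗ₘ ((X.p ⊗ₘ Y.p) ⊗ₘ Z.p)) ≫ (W.X ◁ (α_ X.X Y.X Z.X).hom) =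
    (W.X ◁ (α_ X.X Y.X Z.X).hom) ≫ (W.p ⊗ₘ (X.p ⊗ₘ (Y.p ⊗ₘ Z.p))) := by
    rw [← id_tensorHom, tensorHom_comp_tensorHom, tensorHom_comp_tensorHom, associator_naturality,
      Category.id_comp, Category.comp_id]
  simp only [assoc, comp_f, id_f, h1, h2, Category.assoc]
  simp only [associator_naturality_assoc, idem, reassoc_of% h3,
    tensorHom_comp_tensorHom, MonoidalCategory.pentagon_assoc]

theorem triangle_aux (X Y : Karoubi C) :
    (assoc X tensUnit Y).hom ≫ tensHom (𝟙 X) (left Y).hom = tensHom (right X).hom (𝟙 Y) := by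
  ext
  have h1 : (X.p ⊗ₘ (𝟙 (𝟙_ C) ⊗ₘ Y.p)) ≫ (X.p ⊗ₘ ((λ_ Y.X).hom ≫ Y.p)) =
    (X.X ◁ (λ_ Y.X).hom) ≫ (X.p ⊗ₘ Y.p) := by
    rw [tensorHom_comp_tensorHom, ← id_tensorHom, tensorHom_comp_tensorHom, idem, id_tensorHom,
      leftUnitor_naturality_assoc, idem, Category.id_comp]
  have h2 : ((ρ_ X.X).hom ≫ X.p) ⊗ₘ Y.p = ((ρ_ X.X).hom ▷ Y.X) ≫ (X.p ⊗ₘ Y.p) := by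
    rw [← tensorHom_id, tensorHom_comp_tensorHom, Category.id_comp]
  simp only [assoc, left, right, comp_f, id_f, h1, h2, Category.assoc,
    MonoidalCategory.triangle_assoc]

instance : MonoidalCategory (Karoubi C) :=
  MonoidalCategory.ofTensorHom
    (id_tensorHom_id := fun _ _ => rfl)
    (id_tensorHom := fun _ _ _ _ => rfl)
    (tensorHom_id := fun _ _ => rfl)
    (tensorHom_comp_tensorHom := fun _ _ _ _ =>
      hom_ext _ _ (tensorHom_comp_tensorHom _ _ _ _))
    (associator_naturality := fun {X₁ X₂ X₃ Y₁ Y₂ Y₃} f₁ f₂ f₃ => by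
      apply hom_ext
      change ((f₁.f ⊗ₘ f₂.f) ⊗ₘ f₃.f) ≫ (α_ _ _ _).hom ≫ (Y₁.p ⊗ₘ (Y₂.p ⊗ₘ Y₃.p)) =
        ((α_ _ _ _).hom ≫ (X₁.p ⊗ₘ (X₂.p ⊗ₘ X₃.p))) ≫ (f₁.f ⊗ₘ (f₂.f ⊗ₘ f₃.f))
      simp only [associator_naturality_assoc, Category.assoc, tensorHom_comp_tensorHom, p_comp,
        comp_p])
    (leftUnitor_naturality := fun {X Y} f => by
      apply hom_ext
      change (𝟙 (𝟙_ C) ⊗ₘ f.f) ≫ (λ_ _).hom ≫ Y.p = ((λ_ _).hom ≫ X.p) ≫ f.f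
      simp)
    (rightUnitor_naturality := fun {X Y} f => by
      apply hom_ext
      change (f.f ⊗ₘ 𝟙 (𝟙_ C)) ≫ (ρ_ _).hom ≫ Y.p = ((ρ_ _).hom ≫ X.p) ≫ f.f
      simp)
    (pentagon := pentagon_aux)
    (triangle := triangle_aux)

/-- The symmetry constraint. -/
abbrev braid [BraidedCategory C] (P Q : Karoubi C) : tensObj P Q ⟶ tensObj Q P where
  f := (β_ P.X Q.X).hom ≫ (Q.p ⊗ₘ P.p)
  comm := by
    simp only [Category.assoc, BraidedCategory.braiding_naturality_assoc, tensorHom_comp_tensorHom,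
      idem]

theorem braid_nat [BraidedCategory C] {X₁ X₂ Y₁ Y₂ : Karoubi C} (f : X₁ ⟶ Y₁) (g : X₂ ⟶ Y₂) :
    tensHom f g ≫ braid Y₁ Y₂ = braid X₁ X₂ ≫ tensHom g f := by
  ext
  simp only [comp_f, Category.assoc, BraidedCategory.braiding_naturality_assoc,
    tensorHom_comp_tensorHom, p_comp, comp_p]

theorem braid_symm [SymmetricCategory C] (P Q : Karoubi C) : braid P Q ≫ braid Q P = 𝟙 _ := by
  ext
  simp only [comp_f, id_f, Category.assoc, BraidedCategory.braiding_naturality_assoc,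
    tensorHom_comp_tensorHom, idem, SymmetricCategory.symmetry_assoc]

theorem hex_aux [BraidedCategory C] (X Y Z : Karoubi C) :
    (assoc X Y Z).hom ≫ braid X (tensObj Y Z) ≫ (assoc Y Z X).hom =
      tensHom (braid X Y) (𝟙 Z) ≫ (assoc Y X Z).hom ≫ tensHom (𝟙 Y) (braid X Z) := by
  ext
  have h1 : ((β_ X.X Y.X).hom ≫ (Y.p ⊗ₘ X.p)) ⊗ₘ Z.p =
    ((β_ X.X Y.X).hom ▷ Z.X) ≫ ((Y.p ⊗ₘ X.p) ⊗ₘ Z.p) := by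
    rw [← tensorHom_id, tensorHom_comp_tensorHom, Category.id_comp]
  have h2 : (Y.p ⊗ₘ (X.p ⊗ₘ Z.p)) ≫ (Y.p ⊗ₘ ((β_ X.X Z.X).hom ≫ (Z.p ⊗ₘ X.p))) =
    (Y.X ◁ (β_ X.X Z.X).hom) ≫ (Y.p ⊗ₘ (Z.p ⊗ₘ X.p)) := by
    rw [← id_tensorHom, tensorHom_comp_tensorHom, tensorHom_comp_tensorHom,
      BraidedCategory.braiding_naturality_assoc, idem, tensorHom_comp_tensorHom, idem, idem,
      Category.id_comp]
  have h3 : (Y.p ⊗ₘ (X.p ⊗ₘ Z.p)) ≫ (Y.X ◁ (β_ X.X Z.X).hom) ≫ (Y.p ⊗ₘ (Z.p ⊗ₘ X.p)) =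
    (Y.X ◁ (β_ X.X Z.X).hom) ≫ (Y.p ⊗ₘ (Z.p ⊗ₘ X.p)) := by
    rw [← h2, tensorHom_comp_tensorHom_assoc, idem, tensorHom_comp_tensorHom X.p, idem, idem]
  simp only [assoc, comp_f, id_f, h1, Category.assoc, BraidedCategory.braiding_naturality_assoc,
    associator_naturality_assoc, tensorHom_comp_tensorHom, idem, h2,
    BraidedCategory.hexagon_forward_assoc]
  rw [h3]

theorem hex_aux' [BraidedCategory C] (X Y Z : Karoubi C) :
    (assoc X Y Z).inv ≫ braid (tensObj X Y) Z ≫ (assoc Z X Y).inv =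
      tensHom (𝟙 X) (braid Y Z) ≫ (assoc X Z Y).inv ≫ tensHom (braid X Z) (𝟙 Y) := by
  ext
  have h1 : X.p ⊗ₘ ((β_ Y.X Z.X).hom ≫ (Z.p ⊗ₘ Y.p)) =
    (X.X ◁ (β_ Y.X Z.X).hom) ≫ (X.p ⊗ₘ (Z.p ⊗ₘ Y.p)) := by
    rw [← id_tensorHom, tensorHom_comp_tensorHom, Category.id_comp]
  have h2 : ((X.p ⊗ₘ Z.p) ⊗ₘ Y.p) ≫ (((β_ X.X Z.X).hom ≫ (Z.p ⊗ₘ X.p)) ⊗ₘ Y.p) =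
    ((β_ X.X Z.X).hom ▷ Y.X) ≫ ((Z.p ⊗ₘ X.p) ⊗ₘ Y.p) := by
    rw [← tensorHom_id, tensorHom_comp_tensorHom, tensorHom_comp_tensorHom,
      BraidedCategory.braiding_naturality_assoc, idem, tensorHom_comp_tensorHom, idem, idem,
      Category.id_comp]
  have h3 : ((X.p ⊗ₘ Z.p) ⊗ₘ Y.p) ≫ ((β_ X.X Z.X).hom ▷ Y.X) ≫ ((Z.p ⊗ₘ X.p) ⊗ₘ Y.p) =
    ((β_ X.X Z.X).hom ▷ Y.X) ≫ ((Z.p ⊗ₘ X.p) ⊗ₘ Y.p) := by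
    rw [← h2, tensorHom_comp_tensorHom_assoc, idem, tensorHom_comp_tensorHom X.p, idem, idem]
  simp only [assoc, comp_f, id_f, h1, Category.assoc, BraidedCategory.braiding_naturality_assoc,
    associator_inv_naturality_assoc, tensorHom_comp_tensorHom, idem, h2, BraidedCategory.hexagon_reverse_assoc]
  rw [h3]

instance [SymmetricCategory C] : SymmetricCategory (Karoubi C) where
  braiding P Q := ⟨braid P Q, braid Q P, braid_symm P Q, braid_symm Q P⟩
  braiding_naturality_right X _ _ f := braid_nat (𝟙 X) f
  braiding_naturality_left f Z := braid_nat f (𝟙 Z)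
  hexagon_forward := hex_aux
  hexagon_reverse := hex_aux'
  symmetry := braid_symm
end
end CategoryTheory.Idempotents.Karoubi

/-- The object `V(A)` of the category `𝒱`, for a finite set `A`. -/
structure VObj where
  /-- the finite set indexing the basis -/
  A : Type
  [fin : Fintype A]
  [dec : DecidableEq A]

namespace VObj

attribute [instance] VObj.fin VObj.dec

/-- A map `V(A) ⟶ V(B)` is a `B × A` matrix over the field with two elements, and composition is
matrix multiplication. -/
instance : Category VObj where
  Hom V W := Matrix W.A V.A (ZMod 2)
  id V := (1 : Matrix V.A V.A (ZMod 2))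
  comp {U V W} f g := (g : Matrix W.A V.A (ZMod 2)) * (f : Matrix V.A U.A (ZMod 2))
  id_comp _ := Matrix.mul_one _
  comp_id _ := Matrix.one_mul _
  assoc _ _ _ := (Matrix.mul_assoc _ _ _).symm

/-- The matrix of a map of bases. -/
def ofMap {V W : VObj} (e : V.A → W.A) : V ⟶ W :=
  (Matrix.of fun b a => if e a = b then 1 else 0 : Matrix W.A V.A (ZMod 2))

theorem ofMap_comp {U V W : VObj} (e : V.A → W.A) (he : Function.Injective e) (f : U ⟶ V)
    (b : V.A) (a : U.A) : (f ≫ ofMap e : Matrix W.A U.A (ZMod 2)) (e b) a =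
      (f : Matrix V.A U.A (ZMod 2)) b a := by
  change ∑ x : V.A, (if e x = e b then (1 : ZMod 2) else 0) *
    (f : Matrix V.A U.A (ZMod 2)) x a = _
  simp [he.eq_iff]

theorem comp_ofMap {U V W : VObj} (e : U.A → V.A) (f : V ⟶ W)
    (b : W.A) (a : U.A) : (ofMap e ≫ f : Matrix W.A U.A (ZMod 2)) b a =
      (f : Matrix W.A V.A (ZMod 2)) b (e a) := by
  change ∑ x : V.A, (f : Matrix W.A V.A (ZMod 2)) b x * (if e a = x then (1 : ZMod 2) else 0) = _
  simp

theorem ofMap_comp_ofMap {U V W : VObj} (e : U.A → V.A) (e' : V.A → W.A) :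
    ofMap e ≫ ofMap e' = ofMap fun a => e' (e a) := by
  refine Matrix.ext fun b a => (comp_ofMap e (ofMap e') b a).trans ?_
  rfl

theorem id_eq_ofMap (V : VObj) : 𝟙 V = ofMap fun a => a := by
  refine Matrix.ext fun b a => ?_
  change (1 : Matrix V.A V.A (ZMod 2)) b a = if a = b then 1 else 0
  rw [Matrix.one_apply]
  exact if_congr eq_comm rfl rfl

/-- The isomorphism given by a bijection of bases. -/
def isoOfEquiv {V W : VObj} (e : V.A ≃ W.A) : V ≅ W where
  hom := ofMap e
  inv := ofMap e.symm
  hom_inv_id := by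
    rw [ofMap_comp_ofMap, id_eq_ofMap]
    exact congrArg ofMap (funext e.symm_apply_apply)
  inv_hom_id := by
    rw [ofMap_comp_ofMap, id_eq_ofMap]
    exact congrArg ofMap (funext e.apply_symm_apply)

/-- `V(A) ⊗ V(B) = V(A × B)`. -/
abbrev tensObj (V W : VObj) : VObj := ⟨V.A × W.A⟩

/-- The tensor product of morphisms is the Kronecker product of matrices. -/
def tensHom {V W V' W' : VObj} (f : V ⟶ W) (g : V' ⟶ W') : tensObj V V' ⟶ tensObj W W' :=
  Matrix.kroneckerMap (· * ·) (f : Matrix W.A V.A (ZMod 2)) (g : Matrix W'.A V'.A (ZMod 2))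

/-- The unit object `V(pt)`. -/
abbrev tensUnit : VObj := ⟨PUnit⟩

instance : MonoidalCategoryStruct VObj where
  tensorObj := tensObj
  tensorHom := tensHom
  whiskerLeft V _ _ f := tensHom (𝟙 V) f
  whiskerRight f V := tensHom f (𝟙 V)
  tensorUnit := tensUnit
  associator U V W := isoOfEquiv (V := tensObj (tensObj U V) W) (W := tensObj U (tensObj V W))
    (Equiv.prodAssoc U.A V.A W.A)
  leftUnitor V := isoOfEquiv (V := tensObj tensUnit V) (Equiv.punitProd V.A)
  rightUnitor V := isoOfEquiv (V := tensObj V tensUnit) (Equiv.prodPUnit V.A)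

theorem tensHom_ofMap {V W V' W' : VObj} (e : V.A → W.A) (e' : V'.A → W'.A) :
    tensHom (ofMap e) (ofMap e') =
      ofMap (V := tensObj V V') (W := tensObj W W') fun a => (e a.1, e' a.2) := by
  refine Matrix.ext fun b a => ?_
  change (if e a.1 = b.1 then (1 : ZMod 2) else 0) * (if e' a.2 = b.2 then 1 else 0) =
    if (e a.1, e' a.2) = b then 1 else 0
  simp only [Prod.ext_iff]
  split_ifs <;> simp_all

theorem tensHom_id (V W : VObj) : tensHom (𝟙 V) (𝟙 W) = 𝟙 (tensObj V W) := by
  rw [id_eq_ofMap, id_eq_ofMap, id_eq_ofMap, tensHom_ofMap]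

theorem tensHom_comp {X₁ Y₁ Z₁ X₂ Y₂ Z₂ : VObj} (f₁ : X₁ ⟶ Y₁) (f₂ : X₂ ⟶ Y₂) (g₁ : Y₁ ⟶ Z₁)
    (g₂ : Y₂ ⟶ Z₂) : tensHom f₁ f₂ ≫ tensHom g₁ g₂ = tensHom (f₁ ≫ g₁) (f₂ ≫ g₂) :=
  (Matrix.mul_kronecker_mul (g₁ : Matrix Z₁.A Y₁.A (ZMod 2)) (f₁ : Matrix Y₁.A X₁.A (ZMod 2))
    (g₂ : Matrix Z₂.A Y₂.A (ZMod 2)) (f₂ : Matrix Y₂.A X₂.A (ZMod 2))).symm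

instance : MonoidalCategory VObj :=
  MonoidalCategory.ofTensorHom
    (id_tensorHom_id := tensHom_id)
    (id_tensorHom := fun _ _ _ _ => rfl)
    (tensorHom_id := fun _ _ => rfl)
    (tensorHom_comp_tensorHom := tensHom_comp)
    (associator_naturality := fun {X₁ X₂ X₃ Y₁ Y₂ Y₃} f₁ f₂ f₃ => by
      refine Matrix.ext fun b a => ?_
      refine (ofMap_comp (V := tensObj (tensObj Y₁ Y₂) Y₃) (W := tensObj Y₁ (tensObj Y₂ Y₃))
        _ (Equiv.prodAssoc Y₁.A Y₂.A Y₃.A).injective _ ((b.1, b.2.1), b.2.2) a).trans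
        (Eq.trans ?_ (comp_ofMap (U := tensObj (tensObj X₁ X₂) X₃)
        (V := tensObj X₁ (tensObj X₂ X₃)) _ _ b a).symm)
      exact mul_assoc _ _ _)
    (leftUnitor_naturality := fun {X Y} f => by
      refine Matrix.ext fun b a => ?_
      refine (ofMap_comp (V := tensObj tensUnit Y) (W := Y)
        _ (Equiv.punitProd Y.A).injective _ (PUnit.unit, b) a).trans
        (Eq.trans ?_ (comp_ofMap (U := tensObj tensUnit X) (V := X) _ _ b a).symm)
      exact one_mul _)
    (rightUnitor_naturality := fun {X Y} f => by
      refine Matrix.ext fun b a => ?_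
      refine (ofMap_comp (V := tensObj Y tensUnit) (W := Y)
        _ (Equiv.prodPUnit Y.A).injective _ (b, PUnit.unit) a).trans
        (Eq.trans ?_ (comp_ofMap (U := tensObj X tensUnit) (V := X) _ _ b a).symm)
      exact mul_one _)
    (pentagon := fun W X Y Z => by
      change tensHom (ofMap _) (𝟙 _) ≫ ofMap _ ≫ tensHom (𝟙 _) (ofMap _) = ofMap _ ≫ ofMap _
      simp only [id_eq_ofMap, tensHom_ofMap, ofMap_comp_ofMap]
      rfl)
    (triangle := fun X Y => by
      change ofMap _ ≫ tensHom (𝟙 _) (ofMap _) = tensHom (ofMap _) (𝟙 _)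
      simp only [id_eq_ofMap, tensHom_ofMap, ofMap_comp_ofMap]
      rfl)

theorem braid_nat {X₁ X₂ Y₁ Y₂ : VObj} (f : X₁ ⟶ Y₁) (g : X₂ ⟶ Y₂) :
    tensHom f g ≫ ofMap (V := tensObj Y₁ Y₂) (W := tensObj Y₂ Y₁) (Equiv.prodComm Y₁.A Y₂.A) =
      ofMap (V := tensObj X₁ X₂) (W := tensObj X₂ X₁) (Equiv.prodComm X₁.A X₂.A) ≫
        tensHom g f := by
  refine Matrix.ext fun b a => ?_
  refine (ofMap_comp (V := tensObj Y₁ Y₂) (W := tensObj Y₂ Y₁)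
    _ (Equiv.prodComm Y₁.A Y₂.A).injective _ (b.2, b.1) a).trans
    (Eq.trans ?_ (comp_ofMap (U := tensObj X₁ X₂) (V := tensObj X₂ X₁) _ _ b a).symm)
  exact mul_comm _ _

instance : SymmetricCategory VObj where
  braiding V W := isoOfEquiv (V := tensObj V W) (W := tensObj W V) (Equiv.prodComm V.A W.A)
  braiding_naturality_right X _ _ f := braid_nat (𝟙 X) f
  braiding_naturality_left f Z := braid_nat f (𝟙 Z)
  hexagon_forward X Y Z := by
    change ofMap _ ≫ ofMap _ ≫ ofMap _ =
      tensHom (ofMap _) (𝟙 _) ≫ ofMap _ ≫ tensHom (𝟙 _) (ofMap _)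
    simp only [id_eq_ofMap, tensHom_ofMap, ofMap_comp_ofMap]
    rfl
  hexagon_reverse X Y Z := by
    change ofMap _ ≫ ofMap _ ≫ ofMap _ =
      tensHom (𝟙 _) (ofMap _) ≫ ofMap _ ≫ tensHom (ofMap _) (𝟙 _)
    simp only [id_eq_ofMap, tensHom_ofMap, ofMap_comp_ofMap]
    rfl
  symmetry X Y := by
    change ofMap _ ≫ ofMap _ = 𝟙 _
    rw [ofMap_comp_ofMap, id_eq_ofMap]
    rfl

/-- The zero matrix. -/
def zeroHom (V W : VObj) : V ⟶ W := (0 : Matrix W.A V.A (ZMod 2))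

theorem comp_zeroHom {U V W : VObj} (f : U ⟶ V) : f ≫ zeroHom V W = zeroHom U W :=
  Matrix.zero_mul _

theorem zeroHom_tens {V W V' W' : VObj} (f : V' ⟶ W') :
    zeroHom V W ⊗ₘ f = zeroHom (V ⊗ V') (W ⊗ W') :=
  Matrix.ext fun _ _ => zero_mul _

theorem tens_zeroHom {V W V' W' : VObj} (f : V' ⟶ W') :
    f ⊗ₘ zeroHom V W = zeroHom (V' ⊗ V) (W' ⊗ W) :=
  Matrix.ext fun _ _ => mul_zero _

end VObj

section UnitalSubcategory

variable {D : Type u} [Category.{v} D] [MonoidalCategory D]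

/-- A full subcategory which is closed under the tensor product and has a unit object of its own,
given as a direct factor of the ambient unit object that acts as the identity on the
subcategory. -/
structure TensorCorner (P : ObjectProperty D) where
  /-- the tensor product preserves the subcategory -/
  tens : ∀ {X Y : D}, P X → P Y → P (X ⊗ Y)
  /-- the new unit object -/
  one : D
  /-- the new unit object belongs to the subcategory -/
  prop_one : P one
  /-- the inclusion of the direct factor -/
  incl : one ⟶ 𝟙_ D
  /-- the projection to the direct factor -/
  proj : 𝟙_ D ⟶ one
  incl_proj : incl ≫ proj = 𝟙 one
  left : ∀ X, P X → (proj ≫ incl) ▷ X = 𝟙 (𝟙_ D ⊗ X)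
  right : ∀ X, P X → X ◁ (proj ≫ incl) = 𝟙 (X ⊗ 𝟙_ D)

namespace TensorCorner

variable {P : ObjectProperty D} (T : TensorCorner P)

/-- The left unit constraint of the subcategory. -/
def leftIso (X : D) (h : P X) : T.one ⊗ X ≅ X where
  hom := T.incl ▷ X ≫ (λ_ X).hom
  inv := (λ_ X).inv ≫ T.proj ▷ X
  hom_inv_id := by
    rw [Category.assoc, Iso.hom_inv_id_assoc, ← comp_whiskerRight, T.incl_proj, id_whiskerRight]
  inv_hom_id := by
    rw [Category.assoc, ← comp_whiskerRight_assoc, T.left X h, Category.id_comp, Iso.inv_hom_id]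

/-- The right unit constraint of the subcategory. -/
def rightIso (X : D) (h : P X) : X ⊗ T.one ≅ X where
  hom := X ◁ T.incl ≫ (ρ_ X).hom
  inv := (ρ_ X).inv ≫ X ◁ T.proj
  hom_inv_id := by
    rw [Category.assoc, Iso.hom_inv_id_assoc, ← whiskerLeft_comp, T.incl_proj, whiskerLeft_id]
  inv_hom_id := by
    rw [Category.assoc, ← whiskerLeft_comp_assoc, T.right X h, Category.id_comp, Iso.inv_hom_id]

/-- The tensor product, associativity constraint and unit constraints of the subcategory. -/
@[reducible] def monoidalStruct : MonoidalCategoryStruct P.FullSubcategory where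
  tensorObj X Y := ⟨X.obj ⊗ Y.obj, T.tens X.property Y.property⟩
  tensorHom f g := ObjectProperty.homMk (f.hom ⊗ₘ g.hom)
  whiskerLeft X _ _ f := ObjectProperty.homMk (X.obj ◁ f.hom)
  whiskerRight f X := ObjectProperty.homMk (f.hom ▷ X.obj)
  tensorUnit := ⟨T.one, T.prop_one⟩
  associator X Y Z := P.isoMk (α_ X.obj Y.obj Z.obj)
  leftUnitor X := P.isoMk (T.leftIso X.obj X.property)
  rightUnitor X := P.isoMk (T.rightIso X.obj X.property)

/-- The monoidal structure of the subcategory. -/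
@[reducible] def monoidal : MonoidalCategory P.FullSubcategory :=
  letI := T.monoidalStruct
  MonoidalCategory.ofTensorHom
    (id_tensorHom_id := fun X Y => ObjectProperty.hom_ext _ (id_tensorHom_id X.obj Y.obj))
    (id_tensorHom := fun X _ _ f => ObjectProperty.hom_ext _ (id_tensorHom X.obj f.hom))
    (tensorHom_id := fun f Y => ObjectProperty.hom_ext _ (tensorHom_id f.hom Y.obj))
    (tensorHom_comp_tensorHom := fun f₁ f₂ g₁ g₂ => ObjectProperty.hom_ext _
      (tensorHom_comp_tensorHom f₁.hom f₂.hom g₁.hom g₂.hom))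
    (associator_naturality := fun f₁ f₂ f₃ => ObjectProperty.hom_ext _
      (associator_naturality f₁.hom f₂.hom f₃.hom))
    (leftUnitor_naturality := fun {X Y} f => ObjectProperty.hom_ext _ (by
      change (𝟙 T.one ⊗ₘ f.hom) ≫ T.incl ▷ Y.obj ≫ (λ_ Y.obj).hom =
        (T.incl ▷ X.obj ≫ (λ_ X.obj).hom) ≫ f.hom
      rw [id_tensorHom, whisker_exchange_assoc, leftUnitor_naturality, Category.assoc]))
    (rightUnitor_naturality := fun {X Y} f => ObjectProperty.hom_ext _ (by
      change (f.hom ⊗ₘ 𝟙 T.one) ≫ Y.obj ◁ T.incl ≫ (ρ_ Y.obj).hom =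
        (X.obj ◁ T.incl ≫ (ρ_ X.obj).hom) ≫ f.hom
      rw [tensorHom_id, ← whisker_exchange_assoc, rightUnitor_naturality, Category.assoc]))
    (pentagon := fun W X Y Z => ObjectProperty.hom_ext _ (by
      change ((α_ W.obj X.obj Y.obj).hom ⊗ₘ 𝟙 Z.obj) ≫ (α_ W.obj (X.obj ⊗ Y.obj) Z.obj).hom ≫
        (𝟙 W.obj ⊗ₘ (α_ X.obj Y.obj Z.obj).hom) = _
      rw [id_tensorHom, tensorHom_id]
      exact MonoidalCategory.pentagon W.obj X.obj Y.obj Z.obj))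
    (triangle := fun X Y => ObjectProperty.hom_ext _ (by
      change (α_ X.obj T.one Y.obj).hom ≫ (𝟙 X.obj ⊗ₘ (T.incl ▷ Y.obj ≫ (λ_ Y.obj).hom)) =
        (X.obj ◁ T.incl ≫ (ρ_ X.obj).hom) ⊗ₘ 𝟙 Y.obj
      rw [id_tensorHom, tensorHom_id, whiskerLeft_comp, comp_whiskerRight,
        ← associator_naturality_middle_assoc, MonoidalCategory.triangle]))

/-- The symmetry of the subcategory is that of the ambient category. -/
@[reducible] def symmetric [SymmetricCategory D] :
    letI := T.monoidal
    SymmetricCategory P.FullSubcategory :=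
  letI := T.monoidal
  { braiding := fun X Y => P.isoMk (β_ X.obj Y.obj)
    braiding_naturality_right := fun X _ _ f => ObjectProperty.hom_ext _
      (BraidedCategory.braiding_naturality_right X.obj f.hom)
    braiding_naturality_left := fun f Z => ObjectProperty.hom_ext _
      (BraidedCategory.braiding_naturality_left f.hom Z.obj)
    hexagon_forward := fun X Y Z => ObjectProperty.hom_ext _
      (BraidedCategory.hexagon_forward X.obj Y.obj Z.obj)
    hexagon_reverse := fun X Y Z => ObjectProperty.hom_ext _
      (BraidedCategory.hexagon_reverse X.obj Y.obj Z.obj)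
    symmetry := fun X Y => ObjectProperty.hom_ext _
      (SymmetricCategory.symmetry X.obj Y.obj) }

end TensorCorner

end UnitalSubcategory

section Sharp

open CategoryTheory.Idempotents

variable (k : Type w) [Field k]

/-- The additive-Karoubi envelope `k[𝒱]^♯` of the `k`-linearization `k[𝒱]`. -/
abbrev VSharp : Type (max 1 w) := Karoubi (Mat_ (Free k VObj))

variable {k}

/-- The endomorphism `[0]` of an object `[V(A)]`. -/
noncomputable def zeroFree : ∀ X : Free k VObj, X ⟶ X :=
  fun X : VObj => Free.bas k (VObj.zeroHom X X)

theorem zeroFree_comm_of {V W : VObj} (f : Free.of k V ⟶ Free.of k W) :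
    f ≫ Free.bas k (VObj.zeroHom W W) = Free.bas k (VObj.zeroHom V V) ≫ f := by
  induction f using Free.hom_induction with
  | zero => simp
  | add f g hf hg => simp only [Preadditive.add_comp, Preadditive.comp_add, hf, hg]
  | smul r f =>
    rw [Linear.smul_comp, Linear.comp_smul, Free.bas_comp, Free.bas_comp, VObj.comp_zeroHom]
    exact congrArg _ (congrArg _ (Matrix.mul_zero _).symm)

theorem zeroFree_comm {X Y : Free k VObj} (f : X ⟶ Y) : f ≫ zeroFree Y = zeroFree X ≫ f :=
  zeroFree_comm_of f

theorem zeroFree_idem (X : Free k VObj) : zeroFree X ≫ zeroFree X = zeroFree X :=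
  (Free.bas_comp (C := VObj) _ _).trans (congrArg _ (VObj.comp_zeroHom _))

theorem zeroFree_tens (X Y : Free k VObj) : zeroFree X ⊗ₘ zeroFree Y = zeroFree (X ⊗ Y) :=
  (Free.tens_bas (C := VObj) _ _).trans (congrArg _ (VObj.zeroHom_tens _))

theorem zeroFree_tens_id (X Y : Free k VObj) : zeroFree X ⊗ₘ 𝟙 Y = zeroFree (X ⊗ Y) :=
  (Free.tens_bas (C := VObj) _ (𝟙 _)).trans (congrArg _ (VObj.zeroHom_tens _))

theorem id_tens_zeroFree (X Y : Free k VObj) : 𝟙 X ⊗ₘ zeroFree Y = zeroFree (X ⊗ Y) :=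
  (Free.tens_bas (C := VObj) (𝟙 _) _).trans (congrArg _ (VObj.tens_zeroHom _))

/-- The endomorphism `[0]` of a formal direct sum of objects `[V(A)]`. -/
noncomputable def zeroMat (M : Mat_ (Free k VObj)) : M ⟶ M :=
  Mat_.ofMap (fun i => i) fun i => zeroFree (M.X i)

theorem zeroMat_comm {M N : Mat_ (Free k VObj)} (f : M ⟶ N) : f ≫ zeroMat N = zeroMat M ≫ f := by
  ext i j
  exact (Mat_.comp_ofMap (M := N) (N := N) (fun i => i) (fun _ _ h => h)
    (fun i => zeroFree (N.X i)) f i j).trans ((zeroFree_comm (f i j)).trans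
    (Mat_.ofMap_comp (M := M) (N := M) (fun i => i) (fun i => zeroFree (M.X i)) f i j).symm)

theorem zeroMat_idem (M : Mat_ (Free k VObj)) : zeroMat M ≫ zeroMat M = zeroMat M := by
  rw [zeroMat, Mat_.ofMap_comp_ofMap]
  exact congrArg (Mat_.ofMap _) (funext fun i => zeroFree_idem _)

theorem zeroMat_tens (M N : Mat_ (Free k VObj)) : zeroMat M ⊗ₘ zeroMat N = zeroMat (M ⊗ N) :=
  (Mat_.tensHom_ofMap _ _ _ _).trans
    (congrArg (Mat_.ofMap _) (funext fun _ => zeroFree_tens _ _))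

theorem zeroMat_tens_id (M N : Mat_ (Free k VObj)) : zeroMat M ⊗ₘ 𝟙 N = zeroMat (M ⊗ N) := by
  rw [Mat_.id_eq_ofMap]
  exact (Mat_.tensHom_ofMap _ _ _ _).trans
    (congrArg (Mat_.ofMap _) (funext fun _ => zeroFree_tens_id _ _))

theorem id_tens_zeroMat (M N : Mat_ (Free k VObj)) : 𝟙 M ⊗ₘ zeroMat N = zeroMat (M ⊗ N) := by
  rw [Mat_.id_eq_ofMap]
  exact (Mat_.tensHom_ofMap _ _ _ _).trans
    (congrArg (Mat_.ofMap _) (funext fun _ => id_tens_zeroFree _ _))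

theorem one_sub_zeroMat_idem (M : Mat_ (Free k VObj)) :
    (𝟙 M - zeroMat M) ≫ (𝟙 M - zeroMat M) = 𝟙 M - zeroMat M := by
  rw [Preadditive.sub_comp, Preadditive.comp_sub, Preadditive.comp_sub, zeroMat_idem]
  simp

theorem one_sub_zeroMat_tens {M N U : Mat_ (Free k VObj)} (p : M ⟶ N) (h : zeroMat M ≫ p = 0) :
    ((𝟙 U - zeroMat U) ≫ (𝟙 U - zeroMat U)) ⊗ₘ p = 𝟙 U ⊗ₘ p := by
  have h0 : zeroMat U ⊗ₘ p = 0 := by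
    rw [← Category.comp_id (zeroMat U), ← Category.id_comp p, ← tensorHom_comp_tensorHom,
      zeroMat_tens_id, ← id_tens_zeroMat, tensorHom_comp_tensorHom, h,
      MonoidalPreadditive.tensor_zero]
  have h1 := MonoidalPreadditive.add_tensor (𝟙 U - zeroMat U) (zeroMat U) p
  rw [sub_add_cancel, h0, add_zero] at h1
  rw [one_sub_zeroMat_idem, h1]

theorem tens_one_sub_zeroMat {M N U : Mat_ (Free k VObj)} (p : M ⟶ N) (h : zeroMat M ≫ p = 0) :
    p ⊗ₘ ((𝟙 U - zeroMat U) ≫ (𝟙 U - zeroMat U)) = p ⊗ₘ 𝟙 U := by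
  have h0 : p ⊗ₘ zeroMat U = 0 := by
    rw [← Category.comp_id (zeroMat U), ← Category.id_comp p, ← tensorHom_comp_tensorHom,
      id_tens_zeroMat, ← zeroMat_tens_id, tensorHom_comp_tensorHom, h,
      MonoidalPreadditive.zero_tensor]
  have h1 := MonoidalPreadditive.tensor_add p (𝟙 U - zeroMat U) (zeroMat U)
  rw [sub_add_cancel, h0, add_zero] at h1
  rw [one_sub_zeroMat_idem, h1]

/-- The endomorphism `[0]` of an object of `k[𝒱]^♯`. -/
noncomputable def zeroEnd (X : VSharp k) : X ⟶ X where
  f := X.p ≫ zeroMat X.X ≫ X.p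
  comm := by simp

variable (k) in
/-- The objects of `k[𝒱]^♯_1`: those `X` with `X = X_1`, that is, on which `[0]` vanishes. -/
def isSharpOne : ObjectProperty (VSharp k) := fun X => zeroEnd X = 0

theorem isSharpOne_iff (X : VSharp k) : isSharpOne k X ↔ zeroMat X.X ≫ X.p = 0 := by
  have h : X.p ≫ zeroMat X.X ≫ X.p = zeroMat X.X ≫ X.p := by
    rw [reassoc_of% (zeroMat_comm X.p), X.idem]
  rw [← h]
  exact Karoubi.hom_ext_iff

/-- The direct factor `X_1` of an object `X` of the additive envelope of `k[𝒱]`, that is, the image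
of the idempotent `1 - [0]`. -/
noncomputable def oneFactor (M : Mat_ (Free k VObj)) : VSharp k where
  X := M
  p := 𝟙 M - zeroMat M
  idem := one_sub_zeroMat_idem M

theorem isSharpOne_oneFactor (M : Mat_ (Free k VObj)) : isSharpOne k (oneFactor M) := by
  rw [isSharpOne_iff]
  change zeroMat M ≫ (𝟙 M - zeroMat M) = 0
  rw [Preadditive.comp_sub, zeroMat_idem, Category.comp_id, sub_self]

variable (k) in
/-- `k[𝒱]^♯_1` is closed under the tensor product, and its unit object is `[V(pt)]_1`. -/
noncomputable def sharpOneCorner : TensorCorner (isSharpOne k) where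
  tens {X Y} hX hY := by
    rw [isSharpOne_iff] at hX hY ⊢
    change zeroMat (X.X ⊗ Y.X) ≫ (X.p ⊗ₘ Y.p) = 0
    rw [← zeroMat_tens, tensorHom_comp_tensorHom, hX, hY,
      MonoidalPreadditive.tensor_zero]
  one := oneFactor (𝟙_ _)
  prop_one := isSharpOne_oneFactor _
  incl :=
    { f := 𝟙 _ - zeroMat _
      comm := by
        refine (reassoc_of% (oneFactor (𝟙_ (Mat_ (Free k VObj)))).idem) _ |>.trans ?_
        exact Category.comp_id _ }
  proj :=
    { f := 𝟙 _ - zeroMat _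
      comm := by
        refine (Category.id_comp _).trans ?_
        exact (oneFactor (𝟙_ (Mat_ (Free k VObj)))).idem }
  incl_proj := Karoubi.hom_ext _ _ (oneFactor (𝟙_ (Mat_ (Free k VObj)))).idem
  left X hX := Karoubi.hom_ext _ _ (one_sub_zeroMat_tens X.p ((isSharpOne_iff X).1 hX))
  right X hX := Karoubi.hom_ext _ _ (tens_one_sub_zeroMat X.p ((isSharpOne_iff X).1 hX))

variable (k) in
/-- The category `k[𝒱]^♯_1`. -/
abbrev VSharpOne : Type (max 1 w) := (isSharpOne k).FullSubcategory

noncomputable instance : MonoidalCategory (VSharpOne k) := (sharpOneCorner k).monoidal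

noncomputable instance : SymmetricCategory (VSharpOne k) := (sharpOneCorner k).symmetric

variable (k) in
/-- The object `[V(A)]_1` of `k[𝒱]^♯_1`. -/
noncomputable def vOne (A : Type) [Fintype A] [DecidableEq A] : VSharpOne k :=
  ⟨oneFactor ((Mat_.embedding (Free k VObj)).obj (Free.of k ⟨A⟩)), isSharpOne_oneFactor _⟩

end Sharp

/-- A topological group is Roelcke precompact if `U \ G / V` is finite for all open subgroups `U`
and `V`. -/
class RoelckePrecompact (G : Type u) [Group G] [TopologicalSpace G] : Prop where
  finite_quotient : ∀ U V : Subgroup G, IsOpen (U : Set G) → IsOpen (V : Set G) →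
    Finite (DoubleCoset.Quotient (U : Set G) (V : Set G))

/-- A finitary smooth `G`-set: stabilizers are open and there are finitely many orbits. -/
structure FinGSet (G : Type u) [Group G] [TopologicalSpace G] where
  /-- the underlying set -/
  carrier : Type u
  /-- the action -/
  [act : MulAction G carrier]
  smooth : ∀ x : carrier, IsOpen (MulAction.stabilizer G x : Set G)
  [finitary : Finite (MulAction.orbitRel.Quotient G carrier)]

namespace FinGSet

variable {G : Type u} [Group G] [TopologicalSpace G]

instance : CoeSort (FinGSet G) (Type u) := ⟨carrier⟩

attribute [instance] FinGSet.act FinGSet.finitary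

/-- The set `G \ X` of orbits. -/
abbrev Orb (X : FinGSet G) : Type u := MulAction.orbitRel.Quotient G X

noncomputable instance (X : FinGSet G) : Fintype X.Orb := Fintype.ofFinite _

/-- The orbit of a point. -/
def cls {X : FinGSet G} (x : X) : X.Orb := Quotient.mk _ x

theorem cls_surj {X : FinGSet G} (O : X.Orb) : ∃ x : X, cls x = O := Quotient.exists_rep O

theorem cls_eq {X : FinGSet G} {x y : X} : cls x = cls y ↔ ∃ g : G, g • y = x :=
  Quotient.eq.trans MulAction.orbitRel_apply

@[simp] theorem cls_smul {X : FinGSet G} (g : G) (x : X) : cls (g • x) = cls x :=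
  cls_eq.2 ⟨g, rfl⟩

/-- A `G`-set is transitive if it has exactly one orbit. -/
def IsTransitive (X : FinGSet G) : Prop := Nonempty X ∧ MulAction.IsPretransitive G X

/-- The map on orbits induced by a map of `G`-sets. -/
def orbMap {X Y : FinGSet G} (f : X →[G] Y) : X.Orb → Y.Orb :=
  Quotient.lift (fun x => cls (f x)) fun x y h => by
    obtain ⟨g, rfl⟩ := cls_eq.1 (Quotient.sound h)
    rw [map_smul, cls_smul]

@[simp] theorem orbMap_cls {X Y : FinGSet G} (f : X →[G] Y) (x : X) :
    orbMap f (cls x) = cls (f x) := rfl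

theorem orbMap_comp {X Y Z : FinGSet G} (g : Y →[G] Z) (f : X →[G] Y) (O : X.Orb) :
    orbMap (g.comp f) O = orbMap g (orbMap f O) := by
  obtain ⟨x, rfl⟩ := cls_surj O
  rfl

/-- The one-point `G`-set. -/
def pt : FinGSet G :=
  letI : MulAction G PUnit.{u + 1} :=
    { smul := fun _ x => x, one_smul := fun _ => rfl, mul_smul := fun _ _ _ => rfl }
  { carrier := PUnit
    smooth := fun x => by
      have h : (MulAction.stabilizer G x : Set G) = Set.univ :=
        Set.eq_univ_of_forall fun _ => rfl
      rw [h]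
      exact isOpen_univ
    finitary := Quotient.finite _ }

theorem pt_transitive : (pt : FinGSet G).IsTransitive :=
  ⟨⟨PUnit.unit⟩, ⟨fun _ _ => ⟨1, rfl⟩⟩⟩

/-- The map to the one-point `G`-set. -/
def toPt (X : FinGSet G) : X →[G] (pt : FinGSet G) := ⟨fun _ => PUnit.unit, fun _ _ => rfl⟩

/-- The `G`-subset of `X` consisting of the points which satisfy an invariant predicate. -/
def filter (X : FinGSet G) (P : X → Prop) (hP : ∀ (g : G) x, P x → P (g • x)) : FinGSet G :=
  letI : MulAction G {x : X // P x} :=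
    { smul := fun g x => ⟨g • x.1, hP g x.1 x.2⟩
      one_smul := fun x => Subtype.ext (one_smul G x.1)
      mul_smul := fun g h x => Subtype.ext (mul_smul g h x.1) }
  { carrier := {x : X // P x}
    smooth := fun x => by
      have h : (MulAction.stabilizer G x : Set G) = MulAction.stabilizer G x.1 :=
        Set.ext fun g => Subtype.ext_iff
      rw [h]
      exact X.smooth x.1
    finitary := by
      refine Finite.of_injective (β := X.Orb)
        (Quotient.lift (fun x => cls x.1) fun x y h => ?_) ?_
      · obtain ⟨g, rfl⟩ := MulAction.orbitRel_apply.1 h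
        exact cls_smul g y.1
      · intro a b
        refine Quotient.inductionOn₂ a b fun x y h => ?_
        obtain ⟨g, hg⟩ := cls_eq.1 h
        exact Quotient.sound (MulAction.orbitRel_apply.2 ⟨g, Subtype.ext hg⟩) }

/-- The union of a set of orbits of `X`. -/
def sub (X : FinGSet G) (S : Set X.Orb) : FinGSet G :=
  X.filter (fun x => cls x ∈ S) fun g x h => by rwa [cls_smul]

/-- The inclusion of a union of orbits. -/
def incl (X : FinGSet G) (S : Set X.Orb) : X.sub S →[G] X := ⟨Subtype.val, fun _ _ => rfl⟩

/-- The restriction of a map to unions of orbits. -/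
def res {X Y : FinGSet G} (f : X →[G] Y) (S : Set X.Orb) (T : Set Y.Orb)
    (h : ∀ O ∈ S, orbMap f O ∈ T) : X.sub S →[G] Y.sub T :=
  ⟨fun x => ⟨f x.1, h _ x.2⟩, fun g x => Subtype.ext (map_smul f g x.1)⟩

theorem sub_transitive (X : FinGSet G) (O : X.Orb) : (X.sub {O}).IsTransitive := by
  obtain ⟨x, hx⟩ := cls_surj O
  refine ⟨⟨⟨x, hx⟩⟩, ⟨fun a b => ?_⟩⟩
  obtain ⟨g, hg⟩ := cls_eq.1 ((show cls b.1 = O from b.2).trans (show cls a.1 = O from a.2).symm)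
  exact ⟨g, Subtype.ext hg⟩

/-- The product of two finitary smooth `G`-sets. -/
def prod [RoelckePrecompact G] (X Y : FinGSet G) : FinGSet G where
  carrier := X × Y
  smooth p := by
    have h : (MulAction.stabilizer G p : Set G) =
        (MulAction.stabilizer G p.1 : Set G) ∩ MulAction.stabilizer G p.2 :=
      Set.ext fun g => Prod.ext_iff
    rw [h]
    exact (X.smooth p.1).inter (Y.smooth p.2)
  finitary := by
    have hfin : ∀ (a : X) (b : Y), Finite (DoubleCoset.Quotient
        (MulAction.stabilizer G a : Set G) (MulAction.stabilizer G b : Set G)) := fun a b =>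
      RoelckePrecompact.finite_quotient _ _ (X.smooth a) (Y.smooth b)
    let T := Σ p : X.Orb × Y.Orb, DoubleCoset.Quotient
        (MulAction.stabilizer G p.1.out : Set G) (MulAction.stabilizer G p.2.out : Set G)
    have : Finite T := by
      have := fun p : X.Orb × Y.Orb => hfin p.1.out p.2.out
      infer_instance
    refine Finite.of_surjective (α := T)
      (fun t => Quotient.mk _ (t.1.1.out, t.2.out • t.1.2.out)) fun O => ?_
    obtain ⟨⟨x, y⟩, rfl⟩ := Quotient.exists_rep O
    obtain ⟨g, hg⟩ := cls_eq.1 (Quotient.out_eq (cls x) : cls (cls x).out = cls x)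
    obtain ⟨h, hh⟩ := cls_eq.1 (Quotient.out_eq (cls y) : cls (cls y).out = cls y)
    -- `(x, y)` is in the orbit of `(x₀, g h⁻¹ • y₀)`
    refine ⟨⟨(cls x, cls y), DoubleCoset.mk _ _ (g * h⁻¹)⟩, ?_⟩
    obtain ⟨a, b, ha, hb, hab⟩ := DoubleCoset.mk_out_eq_mul
      (MulAction.stabilizer G (cls x).out) (MulAction.stabilizer G (cls y).out) (g * h⁻¹)
    refine Quotient.sound (MulAction.orbitRel_apply.2 ⟨a * g, ?_⟩)
    change ((a * g) • x, (a * g) • y) = _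
    refine Prod.ext ?_ ?_
    · change (a * g) • x = (cls x).out
      rw [mul_smul, hg]
      exact ha
    · refine Eq.trans ?_ (congrArg (· • (cls y).out) hab).symm
      change (a * g) • y = (a * (g * h⁻¹) * b) • (cls y).out
      rw [mul_smul _ b, show b • (cls y).out = (cls y).out from hb, ← hh, ← mul_smul]
      congr 1
      group

end FinGSet

/-- A measure for `G` with values in `k`: a value `μ(f)` for each map `f : X → Y` of finitary smooth
`G`-sets with `Y` transitive, such that isomorphisms have measure one, and `μ` is additive in `X`,
multiplicative under composition and invariant under base change. -/
@[ext]
structure GMeasure (G : Type u) [Group G] [TopologicalSpace G] (k : Type v) [CommRing k] where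
  /-- the value of the measure on a map with transitive target -/
  val : ∀ {X Y : FinGSet G}, (X →[G] Y) → Y.IsTransitive → k
  iso : ∀ {X Y : FinGSet G} (f : X →[G] Y) (hY : Y.IsTransitive), Function.Bijective f →
    val f hY = 1
  add : ∀ {X X₁ X₂ Y : FinGSet G} (f : X →[G] Y) (hY : Y.IsTransitive) (i₁ : X₁ →[G] X)
    (i₂ : X₂ →[G] X), Function.Injective i₁ → Function.Injective i₂ →
    IsCompl (Set.range i₁) (Set.range i₂) →
    val f hY = val (f.comp i₁) hY + val (f.comp i₂) hY
  comp : ∀ {X Y Z : FinGSet G} (f : X →[G] Y) (g : Y →[G] Z) (hY : Y.IsTransitive)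
    (hZ : Z.IsTransitive), val (g.comp f) hZ = val g hZ * val f hY
  base_change : ∀ {X Y X' Y' : FinGSet G} (f : X →[G] Y) (g : Y' →[G] Y) (f' : X' →[G] Y')
    (g' : X' →[G] X) (hY : Y.IsTransitive) (hY' : Y'.IsTransitive),
    (∀ x', f (g' x') = g (f' x')) →
    (∀ x y', f x = g y' → ∃! x', g' x' = x ∧ f' x' = y') →
    val f' hY' = val f hY

namespace GMeasure

open FinGSet

variable {G : Type u} [Group G] [TopologicalSpace G] {k : Type v} [CommRing k]

/-- The measure of a finitary `G`-set. -/
def mass (μ : GMeasure G k) (X : FinGSet G) : k := μ.val X.toPt pt_transitive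

/-- A measure is regular if maps of transitive `G`-sets have invertible measure. -/
def IsRegular (μ : GMeasure G k) : Prop :=
  ∀ {X Y : FinGSet G} (f : X →[G] Y) (hY : Y.IsTransitive), X.IsTransitive → IsUnit (μ.val f hY)

/-- The extension of scalars of a measure. -/
def map (μ : GMeasure G k) {k' : Type w} [CommRing k'] (φ : k →+* k') : GMeasure G k' where
  val f hY := φ (μ.val f hY)
  iso f hY h := by rw [μ.iso f hY h, map_one]
  add f hY i₁ i₂ h₁ h₂ h := by rw [μ.add f hY i₁ i₂ h₁ h₂ h, map_add]
  comp f g hY hZ := by rw [μ.comp f g hY hZ, map_mul]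
  base_change f g f' g' hY hY' h₁ h₂ := by rw [μ.base_change f g f' g' hY hY' h₁ h₂]

variable (μ : GMeasure G k)

theorem val_iso {X X' Y : FinGSet G} (f : X →[G] Y) (hY : Y.IsTransitive) (e : X' →[G] X)
    (he : Function.Bijective e) : μ.val (f.comp e) hY = μ.val f hY := by
  refine μ.base_change f (MulActionHom.id G) (f.comp e) e hY hY (fun _ => rfl) fun x y' h => ?_
  obtain ⟨x', hx'⟩ := he.2 x
  refine ⟨x', ⟨hx', ?_⟩, fun z hz => he.1 (hz.1.trans hx'.symm)⟩
  change f (e x') = y'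
  rw [hx']
  exact h

/-- The measure of the map from an orbit onto its image. -/
def orbVal {X Y : FinGSet G} (f : X →[G] Y) (O : X.Orb) : k :=
  μ.val (res f {O} {orbMap f O} fun P hP => by rw [Set.mem_singleton_iff.1 hP]; rfl)
    (Y.sub_transitive _)

theorem val_empty {X Y : FinGSet G} (f : X →[G] Y) (hY : Y.IsTransitive) (hX : IsEmpty X) :
    μ.val f hY = 0 := by
  have h := μ.add f hY (MulActionHom.id G) (MulActionHom.id G) (fun x => hX.elim x)
    (fun x => hX.elim x) (by
      rw [Set.eq_empty_of_isEmpty (Set.range _)]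
      exact ⟨disjoint_bot_left, fun _ _ _ x => hX.elim x⟩)
  change μ.val f hY = μ.val f hY + μ.val f hY at h
  simpa using h

theorem val_sub {X Y : FinGSet G} (f : X →[G] Y) (P : Y.Orb) (S : Finset X.Orb)
    (hS : ∀ O ∈ (S : Set X.Orb), orbMap f O ∈ ({P} : Set Y.Orb)) :
    μ.val (res f S {P} hS) (Y.sub_transitive _) = ∑ O ∈ S, μ.orbVal f O := by
  classical
  induction S using Finset.induction_on with
  | empty => exact μ.val_empty _ _ ⟨fun x => by simpa using x.2⟩
  | insert O S hO ih =>
    rw [Finset.sum_insert hO, ← ih fun Q hQ => hS Q (Finset.mem_insert_of_mem hQ)]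
    have hP : orbMap f O = P := hS O (Finset.mem_insert_self O S)
    subst hP
    refine μ.add (res f (insert O S : Finset X.Orb) {orbMap f O} hS) _
      (⟨fun x : X.sub {O} => ⟨x.1, Finset.mem_insert.2 (Or.inl x.2)⟩, fun _ _ => rfl⟩ :
        X.sub {O} →[G] X.sub (insert O S : Finset X.Orb))
      (⟨fun x : X.sub S => ⟨x.1, Finset.mem_insert_of_mem x.2⟩, fun _ _ => rfl⟩ :
        X.sub S →[G] X.sub (insert O S : Finset X.Orb))
      (fun x y h => Subtype.ext (congrArg
        (fun z : X.sub (insert O S : Finset X.Orb) => z.1) h))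
      (fun x y h => Subtype.ext (congrArg
        (fun z : X.sub (insert O S : Finset X.Orb) => z.1) h)) ?_
    refine isCompl_iff.2 ⟨?_, ?_⟩
    · rw [Set.disjoint_iff_forall_ne]
      rintro _ ⟨x, rfl⟩ _ ⟨y, rfl⟩ h
      have h1 : x.1 = y.1 := congrArg Subtype.val h
      have h2 : cls x.1 = O := x.2
      exact hO (h2 ▸ h1 ▸ y.2)
    · rw [codisjoint_iff]
      refine Set.eq_univ_of_forall fun z => ?_
      rcases Finset.mem_insert.1 z.2 with h | h
      · exact Or.inl ⟨⟨z.1, h⟩, rfl⟩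
      · exact Or.inr ⟨⟨z.1, h⟩, rfl⟩

theorem orbVal_of_injective {X Y : FinGSet G} (f : X →[G] Y) (hf : Function.Injective f)
    (O : X.Orb) : μ.orbVal f O = 1 := by
  refine μ.iso _ _ ⟨fun x y h => Subtype.ext (hf (congrArg Subtype.val h)), fun y => ?_⟩
  obtain ⟨x, rfl⟩ := cls_surj O
  obtain ⟨g, hg⟩ := cls_eq.1 (show cls y.1 = cls (f x) from y.2)
  refine ⟨⟨g • x, cls_smul g x⟩, Subtype.ext ?_⟩
  exact (map_smul f g x).trans hg

theorem orbVal_comp {X Y Z : FinGSet G} (g : Y →[G] Z) (f : X →[G] Y) (O : X.Orb) :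
    μ.orbVal (g.comp f) O = μ.orbVal g (orbMap f O) * μ.orbVal f O := by
  obtain ⟨x, rfl⟩ := cls_surj O
  exact μ.comp (res f {cls x} {cls (f x)} _) (res g {cls (f x)} {cls (g (f x))} _)
    (Y.sub_transitive _) (Z.sub_transitive _)

end GMeasure

namespace FinGSet

variable {G : Type u} [Group G] [TopologicalSpace G]

/-- The space `F(X)` of invariant functions on `X`, as functions on the set of orbits. -/
abbrev InvFun (k : Type v) (X : FinGSet G) : Type (max u v) := X.Orb → k

variable {k : Type v} [CommRing k]

/-- The pull-back of invariant functions. -/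
def pull {X Y : FinGSet G} (f : X →[G] Y) (b : InvFun k Y) : InvFun k X := fun O => b (orbMap f O)

open scoped Classical in
/-- The indicator function of an invariant subset. -/
noncomputable def ind (k : Type v) [CommRing k] {X : FinGSet G} (P : X → Prop)
    (h : ∀ (g : G) x, P (g • x) ↔ P x) :
    InvFun k X :=
  Quotient.lift (fun x => if P x then 1 else 0) fun x y hxy => by
    obtain ⟨g, rfl⟩ := MulAction.orbitRel_apply.1 hxy
    exact if_congr (h g y) rfl rfl

end FinGSet

namespace GMeasure

open FinGSet

variable {G : Type u} [Group G] [TopologicalSpace G] {k : Type v} [CommRing k]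
variable (μ : GMeasure G k)

open scoped Classical in
/-- The push-forward `f_*`: the indicator function of an orbit `O` is mapped to `μ(O → f(O))` times
the indicator function of `f(O)`. -/
noncomputable def push {X Y : FinGSet G} (f : X →[G] Y) (a : InvFun k X) : InvFun k Y :=
  fun P => ∑ O : X.Orb, if orbMap f O = P then μ.orbVal f O * a O else 0

theorem push_add {X Y : FinGSet G} (f : X →[G] Y) (a b : InvFun k X) :
    μ.push f (a + b) = μ.push f a + μ.push f b := by
  funext P
  simp only [push, Pi.add_apply, ← Finset.sum_add_distrib]
  refine Finset.sum_congr rfl fun O _ => ?_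
  split_ifs <;> simp [mul_add]

theorem push_smul {X Y : FinGSet G} (f : X →[G] Y) (c : k) (a : InvFun k X) :
    μ.push f (c • a) = c • μ.push f a := by
  funext P
  simp only [push, Pi.smul_apply, smul_eq_mul, Finset.mul_sum]
  refine Finset.sum_congr rfl fun O _ => ?_
  split_ifs <;> ring

theorem push_push {X Y Z : FinGSet G} (g : Y →[G] Z) (f : X →[G] Y) (a : InvFun k X) :
    μ.push g (μ.push f a) = μ.push (g.comp f) a := by
  classical
  funext P
  simp only [push, Finset.mul_sum]
  have h : ∀ Q : Y.Orb, (if orbMap g Q = P then ∑ O : X.Orb, μ.orbVal g Q *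
      (if orbMap f O = Q then μ.orbVal f O * a O else 0) else 0) =
      ∑ O : X.Orb, if orbMap f O = Q then
        (if orbMap g (orbMap f O) = P then μ.orbVal (g.comp f) O * a O else 0) else 0 := by
    intro Q
    by_cases hQ : orbMap g Q = P
    · rw [if_pos hQ]
      refine Finset.sum_congr rfl fun O _ => ?_
      by_cases hO : orbMap f O = Q
      · rw [if_pos hO, if_pos hO, hO, if_pos hQ, orbVal_comp, hO, mul_assoc]
      · rw [if_neg hO, if_neg hO, mul_zero]
    · rw [if_neg hQ]
      refine (Finset.sum_eq_zero fun O _ => ?_).symm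
      by_cases hO : orbMap f O = Q
      · rw [if_pos hO, hO, if_neg hQ]
      · rw [if_neg hO]
  rw [Finset.sum_congr rfl fun Q _ => h Q, Finset.sum_comm]
  refine Finset.sum_congr rfl fun O _ => ?_
  rw [Finset.sum_ite_eq Finset.univ (orbMap f O), if_pos (Finset.mem_univ _), orbMap_comp]

theorem push_mul_pull {X Y : FinGSet G} (f : X →[G] Y) (a : InvFun k X) (b : InvFun k Y) :
    μ.push f (a * pull f b) = μ.push f a * b := by
  funext P
  simp only [push, Pi.mul_apply, Finset.sum_mul, pull]
  refine Finset.sum_congr rfl fun O _ => ?_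
  split_ifs with h
  · rw [h, mul_assoc]
  · rw [zero_mul]

theorem push_base_change {X Y X' Y' : FinGSet G} (f : X →[G] Y) (g : Y' →[G] Y)
    (f' : X' →[G] Y') (g' : X' →[G] X) (h₁ : ∀ x', f (g' x') = g (f' x'))
    (h₂ : ∀ x y', f x = g y' → ∃! x', g' x' = x ∧ f' x' = y') (a : InvFun k X) :
    pull g (μ.push f a) = μ.push f' (pull g' a) := by
  classical
  funext P
  have key : ∀ O : X.Orb, orbMap f O = orbMap g P → μ.orbVal f O =
      ∑ Q : X'.Orb, if orbMap f' Q = P ∧ orbMap g' Q = O then μ.orbVal f' Q else 0 := by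
    intro O hO
    rw [← Finset.sum_filter, ← μ.val_sub f' P _ fun Q hQ => by simp at hQ; exact hQ.1]
    have hg : ∀ Q ∈ ({P} : Set Y'.Orb), orbMap g Q ∈ ({orbMap f O} : Set Y.Orb) := by
      rintro Q rfl
      exact hO.symm
    have hg' : ∀ Q ∈ ((Finset.univ.filter fun Q : X'.Orb =>
        orbMap f' Q = P ∧ orbMap g' Q = O : Finset X'.Orb) : Set X'.Orb),
        orbMap g' Q ∈ ({O} : Set X.Orb) := by
      intro Q hQ
      simp at hQ
      exact hQ.2
    refine (μ.base_change (res f {O} {orbMap f O} _) (res g {P} _ hg)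
      (res f' _ {P} _) (res g' _ _ hg') _ _ (fun x' => Subtype.ext (h₁ x'.1)) fun x y' h => ?_).symm
    obtain ⟨x', ⟨hx, hy⟩, hu⟩ := h₂ x.1 y'.1 (congrArg Subtype.val h)
    refine ⟨⟨x', ?_⟩, ⟨Subtype.ext hx, Subtype.ext hy⟩, fun z hz =>
      Subtype.ext (hu z.1 ⟨congrArg Subtype.val hz.1, congrArg Subtype.val hz.2⟩)⟩
    simp only [Finset.coe_filter, Finset.mem_univ, true_and, Set.mem_ofPred_eq, orbMap_cls]
    exact ⟨(congrArg cls hy).trans y'.2, (congrArg cls hx).trans x.2⟩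
  have h0 : ∀ Q : X'.Orb, orbMap f (orbMap g' Q) = orbMap g (orbMap f' Q) := by
    intro Q
    obtain ⟨x', rfl⟩ := cls_surj Q
    exact congrArg cls (h₁ x')
  simp only [push, pull]
  have h3 : ∀ O : X.Orb, (if orbMap f O = orbMap g P then μ.orbVal f O * a O else 0) =
      ∑ Q : X'.Orb, if orbMap g' Q = O then
        (if orbMap f' Q = P then μ.orbVal f' Q * a (orbMap g' Q) else 0) else 0 := by
    intro O
    by_cases hO : orbMap f O = orbMap g P
    · rw [if_pos hO, key O hO, Finset.sum_mul]
      refine Finset.sum_congr rfl fun Q _ => ?_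
      by_cases h1 : orbMap f' Q = P <;> by_cases h2 : orbMap g' Q = O <;> simp [h1, h2]
    · rw [if_neg hO]
      refine (Finset.sum_eq_zero fun Q _ => ?_).symm
      by_cases h2 : orbMap g' Q = O
      · rw [if_pos h2]
        refine if_neg fun h1 => hO ?_
        rw [← h2, ← h1, h0]
      · exact if_neg h2
  rw [Finset.sum_congr rfl fun O _ => h3 O, Finset.sum_comm]
  refine Finset.sum_congr rfl fun Q _ => ?_
  rw [Finset.sum_ite_eq Finset.univ (orbMap g' Q), if_pos (Finset.mem_univ _)]

end GMeasure

namespace FinGSet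

variable {G : Type u} [Group G] [TopologicalSpace G] {k : Type v}

theorem pull_pull {X Y Z : FinGSet G} (g : Y →[G] Z) (f : X →[G] Y) (a : InvFun k Z) :
    pull f (pull g a) = pull (g.comp f) a :=
  funext fun O => congrArg a (orbMap_comp g f O).symm

theorem invFun_ext {X : FinGSet G} {a b : InvFun k X} (h : ∀ x : X, a (cls x) = b (cls x)) :
    a = b := by
  funext O
  obtain ⟨x, rfl⟩ := cls_surj O
  exact h x

variable [CommRing k]

theorem pull_mul {X Y : FinGSet G} (f : X →[G] Y) (a b : InvFun k Y) :
    pull f (a * b) = pull f a * pull f b := rfl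

theorem pull_one {X Y : FinGSet G} (f : X →[G] Y) : pull f (1 : InvFun k Y) = 1 := rfl

open scoped Classical in
theorem ind_cls {X : FinGSet G} (P : X → Prop) (h : ∀ (g : G) x, P (g • x) ↔ P x) (x : X) :
    ind k P h (cls x) = if P x then 1 else 0 := rfl

variable [RoelckePrecompact G]

/-- The first projection. -/
def fst {X Y : FinGSet G} : X.prod Y →[G] X := ⟨fun p : X × Y => p.1, fun _ _ => rfl⟩

/-- The second projection. -/
def snd {X Y : FinGSet G} : X.prod Y →[G] Y := ⟨fun p : X × Y => p.2, fun _ _ => rfl⟩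

/-- The point of a product with given components. -/
def pr {X Y : FinGSet G} (x : X) (y : Y) : X.prod Y := (x, y)

/-- The map to a product with given components. -/
def pair {T X Y : FinGSet G} (f : T →[G] X) (g : T →[G] Y) : T →[G] X.prod Y :=
  ⟨fun t => pr (f t) (g t), fun a t => Prod.ext (map_smul f a t) (map_smul g a t)⟩

theorem prod_ext {X Y : FinGSet G} {p q : X.prod Y} (h₁ : fst p = fst q) (h₂ : snd p = snd q) :
    p = q := Prod.ext h₁ h₂

theorem fst_eq {X Y : FinGSet G} {p q : X.prod Y} (h : p = q) : fst p = fst q := h ▸ rfl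

theorem snd_eq {X Y : FinGSet G} {p q : X.prod Y} (h : p = q) : snd p = snd q := h ▸ rfl

end FinGSet

namespace GMeasure

open FinGSet

variable {G : Type u} [Group G] [TopologicalSpace G] {k : Type v} [CommRing k]
variable (μ : GMeasure G k)

theorem push_injective {X Y : FinGSet G} (f : X →[G] Y) (hf : Function.Injective f)
    (a : InvFun k X) (O : X.Orb) : μ.push f a (orbMap f O) = a O := by
  have hinj : Function.Injective (orbMap f) := by
    intro A B h
    obtain ⟨x, rfl⟩ := cls_surj A
    obtain ⟨y, rfl⟩ := cls_surj B
    obtain ⟨g, hg⟩ := cls_eq.1 h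
    exact cls_eq.2 ⟨g, hf ((map_smul f g y).trans hg)⟩
  classical
  simp only [push, hinj.eq_iff, μ.orbVal_of_injective f hf, one_mul]
  exact (Finset.sum_ite_eq' Finset.univ O a).trans (if_pos (Finset.mem_univ O))

theorem push_id {X : FinGSet G} (a : InvFun k X) : μ.push (MulActionHom.id G) a = a :=
  invFun_ext fun x => μ.push_injective (MulActionHom.id G) (fun _ _ h => h) a (cls x)

theorem push_one_injective {X Y : FinGSet G} (f : X →[G] Y) (hf : Function.Injective f)
    (P : Y → Prop) (h : ∀ (g : G) x, P (g • x) ↔ P x) (hP : ∀ y, P y ↔ ∃ x, f x = y) :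
    ind k P h = μ.push f 1 := by
  classical
  refine invFun_ext fun y => ?_
  rw [ind_cls]
  split_ifs with hy
  · obtain ⟨x, rfl⟩ := (hP y).1 hy
    exact (μ.push_injective f hf 1 (cls x)).symm
  · refine (Finset.sum_eq_zero fun O _ => if_neg fun hO => hy ?_).symm
    obtain ⟨x, rfl⟩ := cls_surj O
    obtain ⟨g, hg⟩ := cls_eq.1 hO
    rw [← h g]
    exact (hP _).2 ⟨x, hg.symm⟩

section Matrix

variable [RoelckePrecompact G]

/-- The product of a `Z × Y` matrix with a `Y × X` matrix: the push-forward along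
`(z, y, x) ↦ (z, x)` of the function `(z, y, x) ↦ B(z, y) A(y, x)`. -/
noncomputable def matMul {X Y Z : FinGSet G} (B : InvFun k (Z.prod Y)) (A : InvFun k (Y.prod X)) :
    InvFun k (Z.prod X) :=
  μ.push (X := Z.prod (Y.prod X)) (pair fst (snd.comp snd))
    (pull (pair fst (fst.comp snd)) B * pull snd A)

/-- The matrix of a map of `G`-sets, with entries `1` on the graph and `0` elsewhere. -/
noncomputable def _root_.FinGSet.graph (k : Type v) [CommRing k] {X Y : FinGSet G} (e : X →[G] Y) :
    InvFun k (Y.prod X) :=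
  ind k (X := Y.prod X) (fun p => fst p = e (snd p)) fun g p => by
    rw [map_smul, map_smul, map_smul, smul_left_cancel_iff]

/-- The Kronecker product of matrices. -/
def _root_.FinGSet.kron {X Y X' Y' : FinGSet G} (A : InvFun k (Y.prod X))
    (A' : InvFun k (Y'.prod X')) : InvFun k ((Y.prod Y').prod (X.prod X')) :=
  pull (pair (fst.comp fst) (fst.comp snd)) A * pull (pair (snd.comp fst) (snd.comp snd)) A'

theorem graph_eq_push {X Y : FinGSet G} (e : X →[G] Y) :
    graph k e = μ.push (pair e (MulActionHom.id G)) 1 := by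
  refine μ.push_one_injective _ (fun x y h =>
    snd_eq (p := pair e (MulActionHom.id G) x) (q := pair e (MulActionHom.id G) y) h) _ _ fun p => ?_
  constructor
  · intro h
    exact ⟨snd p, prod_ext h.symm rfl⟩
  · rintro ⟨x, rfl⟩
    rfl

theorem matMul_graph {X Y Z : FinGSet G} (B : InvFun k (Z.prod Y)) (e : X →[G] Y) :
    μ.matMul B (graph k e) = pull (pair fst (e.comp snd)) B := by
  have h := μ.push_base_change (pair e (MulActionHom.id G)) (snd : Z.prod (Y.prod X) →[G] _)
    (pair fst (pair (e.comp snd) snd) : Z.prod X →[G] Z.prod (Y.prod X)) snd (fun _ => rfl)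
    (fun x y h => ⟨pr (fst y) x, ⟨rfl, prod_ext rfl h⟩, fun z hz =>
      prod_ext (fst_eq hz.2 :) hz.1⟩) (1 : InvFun k X)
  rw [matMul, μ.graph_eq_push, h, pull_one, mul_comm, ← μ.push_mul_pull, μ.push_push, one_mul,
    pull_pull]
  exact μ.push_id _

theorem graph_matMul {X Y Z : FinGSet G} (e : Y →[G] Z) (A : InvFun k (Y.prod X)) :
    μ.matMul (graph k e) A = μ.push (pair (e.comp fst) snd) A := by
  have h := μ.push_base_change (pair e (MulActionHom.id G))
    (pair fst (fst.comp snd) : Z.prod (Y.prod X) →[G] _)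
    (pair (e.comp fst) (MulActionHom.id G) : Y.prod X →[G] Z.prod (Y.prod X)) fst (fun _ => rfl)
    (fun x y h => ⟨snd y, ⟨(snd_eq h :).symm,
      prod_ext ((congrArg e (snd_eq h :).symm).trans
        (fst_eq h :)) rfl⟩, fun z hz =>
        snd_eq (p := pair (e.comp fst) (MulActionHom.id G) z) (q := y) hz.2⟩)
    (1 : InvFun k Y)
  rw [matMul, μ.graph_eq_push, h, pull_one, mul_comm, mul_comm, ← μ.push_mul_pull, μ.push_push,
    one_mul, pull_pull]
  exact congrArg (μ.push _) (funext fun O => by obtain ⟨p, rfl⟩ := cls_surj O; rfl)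

theorem matMul_assoc {W X Y Z : FinGSet G} (C : InvFun k (W.prod Z)) (B : InvFun k (Z.prod Y))
    (A : InvFun k (Y.prod X)) : μ.matMul (μ.matMul C B) A = μ.matMul C (μ.matMul B A) := by
  have h₁ := μ.push_base_change
    (pair fst (snd.comp snd) : W.prod (Z.prod Y) →[G] W.prod Y)
    (pair fst (fst.comp snd) : W.prod (Y.prod X) →[G] W.prod Y)
    (pair fst (snd.comp snd) : W.prod (Z.prod (Y.prod X)) →[G] W.prod (Y.prod X))
    (pair fst (pair (fst.comp snd) (fst.comp (snd.comp snd)))) (fun _ => rfl)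
    (fun x y h => ⟨pr (fst x) (pr (fst (snd x)) (snd y)), ⟨prod_ext rfl (prod_ext rfl
      (snd_eq h :).symm), prod_ext (fst_eq h :) rfl⟩,
      fun z hz => prod_ext (fst_eq hz.1 :) (prod_ext
        (fst_eq (snd_eq hz.1) :) (snd_eq hz.2 :))⟩)
    (pull (pair fst (fst.comp snd)) C * pull snd B)
  have h₂ := μ.push_base_change
    (pair fst (snd.comp snd) : Z.prod (Y.prod X) →[G] Z.prod X)
    (snd : W.prod (Z.prod X) →[G] Z.prod X)
    (pair fst (pair (fst.comp snd) (snd.comp (snd.comp snd))) :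
      W.prod (Z.prod (Y.prod X)) →[G] W.prod (Z.prod X))
    snd (fun _ => rfl)
    (fun x y h => ⟨pr (fst y) x, ⟨rfl, prod_ext rfl h⟩,
      fun z hz => prod_ext (fst_eq hz.2 :) hz.1⟩)
    (pull (pair fst (fst.comp snd)) B * pull snd A)
  rw [matMul, matMul, h₁, ← μ.push_mul_pull, μ.push_push, matMul, matMul, h₂,
    mul_comm (pull (pair fst (fst.comp snd)) C) (μ.push _ _),
    ← μ.push_mul_pull, μ.push_push]
  simp only [pull_mul, pull_pull]
  refine congrArg (μ.push _) ?_
  exact (mul_assoc _ _ _).trans (mul_comm _ _)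

theorem kron_matMul {X Y Z X' Y' Z' : FinGSet G} (B : InvFun k (Z.prod Y)) (A : InvFun k (Y.prod X))
    (B' : InvFun k (Z'.prod Y')) (A' : InvFun k (Y'.prod X')) :
    μ.matMul (kron B B') (kron A A') = kron (μ.matMul B A) (μ.matMul B' A') := by
  have h₁ := μ.push_base_change
    (pair fst (snd.comp snd) : Z.prod (Y.prod X) →[G] Z.prod X)
    (pair (fst.comp fst) (fst.comp snd) : (Z.prod Z').prod (X.prod X') →[G] Z.prod X)
    (pair fst (snd.comp snd) :
      (Z.prod Z').prod (Y.prod (X.prod X')) →[G] (Z.prod Z').prod (X.prod X'))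
    (pair (fst.comp fst) (pair (fst.comp snd) (fst.comp (snd.comp snd)))) (fun _ => rfl)
    (fun x y h => ⟨pr (fst y) (pr (fst (snd x)) (snd y)), ⟨prod_ext
      (fst_eq h :).symm (prod_ext rfl (snd_eq h :).symm), rfl⟩,
      fun z hz => prod_ext (fst_eq hz.2 :) (prod_ext
        (fst_eq (snd_eq hz.1) :) (snd_eq hz.2 :))⟩)
    (pull (pair fst (fst.comp snd)) B * pull snd A)
  have h₂ := μ.push_base_change
    (pair fst (snd.comp snd) : Z'.prod (Y'.prod X') →[G] Z'.prod X')
    (pair (snd.comp fst) (snd.comp (snd.comp snd)) :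
      (Z.prod Z').prod (Y.prod (X.prod X')) →[G] Z'.prod X')
    (pair fst (pair (fst.comp (fst.comp snd)) (snd.comp snd)) :
      (Z.prod Z').prod ((Y.prod Y').prod (X.prod X')) →[G] (Z.prod Z').prod (Y.prod (X.prod X')))
    (pair (snd.comp fst) (pair (snd.comp (fst.comp snd)) (snd.comp (snd.comp snd))))
    (fun _ => rfl)
    (fun x y h => ⟨pr (fst y) (pr (pr (fst (snd y)) (fst (snd x))) (snd (snd y))), ⟨prod_ext
      (fst_eq h :).symm (prod_ext rfl (snd_eq h :).symm), rfl⟩,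
      fun z hz => prod_ext (fst_eq hz.2 :) (prod_ext (prod_ext
        (fst_eq (snd_eq hz.2) :) (fst_eq (snd_eq hz.1) :))
        (snd_eq (snd_eq hz.2) :))⟩)
    (pull (pair fst (fst.comp snd)) B' * pull snd A')
  refine Eq.trans ?_ (show _ * pull (pair (snd.comp fst) (snd.comp snd)) (μ.matMul B' A') =
    kron (μ.matMul B A) (μ.matMul B' A') from congrArg (· * _) h₁.symm)
  rw [← μ.push_mul_pull, pull_pull]
  refine Eq.trans ?_ (congrArg (μ.push _) (congrArg (_ * ·) h₂.symm))
  rw [mul_comm (pull _ _) (μ.push _ _), ← μ.push_mul_pull, μ.push_push]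
  refine congrArg (μ.push _) ?_
  simp only [kron, pull_mul, pull_pull]
  exact (mul_mul_mul_comm _ _ _ _).trans (mul_comm _ _)

theorem matMul_add {X Y Z : FinGSet G} (C : InvFun k (Z.prod Y)) (A B : InvFun k (Y.prod X)) :
    μ.matMul C (A + B) = μ.matMul C A + μ.matMul C B := by
  refine Eq.trans (congrArg (μ.push _) ?_) (μ.push_add _ _ _)
  exact mul_add _ _ _

theorem add_matMul {X Y Z : FinGSet G} (C D : InvFun k (Z.prod Y)) (A : InvFun k (Y.prod X)) :
    μ.matMul (C + D) A = μ.matMul C A + μ.matMul D A := by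
  refine Eq.trans (congrArg (μ.push _) ?_) (μ.push_add _ _ _)
  exact add_mul _ _ _

theorem matMul_smul {X Y Z : FinGSet G} (c : k) (C : InvFun k (Z.prod Y))
    (A : InvFun k (Y.prod X)) : μ.matMul C (c • A) = c • μ.matMul C A := by
  refine Eq.trans (congrArg (μ.push _) ?_) (μ.push_smul _ _ _)
  exact mul_smul_comm c _ (pull snd A)

theorem smul_matMul {X Y Z : FinGSet G} (c : k) (C : InvFun k (Z.prod Y))
    (A : InvFun k (Y.prod X)) : μ.matMul (c • C) A = c • μ.matMul C A := by
  refine Eq.trans (congrArg (μ.push _) ?_) (μ.push_smul _ _ _)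
  exact smul_mul_assoc c (pull (pair fst (fst.comp snd)) C) _

open scoped Classical in
theorem graph_cls {X Y : FinGSet G} (e : X →[G] Y) (y : Y) (x : X) :
    graph k e (cls (pr y x)) = if y = e x then 1 else 0 := rfl

theorem matMul_graph_cls {X Y Z : FinGSet G} (B : InvFun k (Z.prod Y)) (e : X →[G] Y)
    (z : Z) (x : X) : μ.matMul B (graph k e) (cls (pr z x)) = B (cls (pr z (e x))) := by
  rw [matMul_graph]
  rfl

theorem matMul_id {X Y : FinGSet G} (B : InvFun k (Y.prod X)) :
    μ.matMul B (graph k (MulActionHom.id G)) = B :=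
  invFun_ext fun p => μ.matMul_graph_cls B (MulActionHom.id G) (fst p) (snd p)

theorem graph_matMul_cls {X Y Z : FinGSet G} (e : Y →[G] Z) (he : Function.Injective e)
    (A : InvFun k (Y.prod X)) (y : Y) (x : X) :
    μ.matMul (graph k e) A (cls (pr (e y) x)) = A (cls (pr y x)) := by
  rw [graph_matMul]
  refine μ.push_injective (pair (e.comp fst) snd) (fun p q h => prod_ext (he ?_) ?_) A
    (cls (pr y x))
  · exact fst_eq (p := pair (e.comp fst) snd p) (q := pair (e.comp fst) snd q) h
  · exact snd_eq (p := pair (e.comp fst) snd p) (q := pair (e.comp fst) snd q) h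

theorem id_matMul {X Y : FinGSet G} (A : InvFun k (Y.prod X)) :
    μ.matMul (graph k (MulActionHom.id G)) A = A :=
  invFun_ext fun p => μ.graph_matMul_cls (MulActionHom.id G) (fun _ _ h => h) A (fst p) (snd p)

theorem graph_matMul_graph {X Y Z : FinGSet G} (e' : Y →[G] Z) (e : X →[G] Y) :
    μ.matMul (graph k e') (graph k e) = graph k (e'.comp e) :=
  invFun_ext fun p => μ.matMul_graph_cls (graph k e') e (fst p) (snd p)

theorem kron_graph {X Y X' Y' : FinGSet G} (e : X →[G] Y) (e' : X' →[G] Y') :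
    kron (graph k e) (graph k e') = graph k (pair (e.comp fst) (e'.comp snd)) := by
  classical
  refine invFun_ext fun p => ?_
  change (if fst (fst p) = e (fst (snd p)) then (1 : k) else 0) *
    (if snd (fst p) = e' (snd (snd p)) then 1 else 0) =
    if fst p = pr (e (fst (snd p))) (e' (snd (snd p))) then 1 else 0
  have h : fst p = pr (e (fst (snd p))) (e' (snd (snd p))) ↔
      fst (fst p) = e (fst (snd p)) ∧ snd (fst p) = e' (snd (snd p)) :=
    ⟨fun h => ⟨fst_eq h, snd_eq h⟩, fun h => prod_ext h.1 h.2⟩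
  rw [if_congr h rfl rfl]
  split_ifs <;> simp_all

theorem graph_natural {X Y X' Y' : FinGSet G} (e : Y →[G] Y') (he : Function.Bijective e)
    (e' : X →[G] X') (A : InvFun k (Y.prod X)) (A' : InvFun k (Y'.prod X'))
    (h : ∀ y x, A (cls (pr y x)) = A' (cls (pr (e y) (e' x)))) :
    μ.matMul (graph k e) A = μ.matMul A' (graph k e') := by
  refine invFun_ext fun p => ?_
  obtain ⟨y, hy⟩ := he.2 (fst p)
  have hp : p = pr (e y) (snd p) := prod_ext hy.symm rfl
  rw [hp, graph_matMul_cls _ e he.1, matMul_graph_cls]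
  exact h _ _

end Matrix
end GMeasure

/-- The objects `Vec_X` of the category of permutation modules attached to a measure `μ`, where `X`
is a finitary smooth `G`-set. -/
structure PermObj {G : Type u} [Group G] [TopologicalSpace G] {k : Type v} [CommRing k]
    (μ : GMeasure G k) where
  /-- the underlying finitary smooth `G`-set -/
  set : FinGSet G

namespace PermObj

open FinGSet GMeasure

variable {G : Type u} [Group G] [TopologicalSpace G] [RoelckePrecompact G]
variable {k : Type v} [CommRing k] {μ : GMeasure G k}

/-- Morphisms `Vec_X ⟶ Vec_Y` are `Y × X` matrices, and composition is matrix multiplication. -/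
noncomputable instance : Category (PermObj μ) where
  Hom X Y := InvFun k (Y.set.prod X.set)
  id X := graph k (MulActionHom.id G)
  comp f g := μ.matMul g f
  id_comp f := μ.matMul_id f
  comp_id f := μ.id_matMul f
  assoc f g h := (μ.matMul_assoc h g f).symm

noncomputable instance : Preadditive (PermObj μ) where
  homGroup X Y := inferInstanceAs (AddCommGroup (InvFun k (Y.set.prod X.set)))
  add_comp _ _ _ f g h := μ.matMul_add h f g
  comp_add _ _ _ f g h := μ.add_matMul g h f

noncomputable instance : Linear k (PermObj μ) where
  homModule X Y := inferInstanceAs (Module k (InvFun k (Y.set.prod X.set)))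
  smul_comp _ _ _ c f g := μ.matMul_smul c g f
  comp_smul _ _ _ f c g := μ.smul_matMul c g f

/-- The morphism given by a map of `G`-sets. -/
noncomputable def ofMap {X Y : PermObj μ} (e : X.set →[G] Y.set) : X ⟶ Y := graph k e

theorem ofMap_comp_ofMap {X Y Z : PermObj μ} (e : X.set →[G] Y.set) (e' : Y.set →[G] Z.set) :
    ofMap e ≫ ofMap e' = ofMap (e'.comp e) :=
  μ.graph_matMul_graph e' e

theorem id_eq_ofMap (X : PermObj μ) : 𝟙 X = ofMap (MulActionHom.id G) := rfl

/-- The isomorphism given by mutually inverse maps of `G`-sets. -/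
noncomputable def isoOfMaps {X Y : PermObj μ} (e : X.set →[G] Y.set) (e' : Y.set →[G] X.set)
    (h : ∀ x, e' (e x) = x) (h' : ∀ y, e (e' y) = y) : X ≅ Y where
  hom := ofMap e
  inv := ofMap e'
  hom_inv_id := (ofMap_comp_ofMap e e').trans (congrArg ofMap (MulActionHom.ext h))
  inv_hom_id := (ofMap_comp_ofMap e' e).trans (congrArg ofMap (MulActionHom.ext h'))

/-- `Vec_X ⊗ Vec_Y = Vec_{X × Y}`. -/
abbrev tensObj (X Y : PermObj μ) : PermObj μ := ⟨X.set.prod Y.set⟩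

/-- The tensor product of morphisms is the Kronecker product of matrices. -/
def tensHom {X Y X' Y' : PermObj μ} (f : X ⟶ Y) (g : X' ⟶ Y') : tensObj X X' ⟶ tensObj Y Y' :=
  kron f g

/-- The unit object `Vec_1`, where `1` is the one-point `G`-set. -/
abbrev tensUnit : PermObj μ := ⟨pt⟩

/-- The associativity of products. -/
def assocMap (X Y Z : FinGSet G) : (X.prod Y).prod Z →[G] X.prod (Y.prod Z) :=
  pair (fst.comp fst) (pair (snd.comp fst) snd)

/-- The inverse associativity of products. -/
def assocInv (X Y Z : FinGSet G) : X.prod (Y.prod Z) →[G] (X.prod Y).prod Z :=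
  pair (pair fst (fst.comp snd)) (snd.comp snd)

/-- The symmetry of products. -/
def swapMap (X Y : FinGSet G) : X.prod Y →[G] Y.prod X := pair snd fst

noncomputable instance : MonoidalCategoryStruct (PermObj μ) where
  tensorObj := tensObj
  tensorHom := tensHom
  whiskerLeft X _ _ f := tensHom (𝟙 X) f
  whiskerRight f X := tensHom f (𝟙 X)
  tensorUnit := tensUnit
  associator X Y Z := isoOfMaps (X := tensObj (tensObj X Y) Z) (Y := tensObj X (tensObj Y Z))
    (assocMap X.set Y.set Z.set) (assocInv X.set Y.set Z.set) (fun _ => rfl) (fun _ => rfl)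
  leftUnitor X := isoOfMaps (X := tensObj tensUnit X) snd (pair X.set.toPt (MulActionHom.id G))
    (fun _ => rfl) (fun _ => rfl)
  rightUnitor X := isoOfMaps (X := tensObj X tensUnit) fst (pair (MulActionHom.id G) X.set.toPt)
    (fun _ => rfl) (fun _ => rfl)

theorem tensHom_ofMap {X Y X' Y' : PermObj μ} (e : X.set →[G] Y.set) (e' : X'.set →[G] Y'.set) :
    tensHom (ofMap e) (ofMap e') =
      ofMap (X := tensObj X X') (Y := tensObj Y Y') (pair (e.comp fst) (e'.comp snd)) :=
  kron_graph e e'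

theorem tensHom_id (X Y : PermObj μ) : tensHom (𝟙 X) (𝟙 Y) = 𝟙 (tensObj X Y) :=
  tensHom_ofMap (X := X) (X' := Y) (MulActionHom.id G) (MulActionHom.id G)

theorem tensHom_comp {X₁ Y₁ Z₁ X₂ Y₂ Z₂ : PermObj μ} (f₁ : X₁ ⟶ Y₁) (f₂ : X₂ ⟶ Y₂)
    (g₁ : Y₁ ⟶ Z₁) (g₂ : Y₂ ⟶ Z₂) :
    tensHom f₁ f₂ ≫ tensHom g₁ g₂ = tensHom (f₁ ≫ g₁) (f₂ ≫ g₂) :=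
  μ.kron_matMul g₁ f₁ g₂ f₂

theorem ofMap_natural {X Y X' Y' : PermObj μ} (e : Y.set →[G] Y'.set) (he : Function.Bijective e)
    (e' : X.set →[G] X'.set) (f : X ⟶ Y) (f' : X' ⟶ Y')
    (h : ∀ y x, (f : InvFun k (Y.set.prod X.set)) (cls (pr y x)) =
      (f' : InvFun k (Y'.set.prod X'.set)) (cls (pr (e y) (e' x)))) :
    f ≫ ofMap e = ofMap e' ≫ f' :=
  μ.graph_natural e he e' f f' h

theorem pentagon (W X Y Z : PermObj μ) :
    tensHom (α_ W X Y).hom (𝟙 Z) ≫ (α_ W (X ⊗ Y) Z).hom ≫ tensHom (𝟙 W) (α_ X Y Z).hom =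
      (α_ (W ⊗ X) Y Z).hom ≫ (α_ W X (Y ⊗ Z)).hom := by
  change tensHom (ofMap _) (ofMap _) ≫ ofMap _ ≫ tensHom (ofMap _) (ofMap _) = ofMap _ ≫ ofMap _
  rw [tensHom_ofMap, tensHom_ofMap, ofMap_comp_ofMap, ofMap_comp_ofMap, ofMap_comp_ofMap]
  rfl

theorem triangle (X Y : PermObj μ) :
    (α_ X (𝟙_ _) Y).hom ≫ tensHom (𝟙 X) (λ_ Y).hom = tensHom (ρ_ X).hom (𝟙 Y) := by
  change ofMap _ ≫ tensHom (ofMap _) (ofMap _) = tensHom (ofMap _) (ofMap _)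
  rw [tensHom_ofMap, tensHom_ofMap, ofMap_comp_ofMap]
  rfl

noncomputable instance : MonoidalCategory (PermObj μ) :=
  MonoidalCategory.ofTensorHom
    (id_tensorHom_id := tensHom_id)
    (id_tensorHom := fun _ _ _ _ => rfl)
    (tensorHom_id := fun _ _ => rfl)
    (tensorHom_comp_tensorHom := tensHom_comp)
    (associator_naturality := fun {X₁ X₂ X₃ Y₁ Y₂ Y₃} f₁ f₂ f₃ =>
      ofMap_natural (X := tensObj (tensObj X₁ X₂) X₃) (X' := tensObj X₁ (tensObj X₂ X₃))
        (Y := tensObj (tensObj Y₁ Y₂) Y₃) (Y' := tensObj Y₁ (tensObj Y₂ Y₃))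
        (assocMap Y₁.set Y₂.set Y₃.set)
        (Function.bijective_iff_has_inverse.2
          ⟨assocInv Y₁.set Y₂.set Y₃.set, fun _ => rfl, fun _ => rfl⟩)
        (assocMap X₁.set X₂.set X₃.set) _ _ fun _ _ => mul_assoc _ _ _)
    (leftUnitor_naturality := fun {X Y} f =>
      ofMap_natural (X := tensObj tensUnit X) (X' := X) (Y := tensObj tensUnit Y) (Y' := Y)
        snd (Function.bijective_iff_has_inverse.2
          ⟨pair Y.set.toPt (MulActionHom.id G), fun _ => rfl, fun _ => rfl⟩)
        snd _ _ fun y x => by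
          refine (congrArg (· * _) (?_ : _ = (1 : k))).trans (one_mul _)
          exact (graph_cls (k := k) (MulActionHom.id G) (fst y) (fst x)).trans (if_pos rfl))
    (rightUnitor_naturality := fun {X Y} f =>
      ofMap_natural (X := tensObj X tensUnit) (X' := X) (Y := tensObj Y tensUnit) (Y' := Y)
        fst (Function.bijective_iff_has_inverse.2
          ⟨pair (MulActionHom.id G) Y.set.toPt, fun _ => rfl, fun _ => rfl⟩)
        fst _ _ fun y x => by
          refine (congrArg (_ * ·) (?_ : _ = (1 : k))).trans (mul_one _)
          exact (graph_cls (k := k) (MulActionHom.id G) (snd y) (snd x)).trans (if_pos rfl))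
    (pentagon := pentagon)
    (triangle := triangle)

theorem braid_natural {X₁ X₂ Y₁ Y₂ : PermObj μ} (f : X₁ ⟶ Y₁) (g : X₂ ⟶ Y₂) :
    tensHom f g ≫ ofMap (X := tensObj Y₁ Y₂) (Y := tensObj Y₂ Y₁) (swapMap Y₁.set Y₂.set) =
      ofMap (X := tensObj X₁ X₂) (Y := tensObj X₂ X₁) (swapMap X₁.set X₂.set) ≫ tensHom g f :=
  ofMap_natural (X := tensObj X₁ X₂) (X' := tensObj X₂ X₁)
    (Y := tensObj Y₁ Y₂) (Y' := tensObj Y₂ Y₁) _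
    (Function.bijective_iff_has_inverse.2 ⟨swapMap Y₂.set Y₁.set, fun _ => rfl, fun _ => rfl⟩)
    _ _ _ fun _ _ => mul_comm _ _

/-- The symmetry isomorphism. -/
noncomputable def braid (X Y : PermObj μ) : X ⊗ Y ≅ Y ⊗ X :=
  isoOfMaps (X := tensObj X Y) (Y := tensObj Y X) (swapMap X.set Y.set) (swapMap Y.set X.set)
    (fun _ => rfl) (fun _ => rfl)

theorem hexagon_forward (X Y Z : PermObj μ) :
    (α_ X Y Z).hom ≫ (braid X (Y ⊗ Z)).hom ≫ (α_ Y Z X).hom =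
      tensHom (braid X Y).hom (𝟙 Z) ≫ (α_ Y X Z).hom ≫ tensHom (𝟙 Y) (braid X Z).hom := by
  change ofMap _ ≫ ofMap _ ≫ ofMap _ =
    tensHom (ofMap _) (ofMap _) ≫ ofMap _ ≫ tensHom (ofMap _) (ofMap _)
  rw [tensHom_ofMap, tensHom_ofMap, ofMap_comp_ofMap, ofMap_comp_ofMap, ofMap_comp_ofMap,
    ofMap_comp_ofMap]
  rfl

theorem hexagon_reverse (X Y Z : PermObj μ) :
    (α_ X Y Z).inv ≫ (braid (X ⊗ Y) Z).hom ≫ (α_ Z X Y).inv =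
      tensHom (𝟙 X) (braid Y Z).hom ≫ (α_ X Z Y).inv ≫ tensHom (braid X Z).hom (𝟙 Y) := by
  change ofMap _ ≫ ofMap _ ≫ ofMap _ =
    tensHom (ofMap _) (ofMap _) ≫ ofMap _ ≫ tensHom (ofMap _) (ofMap _)
  rw [tensHom_ofMap, tensHom_ofMap, ofMap_comp_ofMap, ofMap_comp_ofMap, ofMap_comp_ofMap,
    ofMap_comp_ofMap]
  rfl

noncomputable instance : SymmetricCategory (PermObj μ) where
  braiding := braid
  braiding_naturality_right X _ _ f := braid_natural (𝟙 X) f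
  braiding_naturality_left f Z := braid_natural f (𝟙 Z)
  hexagon_forward := hexagon_forward
  hexagon_reverse := hexagon_reverse
  symmetry X Y := (braid X Y).hom_inv_id

end PermObj

/-- A Cantor space is a topological space homeomorphic to the Cantor set. -/
class IsCantorSpace (𝔛 : Type u) [TopologicalSpace 𝔛] : Prop where
  nonempty_homeomorph : Nonempty (𝔛 ≃ₜ cantorSet)

namespace IsCantorSpace

/-- A continuous bijection from a compact space to a Hausdorff space is a homeomorphism. -/
theorem nonempty_homeo {A B : Type*} [TopologicalSpace A] [TopologicalSpace B] [CompactSpace A]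
    [T2Space B] (f : A → B) (hf : Continuous f) (hb : Function.Bijective f) :
    Nonempty (A ≃ₜ B) :=
  ⟨Continuous.homeoOfEquivCompactToT2 (f := Equiv.ofBijective f hb) hf⟩

/-- Prepend an entry to a sequence. -/
def cons (b : Bool) (x : ℕ → Bool) : ℕ → Bool := fun n => n.casesOn b x

theorem continuous_cons (b : Bool) : Continuous (cons b) :=
  continuous_pi fun n => by
    cases n with
    | zero => exact continuous_const
    | succ n => exact continuous_apply n

theorem cons_tail (x : ℕ → Bool) : cons (x 0) (fun n => x (n + 1)) = x := by
  funext n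
  cases n <;> rfl

theorem cons_inj {b c : Bool} {x y : ℕ → Bool} (h : cons b x = cons c y) : b = c ∧ x = y :=
  ⟨congrFun h 0, funext fun n => congrFun h (n + 1)⟩

/-- The part of a set of sequences that starts with a given entry. -/
theorem nonempty_sum (U : Set (ℕ → Bool)) (hU : IsClosed U) :
    Nonempty ((cons false ⁻¹' U) ⊕ (cons true ⁻¹' U) ≃ₜ U) := by
  have h : ∀ b, CompactSpace (cons b ⁻¹' U) := fun b =>
    isCompact_iff_compactSpace.1 (hU.preimage (continuous_cons b)).isCompact
  have h₀ := h false
  have h₁ := h true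
  refine nonempty_homeo (Sum.elim (fun x => ⟨cons false x.1, x.2⟩) fun x => ⟨cons true x.1, x.2⟩)
    (Continuous.sumElim
      (((continuous_cons false).comp continuous_subtype_val).subtype_mk _)
      (((continuous_cons true).comp continuous_subtype_val).subtype_mk _)) ⟨?_, ?_⟩
  · rintro (x | x) (y | y) hxy
    · exact congrArg Sum.inl (Subtype.ext (cons_inj (congrArg Subtype.val hxy)).2)
    · exact absurd (cons_inj (congrArg Subtype.val hxy)).1 (by simp)
    · exact absurd (cons_inj (congrArg Subtype.val hxy)).1 (by simp)
    · exact congrArg Sum.inr (Subtype.ext (cons_inj (congrArg Subtype.val hxy)).2)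
  · rintro ⟨x, hx⟩
    have hc := cons_tail x
    cases hx0 : x 0 with
    | false =>
      rw [hx0] at hc
      exact ⟨Sum.inl ⟨fun n => x (n + 1), by rwa [Set.mem_preimage, hc]⟩, Subtype.ext hc⟩
    | true =>
      rw [hx0] at hc
      exact ⟨Sum.inr ⟨fun n => x (n + 1), by rwa [Set.mem_preimage, hc]⟩, Subtype.ext hc⟩

theorem nonempty_homeo_of_level (N : ℕ) : ∀ U : Set (ℕ → Bool), IsClosed U →
    (∀ x y : ℕ → Bool, (∀ i < N, x i = y i) → x ∈ U → y ∈ U) → U.Nonempty →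
    Nonempty (U ≃ₜ (ℕ → Bool)) := by
  induction N with
  | zero =>
    rintro U - h ⟨x, hx⟩
    have hU : U = Set.univ := Set.eq_univ_of_forall fun y => h x y (by simp) hx
    subst hU
    exact ⟨Homeomorph.Set.univ _⟩
  | succ N ih =>
    intro U hU h hne
    have hc : ∀ b, IsClosed (cons b ⁻¹' U) := fun b => hU.preimage (continuous_cons b)
    have hl : ∀ b, ∀ x y : ℕ → Bool, (∀ i < N, x i = y i) → x ∈ cons b ⁻¹' U →
        y ∈ cons b ⁻¹' U := fun b x y hxy => h _ _ fun i hi => by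
      cases i with
      | zero => rfl
      | succ i => exact hxy i (Nat.lt_of_succ_lt_succ hi)
    obtain ⟨e⟩ := nonempty_sum U hU
    by_cases h₀ : (cons false ⁻¹' U).Nonempty <;> by_cases h₁ : (cons true ⁻¹' U).Nonempty
    · obtain ⟨e₀⟩ := ih _ (hc false) (hl false) h₀
      obtain ⟨e₁⟩ := ih _ (hc true) (hl true) h₁
      obtain ⟨e'⟩ := nonempty_sum Set.univ isClosed_univ
      exact ⟨e.symm.trans ((e₀.sumCongr e₁).trans
        ((((Homeomorph.Set.univ _).symm).sumCongr ((Homeomorph.Set.univ _).symm)).trans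
          (e'.trans (Homeomorph.Set.univ _))))⟩
    · obtain ⟨e₀⟩ := ih _ (hc false) (hl false) h₀
      have : IsEmpty (cons true ⁻¹' U) := ⟨fun x => h₁ ⟨x.1, x.2⟩⟩
      exact ⟨e.symm.trans ((Homeomorph.sumEmpty _ _).trans e₀)⟩
    · obtain ⟨e₁⟩ := ih _ (hc true) (hl true) h₁
      have : IsEmpty (cons false ⁻¹' U) := ⟨fun x => h₀ ⟨x.1, x.2⟩⟩
      exact ⟨e.symm.trans ((Homeomorph.emptySum _ _).trans e₁)⟩
    · obtain ⟨x⟩ := hne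
      rcases e.symm ⟨x, ‹_›⟩ with z | z
      · exact (h₀ ⟨z.1, z.2⟩).elim
      · exact (h₁ ⟨z.1, z.2⟩).elim

theorem exists_level (U : Set (ℕ → Bool)) (hU : IsClopen U) :
    ∃ N, ∀ x y : ℕ → Bool, (∀ i < N, x i = y i) → x ∈ U → y ∈ U := by
  have h : ∀ x : ℕ → Bool, ∃ n, ∀ y ∈ PiNat.cylinder x n, ∀ z ∈ PiNat.cylinder x n,
      y ∈ U → z ∈ U := by
    intro x
    have hb := PiNat.isTopologicalBasis_cylinders (E := fun _ => Bool)
    by_cases hx : x ∈ U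
    · obtain ⟨_, ⟨y, n, rfl⟩, hxy, hs⟩ := hb.exists_subset_of_mem_open hx hU.isOpen
      refine ⟨n, fun _ _ z hz _ => hs ?_⟩
      rw [← PiNat.mem_cylinder_iff_eq.1 hxy]
      exact hz
    · obtain ⟨_, ⟨y, n, rfl⟩, hxy, hs⟩ := hb.exists_subset_of_mem_open
        (show x ∈ Uᶜ from hx) hU.compl.isOpen
      refine ⟨n, fun w hw _ _ hwU => absurd hwU (hs ?_)⟩
      rw [← PiNat.mem_cylinder_iff_eq.1 hxy]
      exact hw
  choose n hn using h
  obtain ⟨t, -, ht⟩ := (isCompact_univ (X := ℕ → Bool)).elim_nhds_subcover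
    (fun x => PiNat.cylinder x (n x))
    fun x _ => (PiNat.isOpen_cylinder _ x (n x)).mem_nhds (PiNat.self_mem_cylinder x (n x))
  refine ⟨t.sup n, fun x y hxy => ?_⟩
  obtain ⟨z, hz, hxz⟩ := Set.mem_iUnion₂.1 (ht (Set.mem_univ x))
  refine hn z x hxz y fun i hi => ?_
  rw [← hxy i (hi.trans_le (Finset.le_sup hz))]
  exact hxz i hi

variable {𝔛 : Type u} [TopologicalSpace 𝔛] [IsCantorSpace 𝔛]

variable (𝔛) in
theorem nonempty_homeomorph_nat : Nonempty (𝔛 ≃ₜ (ℕ → Bool)) :=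
  (nonempty_homeomorph (𝔛 := 𝔛)).map fun e => e.trans cantorSetHomeomorphNatToBool

/-- Non-empty clopen subsets of a Cantor space are Cantor spaces. -/
theorem nonempty_homeo_of_isClopen (U : Set 𝔛) (hU : IsClopen U) (hne : U.Nonempty) :
    Nonempty (U ≃ₜ (ℕ → Bool)) := by
  obtain ⟨e⟩ := nonempty_homeomorph_nat 𝔛
  have hV : IsClopen (e '' U) := ⟨e.isClosed_image.2 hU.1, e.isOpen_image.2 hU.2⟩
  obtain ⟨N, hN⟩ := exists_level _ hV
  obtain ⟨e'⟩ := nonempty_homeo_of_level N _ hV.isClosed hN (hne.image e)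
  exact ⟨(e.image U).trans e'⟩

/-- Two continuous maps from a Cantor space to a finite set that have the same image differ by a
homeomorphism. -/
theorem exists_homeo {A : Type*} [Finite A] (φ ψ : LocallyConstant 𝔛 A)
    (h : Set.range φ = Set.range ψ) : ∃ g : 𝔛 ≃ₜ 𝔛, ∀ x, ψ (g x) = φ x := by
  obtain ⟨e⟩ := nonempty_homeomorph_nat 𝔛
  have hc : CompactSpace 𝔛 := e.symm.compactSpace
  have ht : T2Space 𝔛 := e.symm.t2Space
  have hfib : ∀ a, Nonempty ({x // φ x = a} ≃ₜ {x // ψ x = a}) := by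
    intro a
    by_cases ha : a ∈ Set.range φ
    · obtain ⟨x, hx⟩ := ha
      obtain ⟨y, hy⟩ : a ∈ Set.range ψ := h ▸ ⟨x, hx⟩
      obtain ⟨e₁⟩ := nonempty_homeo_of_isClopen {x | φ x = a}
        (φ.isLocallyConstant.isClopen_fiber a) ⟨x, hx⟩
      obtain ⟨e₂⟩ := nonempty_homeo_of_isClopen {x | ψ x = a}
        (ψ.isLocallyConstant.isClopen_fiber a) ⟨y, hy⟩
      exact ⟨e₁.trans e₂.symm⟩
    · have h₁ : IsEmpty {x // φ x = a} := ⟨fun x => ha ⟨x.1, x.2⟩⟩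
      have h₂ : IsEmpty {x // ψ x = a} := ⟨fun x => ha (h ▸ ⟨x.1, x.2⟩)⟩
      exact ⟨Homeomorph.empty⟩
  have f := fun a => (hfib a).some
  have hcont : Continuous fun x => (f (φ x) ⟨x, rfl⟩ : 𝔛) := by
    refine continuous_iff_continuousAt.2 fun x => ?_
    have hU : IsOpen {y | φ y = φ x} := φ.isLocallyConstant.isOpen_fiber (φ x)
    refine ContinuousOn.continuousAt (s := {y | φ y = φ x}) ?_ (hU.mem_nhds rfl)
    rw [continuousOn_iff_continuous_domRestrict]
    have h' : ({y | φ y = φ x} : Set 𝔛).domRestrict (fun x => (f (φ x) ⟨x, rfl⟩ : 𝔛)) =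
        fun y => (f (φ x) y : 𝔛) := by
      funext ⟨y, hy⟩
      change φ y = φ x at hy
      change ((f (φ y) ⟨y, rfl⟩ : {z // ψ z = φ y}) : 𝔛) = _
      generalize_proofs p
      revert p
      generalize φ x = a at hy ⊢
      subst hy
      intro _
      rfl
    rw [h']
    exact continuous_subtype_val.comp (f (φ x)).continuous
  have hψ : ∀ x, ψ (f (φ x) ⟨x, rfl⟩ : 𝔛) = φ x := fun x => (f (φ x) ⟨x, rfl⟩).2
  obtain ⟨g, hg⟩ : ∃ g : 𝔛 ≃ₜ 𝔛, ∀ x, g x = f (φ x) ⟨x, rfl⟩ := by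
    refine ⟨Continuous.homeoOfEquivCompactToT2 (f := Equiv.ofBijective _ ⟨?_, ?_⟩) hcont,
      fun _ => rfl⟩
    · intro x y hxy
      have hxy' : φ x = φ y := by rw [← hψ x, ← hψ y]; exact congrArg ψ hxy
      have key : ∀ a b (hx : φ x = a) (hy : φ y = b), a = b →
          (f a ⟨x, hx⟩ : 𝔛) = f b ⟨y, hy⟩ → x = y := by
        rintro a _ hx hy rfl h
        exact congrArg Subtype.val ((f a).injective (Subtype.ext h))
      exact key _ _ rfl rfl hxy' hxy
    · intro y
      refine ⟨(f (ψ y)).symm ⟨y, rfl⟩, ?_⟩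
      have key : ∀ a b (x : {x // φ x = b}), φ x.1 = a → (ha : φ x.1 = a) → a = b →
          (f a ⟨x.1, ha⟩ : 𝔛) = f b x := by
        rintro a _ x - ha rfl
        rfl
      refine (key _ (ψ y) _ rfl rfl ((f (ψ y)).symm ⟨y, rfl⟩).2).trans ?_
      rw [Homeomorph.apply_symm_apply]
  exact ⟨g, fun x => by rw [hg, hψ]⟩

end IsCantorSpace

/-- The group of self-homeomorphisms of a space. -/
def HomeoGroup (𝔛 : Type u) [TopologicalSpace 𝔛] : Type u := 𝔛 ≃ₜ 𝔛

namespace HomeoGroup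

open TopologicalSpace (Clopens)

section

variable {𝔛 : Type u} [TopologicalSpace 𝔛]

instance : Group (HomeoGroup 𝔛) := inferInstanceAs (Group (𝔛 ≃ₜ 𝔛))

/-- The homeomorphism underlying an element of the group. -/
def toHomeo (g : HomeoGroup 𝔛) : 𝔛 ≃ₜ 𝔛 := g

/-- The subgroup `G{𝔄₁} ∩ ⋯ ∩ G{𝔄ₙ}` of elements that map each of the clopen sets `𝔄₁, …, 𝔄ₙ`
onto itself. -/
def setStab (S : Finset (Clopens 𝔛)) : Subgroup (HomeoGroup 𝔛) where
  carrier := {g | ∀ A ∈ S, toHomeo g '' (A : Set 𝔛) = A}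
  one_mem' A _ := Set.image_id _
  mul_mem' {g h} hg hh A hA := by
    change (fun x => toHomeo g (toHomeo h x)) '' (A : Set 𝔛) = A
    rw [← Set.image_image (toHomeo g) (toHomeo h), hh A hA, hg A hA]
  inv_mem' {g} hg A hA := by
    change (toHomeo g).symm '' (A : Set 𝔛) = A
    conv_lhs => rw [← hg A hA]
    exact (toHomeo g).toEquiv.symm_image_image _

theorem mem_setStab {S : Finset (Clopens 𝔛)} {g : HomeoGroup 𝔛} :
    g ∈ setStab S ↔ ∀ A ∈ S, toHomeo g '' (A : Set 𝔛) = A := Iff.rfl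

theorem apply_mem_iff {S : Finset (Clopens 𝔛)} {g : HomeoGroup 𝔛} (hg : g ∈ setStab S)
    {A : Clopens 𝔛} (hA : A ∈ S) (x : 𝔛) : toHomeo g x ∈ A ↔ x ∈ A := by
  have h : toHomeo g x ∈ toHomeo g '' (A : Set 𝔛) ↔ x ∈ (A : Set 𝔛) :=
    (toHomeo g).injective.mem_set_image
  rwa [hg A hA] at h

/-- The topology for which the subgroups `G{𝔄₁} ∩ ⋯ ∩ G{𝔄ₙ}`, with `𝔄₁, …, 𝔄ₙ` clopen, are a
neighbourhood basis of the identity. -/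
instance : TopologicalSpace (HomeoGroup 𝔛) where
  IsOpen U := ∀ g ∈ U, ∃ S : Finset (Clopens 𝔛), ∀ h ∈ setStab S, g * h ∈ U
  isOpen_univ _ _ := ⟨∅, fun _ _ => trivial⟩
  isOpen_inter U V hU hV g hg := by
    classical
    obtain ⟨S, hS⟩ := hU g hg.1
    obtain ⟨T, hT⟩ := hV g hg.2
    exact ⟨S ∪ T, fun h hh => ⟨hS h fun A hA => hh A (Finset.mem_union_left T hA),
      hT h fun A hA => hh A (Finset.mem_union_right S hA)⟩⟩
  isOpen_sUnion s hs g hg := by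
    obtain ⟨U, hU, hgU⟩ := hg
    obtain ⟨S, hS⟩ := hs U hU g hgU
    exact ⟨S, fun h hh => ⟨U, hU, hS h hh⟩⟩

theorem isOpen_iff {U : Set (HomeoGroup 𝔛)} : IsOpen U ↔
    ∀ g ∈ U, ∃ S : Finset (Clopens 𝔛), ∀ h ∈ setStab S, g * h ∈ U := Iff.rfl

theorem isOpen_of_setStab_le {U : Subgroup (HomeoGroup 𝔛)} (S : Finset (Clopens 𝔛))
    (h : setStab S ≤ U) : IsOpen (U : Set (HomeoGroup 𝔛)) :=
  isOpen_iff.2 fun _ hg => ⟨S, fun _ hk => U.mul_mem hg (h hk)⟩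

theorem exists_setStab_le {U : Subgroup (HomeoGroup 𝔛)} (hU : IsOpen (U : Set (HomeoGroup 𝔛))) :
    ∃ S : Finset (Clopens 𝔛), setStab S ≤ U := by
  obtain ⟨S, hS⟩ := isOpen_iff.1 hU 1 U.one_mem
  exact ⟨S, fun h hh => by simpa using hS h hh⟩

/-- The locally constant map that records to which of finitely many clopen sets a point belongs. -/
def member (S : Finset (Clopens 𝔛)) : LocallyConstant 𝔛 (S → Prop) where
  toFun x A := x ∈ A.1
  isLocallyConstant := by
    refine (IsLocallyConstant.iff_eventually_eq _).2 fun x => ?_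
    have h : ∀ A : S, ∀ᶠ y in nhds x, (y ∈ A.1) = (x ∈ A.1) := by
      intro A
      by_cases hx : x ∈ A.1
      · filter_upwards [A.1.isClopen.isOpen.mem_nhds hx] with y hy
        exact propext ⟨fun _ => hx, fun _ => hy⟩
      · filter_upwards [A.1.isClopen.compl.isOpen.mem_nhds hx] with y hy
        exact propext ⟨fun h => absurd h hy, fun h => absurd h hx⟩
    filter_upwards [Filter.eventually_all.2 h] with y hy
    exact funext hy

/-- The action on locally constant maps, `g • φ = φ ∘ g⁻¹`. -/
instance {A : Type w} : MulAction (HomeoGroup 𝔛) (LocallyConstant 𝔛 A) where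
  smul g φ := φ.comap ⟨(toHomeo g).symm, (toHomeo g).symm.continuous⟩
  one_smul _ := rfl
  mul_smul _ _ _ := rfl

theorem smul_apply {A : Type w} (g : HomeoGroup 𝔛) (φ : LocallyConstant 𝔛 A) (x : 𝔛) :
    (g • φ) x = φ ((toHomeo g).symm x) := rfl

theorem range_smul {A : Type w} (g : HomeoGroup 𝔛) (φ : LocallyConstant 𝔛 A) :
    Set.range (g • φ) = Set.range φ :=
  (toHomeo g).symm.surjective.range_comp φ

theorem mem_setStab_of_smul {S : Finset (Clopens 𝔛)} {g : HomeoGroup 𝔛}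
    (h : g • member S = member S) : g ∈ setStab S := by
  intro A hA
  have h' : ∀ x, (toHomeo g).symm x ∈ A ↔ x ∈ A := fun x =>
    iff_of_eq (congrFun (congrArg (fun φ : LocallyConstant 𝔛 (S → Prop) => φ x) h) ⟨A, hA⟩)
  ext x
  rw [(toHomeo g).image_eq_preimage_symm]
  exact h' x

theorem isOpen_stabilizer {A : Type w} [Finite A] (φ : LocallyConstant 𝔛 A) :
    IsOpen (MulAction.stabilizer (HomeoGroup 𝔛) φ : Set (HomeoGroup 𝔛)) := by
  classical
  have := Fintype.ofFinite A
  let c : A → Clopens 𝔛 := fun a => ⟨{x | φ x = a}, φ.isLocallyConstant.isClopen_fiber a⟩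
  refine isOpen_of_setStab_le (Finset.univ.image c) fun g hg => ?_
  refine LocallyConstant.ext fun x => ?_
  have h := apply_mem_iff hg (Finset.mem_image_of_mem c (Finset.mem_univ (φ ((toHomeo g).symm x))))
    ((toHomeo g).symm x)
  rw [Homeomorph.apply_symm_apply] at h
  exact (h.2 rfl).symm

end

variable {𝔛 : Type u} [TopologicalSpace 𝔛] [IsCantorSpace 𝔛]

theorem exists_smul_eq {A : Type w} [Finite A] (φ ψ : LocallyConstant 𝔛 A)
    (h : Set.range φ = Set.range ψ) : ∃ g : HomeoGroup 𝔛, g • φ = ψ := by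
  obtain ⟨g, hg⟩ := IsCantorSpace.exists_homeo φ ψ h
  refine ⟨g, LocallyConstant.ext fun x => ?_⟩
  change φ (g.symm x) = ψ x
  rw [← hg, Homeomorph.apply_symm_apply]

instance : RoelckePrecompact (HomeoGroup 𝔛) where
  finite_quotient U V hU hV := by
    obtain ⟨S, hS⟩ := exists_setStab_le hU
    obtain ⟨T, hT⟩ := exists_setStab_le hV
    let p : HomeoGroup 𝔛 → LocallyConstant 𝔛 ((S → Prop) × (T → Prop)) := fun g =>
      ⟨fun x => (member S x, (g • member T) x), (member S).isLocallyConstant.prodMk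
        (g • member T).isLocallyConstant⟩
    refine Finite.of_injective (fun q : DoubleCoset.Quotient (U : Set (HomeoGroup 𝔛)) V =>
      Set.range (p q.out)) fun q q' h => ?_
    obtain ⟨k, hk⟩ := exists_smul_eq _ _ h
    have h₁ : k • member S = member S := LocallyConstant.ext fun x =>
      congrArg (fun φ : LocallyConstant 𝔛 ((S → Prop) × (T → Prop)) => (φ x).1) hk
    have h₂ : k • q.out • member T = q'.out • member T := LocallyConstant.ext fun x =>
      congrArg (fun φ : LocallyConstant 𝔛 ((S → Prop) × (T → Prop)) => (φ x).2) hk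
    have h₃ : (q.out⁻¹ * k⁻¹ * q'.out) • member T = member T := by
      rw [mul_smul, ← h₂, mul_smul, inv_smul_smul, inv_smul_smul]
    rw [← DoubleCoset.out_eq' U V q, ← DoubleCoset.out_eq' U V q']
    refine (DoubleCoset.eq U V _ _).2
      ⟨k, hS (mem_setStab_of_smul h₁), _, hT (mem_setStab_of_smul h₃), ?_⟩
    group

end HomeoGroup

section CantorSets

variable (𝔛 : Type u) [TopologicalSpace 𝔛] [IsCantorSpace 𝔛]

/-- The `G`-set `Y(A)` of all continuous maps from `𝔛` to the finite discrete space `A`, that is,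
of all locally constant maps. -/
def mapSet (A : Type) [Finite A] : FinGSet (HomeoGroup 𝔛) where
  carrier := LocallyConstant 𝔛 A
  smooth := HomeoGroup.isOpen_stabilizer
  finitary := by
    refine Finite.of_injective (β := Set A)
      (Quotient.lift (fun φ : LocallyConstant 𝔛 A => Set.range φ) fun φ ψ h => ?_) ?_
    · obtain ⟨g, rfl⟩ := MulAction.orbitRel_apply.1 h
      exact HomeoGroup.range_smul g ψ
    · intro a b
      refine Quotient.inductionOn₂ a b fun φ ψ h => ?_
      obtain ⟨g, hg⟩ := HomeoGroup.exists_smul_eq ψ φ (Eq.symm h)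
      exact Quotient.sound (MulAction.orbitRel_apply.2 ⟨g, hg⟩)

/-- The `G`-set `X(A)` of all continuous surjections from `𝔛` to the finite discrete space `A`. -/
def surjSet (A : Type) [Finite A] : FinGSet (HomeoGroup 𝔛) :=
  (mapSet 𝔛 A).filter (fun φ : LocallyConstant 𝔛 A => Function.Surjective φ)
    fun g φ h => Set.range_eq_univ.1 ((HomeoGroup.range_smul g φ).trans (Set.range_eq_univ.2 h))

variable {A B : Type} [Finite A] [Finite B]

/-- The map `Y(f) : Y(A) → Y(B)` given by composition with `f : A → B`. -/
def mapSetMap (f : A → B) : mapSet 𝔛 A →[HomeoGroup 𝔛] mapSet 𝔛 B :=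
  ⟨fun φ : LocallyConstant 𝔛 A => φ.map f, fun _ _ => rfl⟩

/-- The set of points over which the fibre of `f` has odd cardinality. -/
def oddFiber (f : A → B) : Set B := {b | Odd (Nat.card {a // f a = b})}

/-- The indicator function of `Y(D) ⊆ Y(B)`, where `D` is a subset of `B` and `Y(D)` is the set of
continuous maps to `B` with image in `D`. -/
noncomputable def mapSetInd (k : Type v) [CommRing k] (D : Set B) : (mapSet 𝔛 B).InvFun k :=
  FinGSet.ind k (fun ψ : LocallyConstant 𝔛 B => ∀ x, ψ x ∈ D)
    fun g (ψ : LocallyConstant 𝔛 B) =>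
    ((HomeoGroup.toHomeo g).symm.surjective.forall (p := fun y => ψ y ∈ D)).symm

end CantorSets

/-! Finitary smooth `G`-sets are governed by the sets `X(n)`. Two continuous maps to a finite set
are conjugate exactly when they have the same image, so the orbits of `Y(A)` are the non-empty
subsets of `A`. Every point `x` of a `G`-set is the image of a point of some `X(n)` under a map
whose fibre over `x` is finite (`exists_cover`), and both `n` and the size of the fibre depend only
on `x` (`cover_unique`). Hence `weight x`, which is `(-2)^n` divided by the size of the fibre, is
well defined.

The measure of `f : X → Y` is the total weight of the orbits of `X` divided by the weight of a point
of `Y`. Isomorphisms, additivity and composition are then formal. Base change is the identity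
`total_pullback`. Covers reduce it to a fibre product of `X(A)` and `X(B)`, whose orbits are
relations `R ⊆ A × B` projecting onto both factors, and in the end to a sum of `(-2)^|R|` over such
relations inside a fibre product of finite sets.

The number `-2` is special because the sum of `(-2)^|T|` over all `T ⊆ U` is `(-1)^|U|` and thus
sees only the parity of `U`. By inversion, the sum of `(-2)^|T|` over the `T` with `f(T) = S` is
`(-2)^|S|` if all fibres over `S` are odd, and zero otherwise (`sum_neg_two_pow_image`). For a
projection of a fibre product this yields base change; for `f` itself it is the formula for
`Y(f)_*`. Uniqueness holds because the value on a cover `X(n) → X` with finite fibres is the same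
for all measures (`val_cover`), so that the masses of the `X(n)` determine everything.

For the equivalence, a `B × A` matrix over the field with two elements is sent to the indicator
function of `Y(S)` inside `Y(B) × Y(A) = Y(B × A)`, where `S` is its support. The product of two
such functions is pushed forward along some `Y(r)`, and the formula for `Y(r)_*` retains the places
with an odd number of intermediate indices, which is matrix multiplication modulo 2 (`matFn_mul`).
The zero matrix goes to zero because `𝔛` is non-empty, and the non-zero matrices go to a basis by
triangularity with respect to inclusion of supports. So the functor from the additive envelope of
`k[𝒱]` is full with kernel generated by `[0]`, and becomes fully faithful on `k[𝒱]^♯_1`. It is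
essentially surjective on Karoubi envelopes because every `Vec_X` is a direct factor of a sum of
objects `Vec_{Y(n)}`: regularity splits a cover of `X` by sets `X(n)`, and `X(n)` is a `G`-subset of
`Y(n)`. -/

/-! ### Locally constant maps with prescribed values -/

namespace IsCantorSpace

variable {𝔛 : Type u} [TopologicalSpace 𝔛] [IsCantorSpace 𝔛]

/-- Every point has arbitrarily small clopen neighbourhoods. -/
theorem exists_isClopen_subset {U : Set 𝔛} (hU : IsOpen U) {x : 𝔛} (hx : x ∈ U) :
    ∃ V : Set 𝔛, IsClopen V ∧ x ∈ V ∧ V ⊆ U := by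
  obtain ⟨e⟩ := nonempty_homeomorph_nat 𝔛
  obtain ⟨V, hV, hxV, hVU⟩ := compact_exists_isClopen_in_isOpen (e.symm.isOpen_preimage.2 hU)
    (show e x ∈ e.symm ⁻¹' U by simpa using hx)
  refine ⟨e ⁻¹' V, hV.preimage e.continuous, hxV, fun y hy => ?_⟩
  simpa using hVU hy

/-- A non-empty open set is not contained in a finite set. -/
theorem exists_mem_notMem {U : Set 𝔛} (hU : IsOpen U) (h : U.Nonempty) {F : Set 𝔛}
    (hF : F.Finite) : ∃ y ∈ U, y ∉ F := by
  obtain ⟨x, hx⟩ := h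
  obtain ⟨V, hV, hxV, hVU⟩ := exists_isClopen_subset hU hx
  obtain ⟨e⟩ := nonempty_homeo_of_isClopen V hV ⟨x, hxV⟩
  have : Infinite V := e.toEquiv.infinite_iff.2 inferInstance
  by_contra! h
  exact Set.infinite_coe_iff.1 this (hF.subset fun y hy => h y (hVU hy))

variable {A D : Type*} (φ : LocallyConstant 𝔛 A) (K : A → Set D)

/-- A locally constant map to a set of values that depends on the point in a locally constant way
can be prescribed at finitely many points. -/
theorem exists_locallyConstant_eqOn (hK : ∀ x, (K (φ x)).Nonempty) {F : Set 𝔛} (hF : F.Finite)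
    (v : 𝔛 → D) (hv : ∀ x ∈ F, v x ∈ K (φ x)) :
    ∃ ψ : LocallyConstant 𝔛 D, (∀ x, ψ x ∈ K (φ x)) ∧ ∀ x ∈ F, ψ x = v x := by
  classical
  induction F, hF using Set.Finite.induction_on with
  | empty =>
    have hK' : ∀ a : A, ∃ d : D, ∀ x, φ x = a → d ∈ K a := by
      intro a
      by_cases ha : ∃ x, φ x = a
      · obtain ⟨x, rfl⟩ := ha
        exact ⟨_, fun _ _ => (hK x).some_mem⟩
      · by_cases hD : Nonempty 𝔛
        · exact ⟨(hK hD.some).some, fun x hx => (ha ⟨x, hx⟩).elim⟩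
        · obtain ⟨e⟩ := nonempty_homeomorph_nat 𝔛
          exact (hD ⟨e.symm fun _ => true⟩).elim
    choose d hd using hK'
    exact ⟨φ.map d, fun x => hd (φ x) x rfl, fun x hx => hx.elim⟩
  | @insert x₀ F hx₀ hF ih =>
    obtain ⟨ψ, hψ, hψF⟩ := ih fun x hx => hv x (Set.mem_insert_of_mem _ hx)
    obtain ⟨e⟩ := nonempty_homeomorph_nat 𝔛
    have : T2Space 𝔛 := e.symm.t2Space
    -- The map is changed only on a clopen neighbourhood of the new point that avoids `F` and on
    -- which `φ` is constant: there `v x₀` is permitted everywhere, and the values on `F` survive.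
    obtain ⟨V, hV, hxV, hVU⟩ := exists_isClopen_subset (U := {x | φ x = φ x₀} ∩ Fᶜ)
      ((φ.isLocallyConstant.isOpen_fiber _).inter hF.isClosed.isOpen_compl) (x := x₀) ⟨rfl, hx₀⟩
    refine ⟨⟨fun x => if LocallyConstant.ofIsClopen hV x = 0 then v x₀ else ψ x, ?_⟩,
      fun x => ?_, fun x hx => ?_⟩
    · exact ((LocallyConstant.ofIsClopen hV).isLocallyConstant.prodMk ψ.isLocallyConstant).comp
        fun p => if p.1 = 0 then v x₀ else p.2
    · change (if LocallyConstant.ofIsClopen hV x = 0 then v x₀ else ψ x) ∈ _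
      split_ifs with h
      · have hx : x ∈ V := by
          by_contra hx
          simp [LocallyConstant.ofIsClopen, hx] at h
        rw [show φ x = φ x₀ from (hVU hx).1]
        exact hv x₀ (Set.mem_insert _ _)
      · exact hψ x
    · change (if LocallyConstant.ofIsClopen hV x = 0 then v x₀ else ψ x) = _
      rcases Set.mem_insert_iff.1 hx with rfl | hx
      · simp [LocallyConstant.ofIsClopen, hxV]
      · have : x ∉ V := fun h => (hVU h).2 hx
        simp [LocallyConstant.ofIsClopen, this, hψF x hx]

/-- The map of `exists_locallyConstant_eqOn` can be chosen to take, on each fibre of `φ`, all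
permitted values. -/
theorem exists_locallyConstant_full [Finite A] [Finite D] (hK : ∀ x, (K (φ x)).Nonempty)
    {F : Set 𝔛} (hF : F.Finite) (v : 𝔛 → D) (hv : ∀ x ∈ F, v x ∈ K (φ x)) :
    ∃ ψ : LocallyConstant 𝔛 D, (∀ x, ψ x ∈ K (φ x)) ∧ (∀ x ∈ F, ψ x = v x) ∧
      ∀ x, ∀ d ∈ K (φ x), ∃ y, φ y = φ x ∧ ψ y = d := by
  classical
  -- Fullness becomes prescription at finitely many points: for each pair of a value `a` of `φ` and
  -- a permitted `d`, the value `d` is required at a new point of the fibre over `a`. New points are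
  -- available since non-empty open sets are infinite.
  have key : ∀ P : Set (A × D), P.Finite → (∀ p ∈ P, p.1 ∈ Set.range φ ∧ p.2 ∈ K p.1) →
      ∃ F' : Set 𝔛, F'.Finite ∧ F ⊆ F' ∧ ∃ v' : 𝔛 → D, (∀ x ∈ F, v' x = v x) ∧
        (∀ x ∈ F', v' x ∈ K (φ x)) ∧ ∀ p ∈ P, ∃ y ∈ F', φ y = p.1 ∧ v' y = p.2 := by
    intro P hP
    induction P, hP using Set.Finite.induction_on with
    | empty => exact fun _ => ⟨F, hF, subset_rfl, v, fun _ _ => rfl, hv, fun p hp => hp.elim⟩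
    | @insert p P hp hP ih =>
      intro h
      obtain ⟨F', hF', hFF', v', hv', hv'', h'⟩ := ih fun q hq => h q (Set.mem_insert_of_mem _ hq)
      obtain ⟨⟨x, hx⟩, hp₂⟩ := h p (Set.mem_insert _ _)
      obtain ⟨y, hy, hyF⟩ := exists_mem_notMem (U := {y | φ y = p.1})
        (φ.isLocallyConstant.isOpen_fiber _) ⟨x, hx⟩ hF'
      have hne : ∀ z ∈ F', z ≠ y := fun z hz h => hyF (h ▸ hz)
      refine ⟨insert y F', hF'.insert y, hFF'.trans (Set.subset_insert _ _),
        Function.update v' y p.2, fun z hz => ?_, fun z hz => ?_, fun q hq => ?_⟩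
      · rw [Function.update_of_ne (hne z (hFF' hz)), hv' z hz]
      · rcases Set.mem_insert_iff.1 hz with rfl | hz
        · rw [Function.update_self, show φ z = p.1 from hy]
          exact hp₂
        · rw [Function.update_of_ne (hne z hz)]
          exact hv'' z hz
      · rcases Set.mem_insert_iff.1 hq with rfl | hq
        · exact ⟨y, Set.mem_insert _ _, hy, Function.update_self _ _ _⟩
        · obtain ⟨z, hz, hz₁, hz₂⟩ := h' q hq
          exact ⟨z, Set.mem_insert_of_mem _ hz, hz₁, by rw [Function.update_of_ne (hne z hz), hz₂]⟩
  obtain ⟨F', hF', hFF', v', hv', hv'', h'⟩ :=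
    key {p | p.1 ∈ Set.range φ ∧ p.2 ∈ K p.1} (Set.toFinite _) fun p hp => hp
  obtain ⟨ψ, hψ, hψF⟩ := exists_locallyConstant_eqOn φ K hK hF' v' hv''
  refine ⟨ψ, hψ, fun x hx => (hψF x (hFF' hx)).trans (hv' x hx), fun x d hd => ?_⟩
  obtain ⟨y, hy, hy₁, hy₂⟩ := h' (φ x, d) ⟨⟨x, rfl⟩, hd⟩
  exact ⟨y, hy₁, (hψF y hy).trans hy₂⟩

end IsCantorSpace

/-! ### Covers of points by the sets `X(n)` -/

namespace FinGSet

/-- A map from a transitive `G`-set can be prescribed at a point. -/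
theorem exists_map {G : Type u} [Group G] [TopologicalSpace G] {W X : FinGSet G}
    (hW : MulAction.IsPretransitive G W) (w : W) (x : X) (h : ∀ g : G, g • w = w → g • x = x) :
    ∃ p : W →[G] X, p w = x := by
  choose g hg using fun y => hW.exists_smul_eq w y
  have key : ∀ a b : G, a • w = b • w → a • x = b • x := by
    intro a b hab
    have := h (b⁻¹ * a) (by rw [mul_smul, hab, inv_smul_smul])
    rw [mul_smul, inv_smul_eq_iff] at this
    exact this
  refine ⟨⟨fun y => g y • x, fun a y => ?_⟩, ?_⟩
  · refine Eq.trans (key _ (a * g y) ?_) (mul_smul a (g y) x)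
    rw [hg, mul_smul, hg]
  · exact (key _ 1 (by rw [hg, one_smul])).trans (one_smul _ _)

end FinGSet

namespace HomeoGroup

theorem smul_eq_iff {𝔛 : Type u} [TopologicalSpace 𝔛] {A : Type*} {g : HomeoGroup 𝔛} {φ ψ : LocallyConstant 𝔛 A} :
    g • φ = ψ ↔ ∀ x, φ ((toHomeo g).symm x) = ψ x :=
  ⟨fun h x => congrArg (fun φ : LocallyConstant 𝔛 A => φ x) h, fun h => LocallyConstant.ext h⟩

variable {𝔛 : Type u} [TopologicalSpace 𝔛] [IsCantorSpace 𝔛] {A B : Type} [Finite A] [Finite B]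

/-- The continuous surjection underlying an element of `X(A)`. -/
def toLC (φ : surjSet 𝔛 A) : LocallyConstant 𝔛 A := φ.1

/-- An element of `X(A)` from a continuous surjection. -/
def ofLC (φ : LocallyConstant 𝔛 A) (h : Function.Surjective φ) : surjSet 𝔛 A := ⟨φ, h⟩

theorem toLC_surjective (φ : surjSet 𝔛 A) : Function.Surjective (toLC φ) := φ.2

theorem toLC_injective : Function.Injective (toLC : surjSet 𝔛 A → LocallyConstant 𝔛 A) :=
  Subtype.val_injective

theorem toLC_smul (g : HomeoGroup 𝔛) (φ : surjSet 𝔛 A) : toLC (g • φ) = g • toLC φ := rfl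

theorem surjSet_pretransitive : MulAction.IsPretransitive (HomeoGroup 𝔛) (surjSet 𝔛 A) := by
  refine ⟨fun φ ψ => ?_⟩
  obtain ⟨g, hg⟩ := exists_smul_eq (toLC φ) (toLC ψ)
    ((toLC_surjective φ).range_eq.trans (toLC_surjective ψ).range_eq.symm)
  exact ⟨g, toLC_injective hg⟩

/-- Two pairs of locally constant maps with the same set of pairs of values are conjugate. -/
theorem exists_smul_eq_pair {φ φ' : LocallyConstant 𝔛 A} {ψ ψ' : LocallyConstant 𝔛 B}
    (h₁ : ∀ x, ∃ y, φ' y = φ x ∧ ψ' y = ψ x) (h₂ : ∀ x, ∃ y, φ y = φ' x ∧ ψ y = ψ' x) :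
    ∃ g : HomeoGroup 𝔛, g • φ = φ' ∧ g • ψ = ψ' := by
  obtain ⟨g, hg⟩ := exists_smul_eq
    (⟨fun x => (φ x, ψ x), φ.isLocallyConstant.prodMk ψ.isLocallyConstant⟩ :
      LocallyConstant 𝔛 (A × B))
    ⟨fun x => (φ' x, ψ' x), φ'.isLocallyConstant.prodMk ψ'.isLocallyConstant⟩ (by
      ext p
      constructor
      · rintro ⟨x, rfl⟩
        obtain ⟨y, h, h'⟩ := h₁ x
        exact ⟨y, Prod.ext h h'⟩
      · rintro ⟨x, rfl⟩
        obtain ⟨y, h, h'⟩ := h₂ x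
        exact ⟨y, Prod.ext h h'⟩)
  exact ⟨g, LocallyConstant.ext fun x => congrArg Prod.fst (smul_eq_iff.1 hg x),
    LocallyConstant.ext fun x => congrArg Prod.snd (smul_eq_iff.1 hg x)⟩

/-- If a map from `X(A)` identifies two points, the second of which takes distinct values at two
points where the first takes the same value, then it does not depend on how the union of the two
parts is divided. -/
theorem map_eq_of_merge {X : FinGSet (HomeoGroup 𝔛)} (p : surjSet 𝔛 A →[HomeoGroup 𝔛] X)
    {φ ψ : surjSet 𝔛 A} (h : p φ = p ψ) {x₁ x₂ : 𝔛} (hφ : toLC φ x₁ = toLC φ x₂)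
    (hψ : toLC ψ x₁ ≠ toLC ψ x₂) {M : Type*} (m : A → M)
    (hm' : ∀ a b, m a = m b → a = b ∨ (a = toLC ψ x₁ ∧ b = toLC ψ x₂) ∨
      (a = toLC ψ x₂ ∧ b = toLC ψ x₁))
    {θ θ' : surjSet 𝔛 A} (hθ : ∀ x, m (toLC θ x) = m (toLC θ' x)) : p θ = p θ' := by
  set j₁ := toLC ψ x₁ with hj₁
  set j₂ := toLC ψ x₂ with hj₂
  -- the case where the corresponding parts meet
  have step : ∀ θ θ' : surjSet 𝔛 A, (∀ x, m (toLC θ x) = m (toLC θ' x)) →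
      (∃ z, toLC θ z = j₁ ∧ toLC θ' z = j₁) → (∃ z, toLC θ z = j₂ ∧ toLC θ' z = j₂) →
      p θ = p θ' := by
    intro θ θ' hθ hz₁ hz₂
    have hdiag : ∀ b, ∃ z, toLC θ z = b ∧ toLC θ' z = b := by
      intro b
      by_cases h₁ : b = j₁
      · rw [h₁]; exact hz₁
      by_cases h₂ : b = j₂
      · rw [h₂]; exact hz₂
      obtain ⟨z, hz⟩ := toLC_surjective θ b
      refine ⟨z, hz, ?_⟩
      rcases hm' _ _ (hθ z) with h' | h' | h'
      · rw [← h', hz]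
      · exact (h₁ (hz.symm.trans h'.1)).elim
      · exact (h₂ (hz.symm.trans h'.1)).elim
    -- A map `φ'` is sought such that `(φ', θ)` and `(φ', θ')` are both conjugate to `(φ, ψ)`; then
    -- `p θ = p φ' = p θ'`. Where `(θ, θ')` has the value `b`, the map `φ'` may take the values that
    -- occur in `(φ, ψ)` together with `b.1` and also with `b.2`. If `b.1 ≠ b.2`, these are `j₁` and
    -- `j₂` in some order, and the common value of `φ` at `x₁` and `x₂` is permitted.
    let K : A × A → Set A := fun b =>
      {a | (∃ z, toLC φ z = a ∧ toLC ψ z = b.1) ∧ ∃ z, toLC φ z = a ∧ toLC ψ z = b.2}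
    obtain ⟨φ', hφ', -, hfull⟩ := IsCantorSpace.exists_locallyConstant_full
      (⟨fun x => (toLC θ x, toLC θ' x),
        (toLC θ).isLocallyConstant.prodMk (toLC θ').isLocallyConstant⟩ :
        LocallyConstant 𝔛 (A × A)) K (fun x => by
          rcases hm' _ _ (hθ x) with h' | h' | h'
          · obtain ⟨z, hz⟩ := toLC_surjective ψ (toLC θ x)
            exact ⟨toLC φ z, ⟨z, rfl, hz⟩, z, rfl, hz.trans h'⟩
          · exact ⟨toLC φ x₁, ⟨x₁, rfl, h'.1.symm⟩, x₂, hφ.symm, h'.2.symm⟩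
          · exact ⟨toLC φ x₁, ⟨x₂, hφ.symm, h'.1.symm⟩, x₁, rfl, h'.2.symm⟩)
      Set.finite_empty (fun x => toLC φ x) (fun x hx => hx.elim)
    -- The points where `θ` and `θ'` agree already realize all pairs of values of `(φ, ψ)`; this is
    -- where the two parts are required to meet.
    have hsurj : ∀ x, ∃ y, φ' y = toLC φ x ∧ toLC θ y = toLC ψ x ∧ toLC θ' y = toLC ψ x := by
      intro x
      obtain ⟨z, hz, hz'⟩ := hdiag (toLC ψ x)
      obtain ⟨y, hy, hy'⟩ := hfull z (toLC φ x) ⟨⟨x, rfl, hz.symm⟩, x, rfl, hz'.symm⟩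
      exact ⟨y, hy', (congrArg Prod.fst hy).trans hz, (congrArg Prod.snd hy).trans hz'⟩
    have hφs : Function.Surjective φ' := fun a => by
      obtain ⟨x, rfl⟩ := toLC_surjective φ a
      obtain ⟨y, hy, -⟩ := hsurj x
      exact ⟨y, hy⟩
    obtain ⟨g, hg, hg'⟩ := exists_smul_eq_pair (φ := toLC φ) (ψ := toLC ψ) (φ' := φ')
      (ψ' := toLC θ) (fun x => by
        obtain ⟨y, hy, hy', -⟩ := hsurj x
        exact ⟨y, hy, hy'⟩) fun x => (hφ' x).1
    obtain ⟨g₂, hg₂, hg₂'⟩ := exists_smul_eq_pair (φ := toLC φ) (ψ := toLC ψ) (φ' := φ')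
      (ψ' := toLC θ') (fun x => by
        obtain ⟨y, hy, -, hy'⟩ := hsurj x
        exact ⟨y, hy, hy'⟩) fun x => (hφ' x).2
    have e₁ : g • φ = ofLC φ' hφs := toLC_injective hg
    have e₂ : g • ψ = θ := toLC_injective hg'
    have e₃ : g₂ • φ = ofLC φ' hφs := toLC_injective hg₂
    have e₄ : g₂ • ψ = θ' := toLC_injective hg₂'
    rw [← e₂, ← e₄, map_smul, map_smul, ← h, ← map_smul, ← map_smul, e₁, e₃]
  -- In general one passes through a third surjection `θ₀` with the same composite with `m`, equal
  -- to `j₁` at `c₁` and `d₁` and to `j₂` at `c₂` and `d₂`, so that its parts meet those of `θ` and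
  -- of `θ'`. The requirements do not clash because `d₁ ≠ c₂` and `d₂ ≠ c₁`.
  obtain ⟨c₁, hc₁⟩ := toLC_surjective θ j₁
  obtain ⟨c₂, hc₂⟩ := toLC_surjective θ j₂
  obtain ⟨d₁, hd₁, hne₁⟩ := IsCantorSpace.exists_mem_notMem (U := {x | toLC θ' x = j₁})
    ((toLC θ').isLocallyConstant.isOpen_fiber _) (toLC_surjective θ' j₁) (Set.finite_singleton c₂)
  obtain ⟨d₂, hd₂, hne₂⟩ := IsCantorSpace.exists_mem_notMem (U := {x | toLC θ' x = j₂})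
    ((toLC θ').isLocallyConstant.isOpen_fiber _) (toLC_surjective θ' j₂) (Set.finite_singleton c₁)
  change toLC θ' d₁ = j₁ at hd₁
  change toLC θ' d₂ = j₂ at hd₂
  classical
  have hcd : c₂ ≠ c₁ := fun e => hψ (by rw [← hc₁, ← hc₂, e])
  have hdd : d₂ ≠ d₁ := fun e => hψ (by rw [← hd₁, ← hd₂, e])
  let v : 𝔛 → A := fun x => if x = c₁ ∨ x = d₁ then j₁ else j₂
  have v₁ : v c₁ = j₁ := if_pos (Or.inl rfl)
  have v₂ : v d₁ = j₁ := if_pos (Or.inr rfl)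
  have v₃ : v c₂ = j₂ := if_neg (by
    rintro (e | e)
    · exact hcd e
    · exact hne₁ e.symm)
  have v₄ : v d₂ = j₂ := if_neg (by
    rintro (e | e)
    · exact hne₂ e
    · exact hdd e)
  obtain ⟨θ₀, hθ₀, hv, hfull⟩ := IsCantorSpace.exists_locallyConstant_full (toLC θ)
    (fun a => {b | m b = m a}) (fun x => ⟨toLC θ x, rfl⟩) (F := {c₁, d₁, c₂, d₂}) (Set.toFinite _) v
    (by
      rintro x (rfl | rfl | rfl | rfl)
      · rw [v₁, hc₁]; rfl
      · rw [v₂, hθ, hd₁]; rfl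
      · rw [v₃, hc₂]; rfl
      · rw [v₄, hθ, hd₂]; rfl)
  have hs : Function.Surjective θ₀ := fun a => by
    obtain ⟨x, rfl⟩ := toLC_surjective θ a
    obtain ⟨y, -, hy⟩ := hfull x (toLC θ x) rfl
    exact ⟨y, hy⟩
  have e₁ := step θ (ofLC θ₀ hs) (fun x => (hθ₀ x).symm)
    ⟨c₁, hc₁, (hv c₁ (by simp)).trans v₁⟩ ⟨c₂, hc₂, (hv c₂ (by simp)).trans v₃⟩
  have e₂ := step θ' (ofLC θ₀ hs) (fun x => (hθ x).symm.trans (hθ₀ x).symm)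
    ⟨d₁, hd₁, (hv d₁ (by simp)).trans v₂⟩ ⟨d₂, hd₂, (hv d₂ (by simp)).trans v₄⟩
  exact e₁.trans e₂.symm

/-- If `x` is fixed by the stabilizer of `φ` and has a finite fibre in `X(B)`, then every point of
the fibre is a function of `φ`. -/
theorem eq_of_finite_fiber {X : FinGSet (HomeoGroup 𝔛)} {x : X} {φ : surjSet 𝔛 A}
    (hφ : ∀ g : HomeoGroup 𝔛, g • φ = φ → g • x = x) (q : surjSet 𝔛 B →[HomeoGroup 𝔛] X)
    (hq : Finite {ψ // q ψ = x}) {ψ : surjSet 𝔛 B} (hψ : q ψ = x) {x₁ x₂ : 𝔛}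
    (h : toLC φ x₁ = toLC φ x₂) : toLC ψ x₁ = toLC ψ x₂ := by
  by_contra hne
  -- All of the finitely many points of the fibre are constant on the neighbourhood `U` of `x₁`. But
  -- some element fixing `φ`, and hence `x`, moves `ψ` to a point of the same fibre that separates
  -- `x₁` from another point `z` of `U`.
  let U : Set 𝔛 := {z | toLC φ z = toLC φ x₁} ∩ ⋂ θ : {ψ // q ψ = x}, {z | toLC θ.1 z = toLC θ.1 x₁}
  obtain ⟨z, ⟨hz, hz'⟩, hzne⟩ := IsCantorSpace.exists_mem_notMem (U := U)
    (((toLC φ).isLocallyConstant.isOpen_fiber _).inter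
      (isOpen_iInter_of_finite fun θ => (toLC θ.1).isLocallyConstant.isOpen_fiber _))
    ⟨x₁, rfl, Set.mem_iInter.2 fun _ => rfl⟩ (Set.finite_singleton x₁)
  rw [Set.mem_singleton_iff] at hzne
  change toLC φ z = toLC φ x₁ at hz
  classical
  obtain ⟨ψ', hψ', hv, hfull⟩ := IsCantorSpace.exists_locallyConstant_full (toLC φ)
    (fun a => {b | ∃ y, toLC φ y = a ∧ toLC ψ y = b}) (fun x => ⟨toLC ψ x, x, rfl, rfl⟩)
    (F := {x₁, z}) (Set.toFinite _) (fun y => if y = x₁ then toLC ψ x₁ else toLC ψ x₂) (by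
      rintro y (rfl | rfl)
      · rw [if_pos rfl]; exact ⟨y, rfl, rfl⟩
      · rw [if_neg hzne]; exact ⟨x₂, h.symm.trans hz.symm, rfl⟩)
  obtain ⟨g, hg, hg'⟩ := exists_smul_eq_pair (φ := toLC φ) (φ' := toLC φ) (ψ := toLC ψ) (ψ' := ψ')
    (fun y => hfull y _ ⟨y, rfl, rfl⟩) hψ'
  have hfix : q (g • ψ) = x := by
    rw [map_smul, hψ]
    exact hφ g (toLC_injective hg)
  have h₁ := Set.mem_iInter.1 hz' ⟨g • ψ, hfix⟩
  have e₁ : toLC (g • ψ) x₁ = toLC ψ x₁ := by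
    rw [toLC_smul, hg', hv x₁ (by simp), if_pos rfl]
  have e₂ : toLC (g • ψ) z = toLC ψ x₂ := by
    rw [toLC_smul, hg', hv z (by simp), if_neg hzne]
  exact hne (e₁.symm.trans ((Eq.symm h₁).trans e₂))

/-- Every point of a finitary smooth `G`-set is the image, under a map with a finite fibre over it,
of a point of some `X(A)`. -/
theorem exists_cover (X : FinGSet (HomeoGroup 𝔛)) (x : X) :
    ∃ (n : ℕ) (p : surjSet 𝔛 (Fin n) →[HomeoGroup 𝔛] X),
      Finite {φ // p φ = x} ∧ Nonempty {φ // p φ = x} := by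
  classical
  -- The cover is taken from the smallest `n` for which the stabilizer of some point of `X(n)` fixes
  -- `x`; minimality is what makes the fibre finite.
  let P : ℕ → Prop := fun n => ∃ φ : surjSet 𝔛 (Fin n), ∀ g : HomeoGroup 𝔛, g • φ = φ → g • x = x
  have of_fin : ∀ {A : Type u} [Finite A] (φ : LocallyConstant 𝔛 A),
      (∀ g : HomeoGroup 𝔛, g • φ = φ → g • x = x) → ∃ n ≤ Nat.card A, P n := by
    intro A _ φ hφ
    let e := Finite.equivFin (Set.range φ)
    let φ' : LocallyConstant 𝔛 (Set.range φ) := ⟨fun y => ⟨φ y, y, rfl⟩, by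
      refine (IsLocallyConstant.iff_exists_open _).2 fun y => ?_
      obtain ⟨U, hU, hy, h⟩ := (IsLocallyConstant.iff_exists_open _).1 φ.isLocallyConstant y
      exact ⟨U, hU, hy, fun z hz => Subtype.ext (h z hz)⟩⟩
    refine ⟨Nat.card (Set.range φ), Finite.card_subtype_le _, ofLC (φ'.map e) ?_, fun g hg => ?_⟩
    · refine e.surjective.comp ?_
      rintro ⟨_, y, rfl⟩
      exact ⟨y, rfl⟩
    · refine hφ g (smul_eq_iff.2 fun y => ?_)
      have := smul_eq_iff.1 (congrArg toLC hg) y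
      exact congrArg Subtype.val (e.injective this)
  have hP : ∃ n, P n := by
    obtain ⟨S, hS⟩ := exists_setStab_le (X.smooth x)
    obtain ⟨n, -, hn⟩ := of_fin (member S) fun g hg => hS (mem_setStab_of_smul hg)
    exact ⟨n, hn⟩
  obtain ⟨φ, hφ⟩ := Nat.find_spec hP
  obtain ⟨p, hp⟩ := FinGSet.exists_map surjSet_pretransitive φ x hφ
  refine ⟨Nat.find hP, p, ?_, ⟨⟨φ, hp⟩⟩⟩
  -- If a point `ψ` of the fibre were not a function of `φ`, then by `map_eq_of_merge` the
  -- stabilizer of `ψ` with two of its values merged would fix `x`, contradicting the minimality of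
  -- `n`.
  have key : ∀ ψ : surjSet 𝔛 (Fin (Nat.find hP)), p ψ = x → ∀ x₁ x₂, toLC φ x₁ = toLC φ x₂ →
      toLC ψ x₁ = toLC ψ x₂ := by
    intro ψ hψ x₁ x₂ h
    by_contra hne
    let m : Fin (Nat.find hP) → {a : Fin (Nat.find hP) // a ≠ toLC ψ x₂} := fun a =>
      if ha : a = toLC ψ x₂ then ⟨toLC ψ x₁, hne⟩ else ⟨a, ha⟩
    have hm' : ∀ a b, m a = m b → a = b ∨ (a = toLC ψ x₁ ∧ b = toLC ψ x₂) ∨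
      (a = toLC ψ x₂ ∧ b = toLC ψ x₁) := by
      intro a b hab
      simp only [m] at hab
      split_ifs at hab with ha hb hb
      · exact Or.inl (ha.trans hb.symm)
      · exact Or.inr (Or.inr ⟨ha, (congrArg Subtype.val hab).symm⟩)
      · exact Or.inr (Or.inl ⟨congrArg Subtype.val hab, hb⟩)
      · exact Or.inl (congrArg Subtype.val hab)
    let m' : Fin (Nat.find hP) → ULift.{u} {a : Fin (Nat.find hP) // a ≠ toLC ψ x₂} :=
      fun a => ⟨m a⟩
    obtain ⟨n, hn, hPn⟩ := of_fin ((toLC ψ).map m') fun g hg => by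
      rw [← hψ, ← map_smul]
      refine map_eq_of_merge p (hp.trans hψ.symm) h hne m hm' fun y => ?_
      exact congrArg ULift.down (smul_eq_iff.1 hg y)
    refine Nat.find_min hP (lt_of_le_of_lt hn ?_) hPn
    rw [Nat.card_eq_fintype_card, Fintype.card_ulift, Fintype.card_subtype_compl,
      Fintype.card_fin, Fintype.card_unique]
    have := (toLC ψ x₂).pos
    omega
  -- A point of the fibre is therefore determined by a self-map of the set of `n` values.
  choose s hs using toLC_surjective φ
  refine Finite.of_injective (β := Fin (Nat.find hP) → Fin (Nat.find hP))
    (fun ψ a => toLC ψ.1 (s a)) fun ψ ψ' h => ?_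
  refine Subtype.ext (toLC_injective (LocallyConstant.ext fun y => ?_))
  have h₁ := key ψ.1 ψ.2 y (s (toLC φ y)) (hs _).symm
  have h₂ := key ψ'.1 ψ'.2 y (s (toLC φ y)) (hs _).symm
  rw [h₁, h₂]
  exact congrFun h (toLC φ y)

end HomeoGroup

/-! ### Sums of powers of `-2` over finite sets -/

namespace Finset

/-- A function on finite sets is determined by its sums over power sets. -/
theorem eq_of_sum_powerset_eq {A M : Type*} [DecidableEq A] [AddCommGroup M] {f g : Finset A → M}
    (h : ∀ U : Finset A, ∑ T ∈ U.powerset, f T = ∑ T ∈ U.powerset, g T) (U : Finset A) :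
    f U = g U := by
  induction U using Finset.strongInduction with
  | H U ih =>
    have hU := h U
    rw [← Finset.sum_erase_add _ _ (Finset.mem_powerset_self U),
      ← Finset.sum_erase_add _ g (Finset.mem_powerset_self U)] at hU
    rw [Finset.sum_congr rfl fun T hT => ih T ?_] at hU
    · exact add_left_cancel hU
    · rw [Finset.mem_erase, Finset.mem_powerset] at hT
      exact Finset.ssubset_iff_subset_ne.2 ⟨hT.2, hT.1⟩

/-- The binomial theorem for `(-2 + 1) ^ #U`. Only the parity of `#U` matters, and this is how the
field with two elements enters. -/
theorem sum_powerset_neg_two_pow {A : Type*} (U : Finset A) :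
    ∑ T ∈ U.powerset, (-2 : ℚ) ^ #T = (-1) ^ #U := by
  have h := Finset.sum_pow_mul_eq_add_pow (-2 : ℚ) 1 U
  norm_num at h
  exact h

/-- Brings sums over the sets `T` with prescribed `r T` into the form that `eq_of_sum_powerset_eq`
compares. -/
theorem sum_powerset_fiberwise {A C M : Type*} [AddCommMonoid M] [DecidableEq C]
    (s : Finset A) (r : A → Finset C) (w : A → M) (V : Finset C) :
    ∑ S ∈ V.powerset, ∑ T ∈ s with r T = S, w T = ∑ T ∈ s with r T ⊆ V, w T := by
  rw [← Finset.sum_fiberwise_of_maps_to (t := V.powerset) (g := r) fun T hT => by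
    rw [Finset.mem_powerset]
    exact (Finset.mem_filter.1 hT).2]
  refine Finset.sum_congr rfl fun S hS => Finset.sum_congr ?_ fun _ _ => rfl
  ext T
  simp only [Finset.mem_filter]
  constructor
  · rintro ⟨h, rfl⟩
    exact ⟨⟨h, Finset.mem_powerset.1 hS⟩, rfl⟩
  · rintro ⟨⟨h, -⟩, h'⟩
    exact ⟨h, h'⟩

/-- The sum of `(-2)^|T|` over the subsets `T` with image `S` is `(-2)^|S|` if the fibres over the
points of `S` are odd, and zero otherwise. -/
theorem sum_neg_two_pow_image {A C : Type*} [DecidableEq C] (f : A → C) (U : Finset A)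
    (S : Finset C) [DecidableEq (Finset C)] :
    ∑ T ∈ U.powerset with T.image f = S, (-2 : ℚ) ^ #T =
      if ∀ c ∈ S, Odd #{a ∈ U | f a = c} then (-2) ^ #S else 0 := by
  classical
  -- Both sides are summed over the subsets `S` of `V`. The left becomes `-1` to the number of
  -- points of `U` above `V`, the right `-1` to the number of points of `V` with odd fibre, and
  -- these numbers have the same parity.
  refine eq_of_sum_powerset_eq (f := fun S => ∑ T ∈ U.powerset with T.image f = S, (-2 : ℚ) ^ #T)
    (g := fun S => if ∀ c ∈ S, Odd #{a ∈ U | f a = c} then (-2) ^ #S else 0) (fun V => ?_) S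
  have h₁ : {T ∈ U.powerset | T.image f ⊆ V} = {a ∈ U | f a ∈ V}.powerset := by
    ext T
    rw [Finset.mem_filter, Finset.image_subset_iff, Finset.mem_powerset, Finset.mem_powerset]
    simp only [Finset.subset_iff, Finset.mem_filter]
    exact ⟨fun h a ha => ⟨h.1 ha, h.2 a ha⟩, fun h => ⟨fun a ha => (h ha).1, fun a ha => (h ha).2⟩⟩
  have h₂ : {S ∈ V.powerset | ∀ c ∈ S, Odd #{a ∈ U | f a = c}} =
      {c ∈ V | Odd #{a ∈ U | f a = c}}.powerset := by
    ext T
    simp only [Finset.mem_filter, Finset.mem_powerset, Finset.subset_iff]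
    exact ⟨fun h a ha => ⟨h.1 ha, h.2 a ha⟩, fun h => ⟨fun a ha => (h ha).1, fun a ha => (h ha).2⟩⟩
  have h₃ : ∑ S ∈ V.powerset, ∑ T ∈ U.powerset with T.image f = S, (-2 : ℚ) ^ #T =
      ∑ T ∈ U.powerset with T.image f ⊆ V, (-2 : ℚ) ^ #T := by
    convert sum_powerset_fiberwise U.powerset (fun T => T.image f) (fun T => (-2 : ℚ) ^ #T) V
  refine h₃.trans ?_
  rw [← Finset.sum_filter, h₁, h₂, sum_powerset_neg_two_pow, sum_powerset_neg_two_pow,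
    Finset.card_eq_sum_card_fiberwise (s := {a ∈ U | f a ∈ V}) (f := f) (t := V)
      fun a ha => (Finset.mem_filter.1 ha).2]
  have h₄ : ∀ c ∈ V, #{a ∈ {a ∈ U | f a ∈ V} | f a = c} = #{a ∈ U | f a = c} := by
    intro c hc
    congr 1
    ext a
    simp only [Finset.mem_filter]
    exact ⟨fun h => ⟨h.1.1, h.2⟩, fun h => ⟨⟨h.1, h.2 ▸ hc⟩, h.2⟩⟩
  rw [Finset.sum_congr rfl h₄]
  have h₅ := Finset.odd_sum_iff_odd_card_odd (s := V) fun c => #{a ∈ U | f a = c}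
  by_cases h : Odd (∑ c ∈ V, #{a ∈ U | f a = c})
  · rw [h.neg_one_pow, (h₅.1 h).neg_one_pow]
  · rw [(Nat.not_odd_iff_even.1 h).neg_one_pow,
      (Nat.not_odd_iff_even.1 (mt h₅.2 h)).neg_one_pow]

/-- The sum of `(-2)^|R|` over the relations `R` contained in a fibre product which project onto
both factors. -/
theorem sum_neg_two_pow_fiberProd {A B C : Type*} [Fintype A] [Fintype B] [Fintype C]
    [DecidableEq A] [DecidableEq B] [DecidableEq C] (f : A → C) (g : B → C)
    (hf : Function.Surjective f) (hg : Function.Surjective g) :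
    ∑ R : Finset (A × B) with (∀ p ∈ R, f p.1 = g p.2) ∧ R.image Prod.fst = univ ∧
      R.image Prod.snd = univ, (-2 : ℚ) ^ #R =
    (-2) ^ Fintype.card A * (-2) ^ Fintype.card B / (-2) ^ Fintype.card C := by
  let Q : Finset (A × B) := {p | f p.1 = g p.2}
  let s : Finset (Finset (A × B)) := {R ∈ Q.powerset | R.image Prod.snd = univ}
  -- The first projection is first allowed to have any image `T`, and then `T` is summed over the
  -- subsets of `U`. On the left, `sum_neg_two_pow_image` for the second projection gives `(-2)^|B|`
  -- if all sets `{a ∈ U | f a = g b}` are odd. On the right, the same lemma for `f` gives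
  -- `(-2)^|C|` if all sets `{a ∈ U | f a = c}` are odd. The conditions agree since `g` is
  -- surjective, and `T = univ` is the claim.
  have key := eq_of_sum_powerset_eq
    (f := fun T => ∑ R ∈ s with R.image Prod.fst = T, (-2 : ℚ) ^ #R)
    (g := fun T => (-2) ^ Fintype.card B / (-2) ^ Fintype.card C *
      if T.image f = univ then (-2 : ℚ) ^ #T else 0) (fun U => ?_) univ
  · rw [if_pos (Finset.image_univ_of_surjective hf), Finset.card_univ] at key
    refine (Finset.sum_congr ?_ fun _ _ => rfl).trans (key.trans (by ring))
    ext R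
    simp only [s, Q, Finset.mem_filter, Finset.mem_powerset, Finset.mem_univ, true_and,
      Finset.subset_iff]
    tauto
  · rw [sum_powerset_fiberwise, ← Finset.mul_sum, ← Finset.sum_filter, sum_neg_two_pow_image]
    have h₁ : {R ∈ s | R.image Prod.fst ⊆ U} =
        {R ∈ {p ∈ Q | p.1 ∈ U}.powerset | R.image Prod.snd = univ} := by
      ext R
      rw [Finset.mem_filter, Finset.mem_filter, Finset.mem_filter, Finset.image_subset_iff,
        Finset.mem_powerset, Finset.mem_powerset]
      simp only [Finset.subset_iff, Finset.mem_filter]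
      constructor
      · rintro ⟨⟨h, h'⟩, h''⟩
        exact ⟨fun p hp => ⟨h hp, h'' p hp⟩, h'⟩
      · rintro ⟨h, h'⟩
        exact ⟨⟨fun p hp => (h hp).1, h'⟩, fun p hp => (h hp).2⟩
    rw [h₁, sum_neg_two_pow_image]
    have h₂ : ∀ b, #{p ∈ {p ∈ Q | p.1 ∈ U} | p.2 = b} = #{a ∈ U | f a = g b} := by
      intro b
      refine Finset.card_bij' (fun p _ => p.1) (fun a _ => (a, b)) ?_ ?_ ?_ ?_
      · rintro p hp
        simp only [Q, Finset.mem_filter, Finset.mem_univ, true_and] at hp ⊢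
        exact ⟨hp.1.2, hp.2 ▸ hp.1.1⟩
      · rintro a ha
        simp only [Q, Finset.mem_filter, Finset.mem_univ, true_and] at ha ⊢
        exact ⟨⟨ha.2, ha.1⟩, trivial⟩
      · rintro p hp
        simp only [Finset.mem_filter] at hp
        exact Prod.ext rfl hp.2.symm
      · exact fun _ _ => rfl
    have h₃ : (∀ b ∈ (univ : Finset B), Odd #{p ∈ {p ∈ Q | p.1 ∈ U} | p.2 = b}) ↔
        ∀ c ∈ (univ : Finset C), Odd #{a ∈ U | f a = c} := by
      simp only [h₂, Finset.mem_univ, true_imp_iff]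
      exact (hg.forall (p := fun c => Odd #{a ∈ U | f a = c})).symm
    by_cases h : ∀ c ∈ (univ : Finset C), Odd #{a ∈ U | f a = c}
    · rw [if_pos (h₃.2 h), if_pos h, Finset.card_univ, Finset.card_univ, div_mul_cancel₀]
      exact pow_ne_zero _ (by norm_num)
    · rw [if_neg (mt h₃.1 h), if_neg h, mul_zero]

end Finset

/-! ### Orbits, fibres and fibre products of `G`-sets -/

namespace FinGSet

section

variable {G : Type u} [Group G] [TopologicalSpace G]

theorem orbMap_injective {X Y : FinGSet G} (f : X →[G] Y) (hf : Function.Injective f) :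
    Function.Injective (orbMap f) := by
  intro A B h
  obtain ⟨x, rfl⟩ := cls_surj A
  obtain ⟨y, rfl⟩ := cls_surj B
  obtain ⟨g, hg⟩ := cls_eq.1 h
  exact cls_eq.2 ⟨g, hf ((map_smul f g y).trans hg)⟩

theorem orbMap_surjective {X Y : FinGSet G} (f : X →[G] Y) (hf : Function.Surjective f) :
    Function.Surjective (orbMap f) := by
  intro B
  obtain ⟨y, rfl⟩ := cls_surj B
  obtain ⟨x, rfl⟩ := hf y
  exact ⟨cls x, rfl⟩

theorem exists_cls_eq_of_orbMap {X Y : FinGSet G} (f : X →[G] Y) {O : X.Orb} {y : Y}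
    (h : orbMap f O = cls y) : ∃ x, f x = y ∧ cls x = O := by
  obtain ⟨x, rfl⟩ := cls_surj O
  obtain ⟨g, hg⟩ := cls_eq.1 h.symm
  exact ⟨g • x, (map_smul f g x).trans hg, cls_smul g x⟩

/-- The equivalence between the fibres of a map over points of the same orbit. -/
theorem card_fiber_smul {X Y : FinGSet G} (f : X →[G] Y) (g : G) (y : Y) :
    Nat.card {x // f x = g • y} = Nat.card {x // f x = y} := by
  refine Nat.card_congr
    { toFun := fun x => ⟨g⁻¹ • x.1, by rw [map_smul, x.2, inv_smul_smul]⟩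
      invFun := fun x => ⟨g • x.1, by rw [map_smul, x.2]⟩
      left_inv := fun x => Subtype.ext (smul_inv_smul g x.1)
      right_inv := fun x => Subtype.ext (inv_smul_smul g x.1) }

variable [RoelckePrecompact G]

/-- The fibre product of two maps of `G`-sets. -/
def pullback {X Y Z : FinGSet G} (f : X →[G] Z) (g : Y →[G] Z) : FinGSet G :=
  (X.prod Y).filter (fun p => f (fst p) = g (snd p)) fun a p h => by
    rw [map_smul, map_smul, map_smul, map_smul, h]

namespace pullback

variable {X Y Z : FinGSet G} {f : X →[G] Z} {g : Y →[G] Z}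

/-- The point of a fibre product with given components. -/
def mk (x : X) (y : Y) (h : f x = g y) : pullback f g := ⟨pr x y, h⟩

variable (f g) in
/-- The first projection of a fibre product. -/
def fst : pullback f g →[G] X := ⟨fun p => FinGSet.fst p.1, fun _ _ => rfl⟩

variable (f g) in
/-- The second projection of a fibre product. -/
def snd : pullback f g →[G] Y := ⟨fun p => FinGSet.snd p.1, fun _ _ => rfl⟩

theorem condition (p : pullback f g) : f (fst f g p) = g (snd f g p) := p.2

theorem ext {p q : pullback f g} (h₁ : fst f g p = fst f g q) (h₂ : snd f g p = snd f g q) :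
    p = q :=
  Subtype.ext (prod_ext h₁ h₂)

/-- The map to a fibre product with given components. -/
def lift {T : FinGSet G} (a : T →[G] X) (b : T →[G] Y) (h : ∀ t, f (a t) = g (b t)) :
    T →[G] pullback f g :=
  ⟨fun t => mk (a t) (b t) (h t), fun c t => ext (map_smul a c t) (map_smul b c t)⟩

end pullback

end

end FinGSet

/-! ### The weight of a point -/

namespace HomeoGroup

open FinGSet

section

variable {𝔛 : Type u} [TopologicalSpace 𝔛] [IsCantorSpace 𝔛] {A B : Type} [Finite A] [Finite B]

local notation "𝔾" => HomeoGroup 𝔛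

/-- By `eq_of_finite_fiber`, a point `ψ` of the finite fibre is `h ∘ φ` for a point `φ` of the other
one. Translating `φ` and `ψ` by the same group element shows that this `h` serves all points of the
fibre of `p`. In particular `B` is not larger than `A`. -/
theorem card_le_of_finite_fiber {X : FinGSet 𝔾} {x : X} (p : surjSet 𝔛 A →[𝔾] X)
    (q : surjSet 𝔛 B →[𝔾] X) (hp : Nonempty {φ // p φ = x}) (hq : Finite {ψ // q ψ = x})
    (hq' : Nonempty {ψ // q ψ = x}) :
    ∃ h : A → B, Function.Surjective h ∧ ∀ φ, p φ = x → ∃ ψ, q ψ = x ∧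
      ∀ y, toLC ψ y = h (toLC φ y) := by
  obtain ⟨φ, hφ⟩ := hp
  obtain ⟨ψ, hψ⟩ := hq'
  have key : ∀ y z, toLC φ y = toLC φ z → toLC ψ y = toLC ψ z := fun y z h =>
    eq_of_finite_fiber (fun g hg => by rw [← hφ, ← map_smul, hg]) q hq hψ h
  choose s hs using toLC_surjective φ
  have hh : ∀ y, toLC ψ y = toLC ψ (s (toLC φ y)) := fun y => key _ _ (hs _).symm
  refine ⟨fun a => toLC ψ (s a), fun b => ?_, fun φ' hφ' => ?_⟩
  · obtain ⟨y, rfl⟩ := toLC_surjective ψ b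
    exact ⟨toLC φ y, (hh y).symm⟩
  · obtain ⟨g, rfl⟩ := surjSet_pretransitive.exists_smul_eq φ φ'
    refine ⟨g • ψ, ?_, fun y => hh _⟩
    rw [map_smul, hψ, ← hφ, ← map_smul, hφ', hφ]

/-- The size of a set `A` such that `x` has a finite fibre in `X(A)`, and the size of the fibre, are
determined by `x`. -/
theorem cover_unique {X : FinGSet 𝔾} {x : X} (p : surjSet 𝔛 A →[𝔾] X)
    (q : surjSet 𝔛 B →[𝔾] X) (hp : Nat.card {φ // p φ = x} ≠ 0) (hq : Nat.card {ψ // q ψ = x} ≠ 0) :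
    Nat.card A = Nat.card B ∧ Nat.card {φ // p φ = x} = Nat.card {ψ // q ψ = x} := by
  have key : ∀ {A B : Type} [Finite A] [Finite B] (p : surjSet 𝔛 A →[𝔾] X)
      (q : surjSet 𝔛 B →[𝔾] X), Nat.card {φ // p φ = x} ≠ 0 → Nat.card {ψ // q ψ = x} ≠ 0 →
      Nat.card B ≤ Nat.card A ∧ (Nat.card A ≤ Nat.card B →
        Nat.card {φ // p φ = x} ≤ Nat.card {ψ // q ψ = x}) := by
    intro A B _ _ p q hp hq
    have hp' := Nat.card_ne_zero.1 hp
    have hq' := Nat.card_ne_zero.1 hq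
    obtain ⟨h, hs, hh⟩ := card_le_of_finite_fiber p q hp'.1 hq'.2 hq'.1
    refine ⟨Nat.card_le_card_of_surjective h hs, fun hAB => ?_⟩
    -- When the sizes agree, `h` is bijective, and `φ ↦ h ∘ φ` embeds one fibre in the other.
    have hi : Function.Injective h :=
      (hs.bijective_of_nat_card_le hAB).1
    choose ψ hψ hψ' using hh
    have := hq'.2
    refine Nat.card_le_card_of_injective (fun φ => (⟨ψ φ.1 φ.2, hψ φ.1 φ.2⟩ : {ψ // q ψ = x}))
      fun φ φ' e => ?_
    refine Subtype.ext (toLC_injective (LocallyConstant.ext fun y => hi ?_))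
    rw [← hψ' φ.1 φ.2, ← hψ' φ'.1 φ'.2]
    exact congrArg (fun ψ : {ψ // q ψ = x} => toLC ψ.1 y) e
  have h₁ := key p q hp hq
  have h₂ := key q p hq hp
  exact ⟨le_antisymm h₂.1 h₁.1, le_antisymm (h₁.2 h₂.1) (h₂.2 h₁.1)⟩

/-- The weight of a point of a `G`-set: `(-2)ⁿ` divided by the size of the fibre over the point of a
map from `X(n)` for which this fibre is finite. -/
noncomputable def weight {X : FinGSet 𝔾} (x : X) : ℚ :=
  (-2) ^ (exists_cover X x).choose / Nat.card {φ // (exists_cover X x).choose_spec.choose φ = x}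

theorem weight_eq {X : FinGSet 𝔾} {x : X} (p : surjSet 𝔛 A →[𝔾] X)
    (hp : Nat.card {φ // p φ = x} ≠ 0) :
    weight x = (-2) ^ Nat.card A / Nat.card {φ // p φ = x} := by
  have h := cover_unique p (exists_cover X x).choose_spec.choose hp
    (Nat.card_ne_zero.2 (exists_cover X x).choose_spec.choose_spec.symm)
  rw [weight, h.2, h.1, Nat.card_fin]

/-- The weight can be computed with some map from `X(n)`. -/
theorem exists_weight_eq {X : FinGSet 𝔾} (x : X) :
    ∃ (n : ℕ) (p : surjSet 𝔛 (Fin n) →[𝔾] X), Nat.card {φ // p φ = x} ≠ 0 ∧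
      weight x = (-2) ^ n / Nat.card {φ // p φ = x} := by
  obtain ⟨n, p, h₁, h₂⟩ := exists_cover X x
  have h := Nat.card_ne_zero.2 ⟨h₂, h₁⟩
  exact ⟨n, p, h, by rw [weight_eq p h, Nat.card_fin]⟩

theorem weight_ne_zero {X : FinGSet 𝔾} (x : X) : weight x ≠ 0 := by
  obtain ⟨n, p, h, e⟩ := exists_weight_eq x
  rw [e]
  exact div_ne_zero (pow_ne_zero _ (by norm_num)) (Nat.cast_ne_zero.2 h)

theorem weight_map {X Y : FinGSet 𝔾} (i : X →[𝔾] Y) (hi : Function.Injective i) (x : X) :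
    weight (i x) = weight x := by
  obtain ⟨n, p, h, e⟩ := exists_weight_eq x
  have hc : Nat.card {φ // (i.comp p) φ = i x} = Nat.card {φ // p φ = x} :=
    Nat.card_congr (Equiv.subtypeEquivRight fun φ => hi.eq_iff)
  rw [e, weight_eq (i.comp p) (by rwa [hc]), hc, Nat.card_fin]

theorem weight_smul {X : FinGSet 𝔾} (g : 𝔾) (x : X) : weight (g • x) = weight x := by
  obtain ⟨n, p, h, e⟩ := exists_weight_eq x
  have hc := card_fiber_smul p g x
  rw [e, weight_eq p (by rwa [hc]), hc, Nat.card_fin]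

/-- The weight of an orbit. -/
noncomputable def orbWeight {X : FinGSet 𝔾} : X.Orb → ℚ :=
  Quotient.lift weight fun x y h => by
    obtain ⟨g, rfl⟩ := cls_eq.1 (Quotient.sound h)
    exact weight_smul g y

theorem orbWeight_cls {X : FinGSet 𝔾} (x : X) : orbWeight (cls x) = weight x := rfl

theorem orbWeight_orbMap {X Y : FinGSet 𝔾} (i : X →[𝔾] Y) (hi : Function.Injective i) (O : X.Orb) :
    orbWeight (orbMap i O) = orbWeight O := by
  obtain ⟨x, rfl⟩ := cls_surj O
  exact weight_map i hi x

/-- The weight of a locally constant map with `n` values is `(-2)ⁿ`. -/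
theorem weight_locallyConstant (φ : LocallyConstant 𝔛 A) :
    weight (X := mapSet 𝔛 A) φ = (-2) ^ Nat.card (Set.range φ) := by
  let i : surjSet 𝔛 (Set.range φ) →[𝔾] mapSet 𝔛 A :=
    ⟨fun ψ => (toLC ψ).map Subtype.val, fun _ _ => rfl⟩
  have hi : Function.Injective i := fun ψ ψ' h => toLC_injective (LocallyConstant.ext fun x =>
    Subtype.ext (congrArg (fun φ : LocallyConstant 𝔛 A => φ x) h))
  have hφ : IsLocallyConstant fun y => (⟨φ y, y, rfl⟩ : Set.range φ) := by
    refine (IsLocallyConstant.iff_exists_open _).2 fun y => ?_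
    obtain ⟨U, hU, hy, h⟩ := (IsLocallyConstant.iff_exists_open _).1 φ.isLocallyConstant y
    exact ⟨U, hU, hy, fun z hz => Subtype.ext (h z hz)⟩
  have hc : Nat.card {ψ // i ψ = φ} = 1 := by
    refine Nat.card_eq_one_iff_unique.2 ⟨⟨fun a b => Subtype.ext (hi (a.2.trans b.2.symm))⟩,
      ⟨⟨ofLC ⟨_, hφ⟩ ?_, rfl⟩⟩⟩
    rintro ⟨_, y, rfl⟩
    exact ⟨y, rfl⟩
  refine (weight_eq i (by rw [hc]; exact one_ne_zero)).trans ?_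
  rw [hc, Nat.cast_one, div_one]

/-- The weight of a point is the weight of its image times the number of points of its orbit with
the same image. -/
theorem weight_eq_card_mul {P W : FinGSet 𝔾} (f : P →[𝔾] W) (x : P)
    (hf : Finite {v // f v = f x}) :
    weight x = Nat.card {v : {v // f v = f x} // cls v.1 = cls x} * weight (f x) := by
  obtain ⟨n, p, h, e⟩ := exists_weight_eq x
  have hp := Nat.card_ne_zero.1 h
  obtain ⟨φ₀, hφ₀⟩ := hp.1
  -- The fibre of `f ∘ p` over `f x` will compute the weight of `f x`. It is the union of the fibres
  -- of `p` over those points of the orbit of `x` that lie above `f x`, and these fibres all have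
  -- the same size.
  let E : {φ // (f.comp p) φ = f x} ≃
      Σ v : {v : {v // f v = f x} // cls v.1 = cls x}, {φ // p φ = v.1.1} :=
    { toFun := fun φ => ⟨⟨⟨p φ.1, φ.2⟩, by
        obtain ⟨g, hg⟩ := surjSet_pretransitive.exists_smul_eq φ₀ φ.1
        change cls (p φ.1) = cls x
        rw [← hg, map_smul, cls_smul, hφ₀]⟩, φ.1, rfl⟩
      invFun := fun s => ⟨s.2.1, (congrArg f s.2.2).trans s.1.1.2⟩
      left_inv := fun _ => rfl
      right_inv := by
        rintro ⟨⟨⟨v, hv⟩, hv'⟩, φ, hφ⟩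
        change p φ = v at hφ
        subst hφ
        rfl }
  have hfib : ∀ v : {v : {v // f v = f x} // cls v.1 = cls x},
      Nat.card {φ // p φ = v.1.1} = Nat.card {φ // p φ = x} := by
    intro v
    obtain ⟨g, hg⟩ := cls_eq.1 v.2
    rw [← hg, card_fiber_smul]
  have hfin : ∀ v : {v : {v // f v = f x} // cls v.1 = cls x}, Finite {φ // p φ = v.1.1} :=
    fun v => (Nat.card_ne_zero.1 ((hfib v).trans_ne h)).2
  have := Fintype.ofFinite {v : {v // f v = f x} // cls v.1 = cls x}
  have hc : Nat.card {φ // (f.comp p) φ = f x} =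
      Nat.card {v : {v // f v = f x} // cls v.1 = cls x} * Nat.card {φ // p φ = x} := by
    rw [Nat.card_congr E, Nat.card_sigma, Finset.sum_congr rfl fun v _ => hfib v,
      Finset.sum_const, Finset.card_univ, smul_eq_mul,
      Nat.card_eq_fintype_card (α := {v : {v // f v = f x} // cls v.1 = cls x})]
  have hc₀ : Nat.card {v : {v // f v = f x} // cls v.1 = cls x} ≠ 0 :=
    Nat.card_ne_zero.2 ⟨⟨⟨x, rfl⟩, rfl⟩, inferInstance⟩
  rw [e, weight_eq (f.comp p) (by rw [hc]; exact mul_ne_zero hc₀ h), hc, Nat.card_fin, Nat.cast_mul]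
  have h₁ : (Nat.card {v : {v // f v = f x} // cls v.1 = cls x} : ℚ) ≠ 0 := Nat.cast_ne_zero.2 hc₀
  have h₂ : (Nat.card {φ // p φ = x} : ℚ) ≠ 0 := Nat.cast_ne_zero.2 h
  field_simp

open scoped Classical in
/-- The total weight of the orbits over the orbit of `w` is the size of the fibre over `w` times the
weight of `w`. -/
theorem sum_orbWeight_over {P W : FinGSet 𝔾} (f : P →[𝔾] W) (w : W) (hf : Finite {v // f v = w}) :
    ∑ Q : P.Orb with orbMap f Q = cls w, orbWeight Q = Nat.card {v // f v = w} * weight w := by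
  have := Fintype.ofFinite {v // f v = w}
  have h : ∀ Q : P.Orb, Q ∈ Finset.univ.filter (fun Q : P.Orb => orbMap f Q = cls w) →
      orbWeight Q = Nat.card {v : {v // f v = w} // cls v.1 = Q} * weight w := by
    intro Q hQ
    obtain ⟨x, rfl, rfl⟩ := exists_cls_eq_of_orbMap f (Finset.mem_filter.1 hQ).2
    exact weight_eq_card_mul f x hf
  rw [Finset.sum_congr rfl h, ← Finset.sum_mul, ← Nat.cast_sum]
  congr 2
  rw [Nat.card_congr (Equiv.sigmaFiberEquiv fun v : {v // f v = w} => cls v.1).symm, Nat.card_sigma]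
  refine Finset.sum_subset (Finset.filter_subset _ _) fun Q _ hQ => ?_
  rw [Nat.card_eq_zero]
  refine Or.inl ⟨fun v => hQ (Finset.mem_filter.2 ⟨Finset.mem_univ _, ?_⟩)⟩
  rw [← v.2, orbMap_cls, v.1.2]

/-- The total weight of a `G`-set. -/
noncomputable def total (X : FinGSet 𝔾) : ℚ := ∑ O : X.Orb, orbWeight O

theorem total_of_transitive {X : FinGSet 𝔾} (hX : X.IsTransitive) (x : X) : total X = weight x := by
  have h : ∀ O : X.Orb, O = cls x := fun O => by
    obtain ⟨y, rfl⟩ := cls_surj O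
    obtain ⟨g, hg⟩ := hX.2.exists_smul_eq x y
    exact cls_eq.2 ⟨g, hg⟩
  have : Unique X.Orb := ⟨⟨cls x⟩, h⟩
  rw [total, Fintype.sum_unique, h default, orbWeight_cls]

theorem total_eq_of_bijective {X Y : FinGSet 𝔾} (f : X →[𝔾] Y) (hf : Function.Bijective f) :
    total X = total Y :=
  Fintype.sum_bijective (orbMap f) ⟨orbMap_injective f hf.1, orbMap_surjective f hf.2⟩ _ _
    fun O => (orbWeight_orbMap f hf.1 O).symm

theorem total_add {X X₁ X₂ : FinGSet 𝔾} (i₁ : X₁ →[𝔾] X) (i₂ : X₂ →[𝔾] X)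
    (h₁ : Function.Injective i₁) (h₂ : Function.Injective i₂)
    (h : IsCompl (Set.range i₁) (Set.range i₂)) : total X = total X₁ + total X₂ := by
  rw [total, total, total, ← Fintype.sum_sumElim]
  refine (Fintype.sum_bijective (Sum.elim (orbMap i₁) (orbMap i₂)) ⟨?_, fun O => ?_⟩ _ _ ?_).symm
  · refine (orbMap_injective i₁ h₁).sumElim (orbMap_injective i₂ h₂) fun O P e => ?_
    obtain ⟨y, rfl⟩ := cls_surj P
    obtain ⟨x, hx, -⟩ := exists_cls_eq_of_orbMap i₁ e
    exact Set.disjoint_left.1 h.disjoint ⟨x, hx⟩ ⟨y, rfl⟩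
  · obtain ⟨x, rfl⟩ := cls_surj O
    rcases (h.sup_eq_top.symm ▸ Set.mem_univ x : x ∈ Set.range i₁ ⊔ Set.range i₂) with
      ⟨y, rfl⟩ | ⟨y, rfl⟩
    · exact ⟨Sum.inl (cls y), rfl⟩
    · exact ⟨Sum.inr (cls y), rfl⟩
  · rintro (O | O)
    · exact (orbWeight_orbMap i₁ h₁ O).symm
    · exact (orbWeight_orbMap i₂ h₂ O).symm

/-- The finite set of values of a locally constant map to a finite set, for an orbit of `Y(D)`. -/
noncomputable def orbRange {D : Type} [Fintype D] : (mapSet 𝔛 D).Orb → Finset D :=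
  Quotient.lift (fun φ : LocallyConstant 𝔛 D => (Set.toFinite (Set.range φ)).toFinset)
    fun (φ ψ : LocallyConstant 𝔛 D) h => by
      obtain ⟨g, rfl⟩ := MulAction.orbitRel_apply.1 h
      exact Set.Finite.toFinset_inj.2 (range_smul g ψ)

theorem mem_orbRange {D : Type} [Fintype D] (φ : LocallyConstant 𝔛 D) (d : D) :
    d ∈ orbRange (𝔛 := 𝔛) (cls (X := mapSet 𝔛 D) φ) ↔ ∃ x, φ x = d := by
  exact Set.Finite.mem_toFinset _

/-- Maps with the same image are conjugate. With `orbRange_nonempty` and `exists_orbRange_eq` this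
identifies the orbits of `Y(D)` with the non-empty subsets of `D`. -/
theorem orbRange_injective {D : Type} [Fintype D] :
    Function.Injective (orbRange (𝔛 := 𝔛) (D := D)) := by
  intro O P h
  obtain ⟨φ, rfl⟩ := cls_surj O
  obtain ⟨ψ, rfl⟩ := cls_surj P
  obtain ⟨g, hg⟩ := exists_smul_eq (𝔛 := 𝔛) (A := D) ψ φ (by
    ext d
    exact ((mem_orbRange ψ d).symm.trans (by rw [h])).trans (mem_orbRange φ d))
  exact cls_eq.2 ⟨g, hg⟩

theorem orbWeight_eq {D : Type} [Fintype D] (O : (mapSet 𝔛 D).Orb) :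
    orbWeight O = (-2) ^ (orbRange O).card := by
  obtain ⟨φ, rfl⟩ := cls_surj O
  refine (weight_locallyConstant (𝔛 := 𝔛) (A := D) φ).trans ?_
  congr 1
  exact Nat.card_eq_card_finite_toFinset _

open scoped Classical in
/-- The total weight of a `G`-subset of `Y(D)`. -/
theorem total_of_injective {D : Type} [Fintype D] {L : FinGSet 𝔾} (j : L →[𝔾] mapSet 𝔛 D)
    (hj : Function.Injective j) : total L =
      ∑ S : Finset D with ∃ l : L, orbRange (cls (j l)) = S, (-2 : ℚ) ^ S.card := by
  have h : (Finset.univ.filter fun S : Finset D => ∃ l : L, orbRange (cls (j l)) = S) =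
      Finset.univ.image fun O : L.Orb => orbRange (orbMap j O) := by
    ext S
    simp only [Finset.mem_filter, Finset.mem_univ, true_and, Finset.mem_image]
    constructor
    · rintro ⟨l, rfl⟩
      exact ⟨cls l, rfl⟩
    · rintro ⟨O, rfl⟩
      obtain ⟨l, rfl⟩ := cls_surj O
      exact ⟨l, rfl⟩
  rw [h, Finset.sum_image fun O _ P _ e => orbMap_injective j hj (orbRange_injective e)]
  exact Finset.sum_congr rfl fun O _ => by rw [← orbWeight_orbMap j hj, orbWeight_eq]

end

end HomeoGroup

/-! ### Fibre products and the construction of the measure -/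

namespace HomeoGroup

open FinGSet

section

variable {𝔛 : Type u} [TopologicalSpace 𝔛] [IsCantorSpace 𝔛]

local notation "𝔾" => HomeoGroup 𝔛

variable (𝔛) in
/-- There is a continuous surjection from a Cantor space to every non-empty finite set. -/
theorem exists_surjective (D : Type) [Finite D] [Nonempty D] :
    ∃ φ : LocallyConstant 𝔛 D, Function.Surjective φ := by
  obtain ⟨e⟩ := IsCantorSpace.nonempty_homeomorph_nat 𝔛
  obtain ⟨ψ, -, -, h⟩ := IsCantorSpace.exists_locallyConstant_full (LocallyConstant.const 𝔛 ())
    (fun _ => (Set.univ : Set D)) (fun _ => Set.univ_nonempty) Set.finite_empty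
    (fun _ => Classical.arbitrary D) fun _ hx => hx.elim
  refine ⟨ψ, fun d => ?_⟩
  obtain ⟨y, -, hy⟩ := h (e.symm fun _ => true) d trivial
  exact ⟨y, hy⟩

/-- The map `(φ, ψ) ↦ (x ↦ (φ x, ψ x))`. -/
def pairLC {A B : Type*} (φ : LocallyConstant 𝔛 A) (ψ : LocallyConstant 𝔛 B) :
    LocallyConstant 𝔛 (A × B) :=
  ⟨fun x => (φ x, ψ x), φ.isLocallyConstant.prodMk ψ.isLocallyConstant⟩

section

variable {A B C : Type} [Fintype A] [Fintype B] [Fintype C]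

/-- The maps `h : A → C` through which `a : X(A) → Y` factors over `r : X(C) → Y`. -/
def factorSet {Y : FinGSet 𝔾} (a : surjSet 𝔛 A →[𝔾] Y) (r : surjSet 𝔛 C →[𝔾] Y) : Set (A → C) :=
  {h | ∃ φ χ, r χ = a φ ∧ ∀ x, toLC χ x = h (toLC φ x)}

/-- `X(A)` is a single orbit, so a factorization at one of its points can be carried to every other
point. -/
theorem exists_of_mem_factorSet {Y : FinGSet 𝔾} {a : surjSet 𝔛 A →[𝔾] Y}
    {r : surjSet 𝔛 C →[𝔾] Y} {h : A → C} (hh : h ∈ factorSet a r) (φ : surjSet 𝔛 A) :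
    ∃ χ, r χ = a φ ∧ ∀ x, toLC χ x = h (toLC φ x) := by
  obtain ⟨φ', χ, h₁, h₂⟩ := hh
  obtain ⟨g, rfl⟩ := surjSet_pretransitive.exists_smul_eq φ' φ
  exact ⟨g • χ, by rw [map_smul, map_smul, h₁], fun x => h₂ _⟩

theorem surjective_of_mem_factorSet {Y : FinGSet 𝔾} {a : surjSet 𝔛 A →[𝔾] Y}
    {r : surjSet 𝔛 C →[𝔾] Y} {h : A → C} (hh : h ∈ factorSet a r) : Function.Surjective h := by
  obtain ⟨φ, χ, -, h₂⟩ := hh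
  intro c
  obtain ⟨x, rfl⟩ := toLC_surjective χ c
  exact ⟨_, (h₂ x).symm⟩

theorem exists_mem_factorSet {Y : FinGSet 𝔾} (a : surjSet 𝔛 A →[𝔾] Y)
    (r : surjSet 𝔛 C →[𝔾] Y) (φ : surjSet 𝔛 A) (hr : Finite {χ // r χ = a φ}) (χ : surjSet 𝔛 C)
    (hχ : r χ = a φ) : ∃ h ∈ factorSet a r, ∀ x, toLC χ x = h (toLC φ x) := by
  choose s hs using toLC_surjective φ
  have key : ∀ x, toLC χ x = toLC χ (s (toLC φ x)) := fun x =>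
    eq_of_finite_fiber (fun g hg => by rw [← map_smul, hg]) r hr hχ (hs _).symm
  exact ⟨fun b => toLC χ (s b), ⟨φ, χ, hχ, key⟩, key⟩

/-- Composition with `φ` identifies the maps `h` with the points of the fibre of `r` over `a φ`.
Lifts, which depend on `φ`, are thereby replaced by maps of finite sets, which do not. -/
theorem card_factorSet {Y : FinGSet 𝔾} (a : surjSet 𝔛 A →[𝔾] Y)
    (r : surjSet 𝔛 C →[𝔾] Y) (φ : surjSet 𝔛 A) (hr : Finite {χ // r χ = a φ}) :
    Nat.card (factorSet a r) = Nat.card {χ // r χ = a φ} := by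
  choose χ hχ hχ' using fun h : factorSet a r => exists_of_mem_factorSet h.2 φ
  refine Nat.card_congr (Equiv.ofBijective (fun h => ⟨χ h, hχ h⟩) ⟨fun h h' e => ?_, fun c => ?_⟩)
  · refine Subtype.ext (funext fun b => ?_)
    obtain ⟨x, rfl⟩ := toLC_surjective φ b
    rw [← hχ', ← hχ']
    exact congrArg (fun c : {χ // r χ = a φ} => toLC c.1 x) e
  · obtain ⟨h, hh, h'⟩ := exists_mem_factorSet a r φ hr c.1 c.2
    refine ⟨⟨h, hh⟩, Subtype.ext (toLC_injective (LocallyConstant.ext fun x => ?_))⟩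
    exact (hχ' ⟨h, hh⟩ x).trans (h' x).symm

open scoped Classical in
/-- The total weight of a fibre product of `X(A)` and `X(B)` over a transitive `G`-set. -/
theorem total_pullback_surjSet {Y : FinGSet 𝔾} (hY : Y.IsTransitive) (a : surjSet 𝔛 A →[𝔾] Y)
    (b : surjSet 𝔛 B →[𝔾] Y) (φ₀ : surjSet 𝔛 A) (ψ₀ : surjSet 𝔛 B) (y : Y) :
    total (pullback a b) * weight y = (-2) ^ Nat.card A * (-2) ^ Nat.card B := by
  -- Let `c` be the size of the fibres of `r`. The proof evaluates in two ways the sum of `(-2)^|R|`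
  -- over triples `(h, k, R)`, where `a` and `b` factor through `h` and `k` over `r`, the two maps
  -- agree along `R`, and `R` projects onto `A` and `B`. There are `c ^ 2` pairs `(h, k)`, and each
  -- contributes the sum of `sum_neg_two_pow_fiberProd`. Each `R` coming from an orbit of the fibre
  -- product belongs to exactly `c` pairs, and no other `R` occurs.
  obtain ⟨n, r, hr, hy⟩ := exists_weight_eq y
  have hcard : ∀ y', Nat.card {χ // r χ = y'} = Nat.card {χ // r χ = y} := by
    intro y'
    obtain ⟨g, rfl⟩ := hY.2.exists_smul_eq y y'
    exact card_fiber_smul r g y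
  have hfin : ∀ y', Finite {χ // r χ = y'} := fun y' =>
    (Nat.card_ne_zero.1 ((hcard y').trans_ne hr)).2
  let j : pullback a b →[𝔾] mapSet 𝔛 (A × B) :=
    ⟨fun p => pairLC (toLC (pullback.fst a b p)) (toLC (pullback.snd a b p)), fun _ _ => rfl⟩
  have hj : Function.Injective j := fun p q h => pullback.ext
    (toLC_injective (LocallyConstant.ext fun x =>
      congrArg (fun φ : LocallyConstant 𝔛 (A × B) => (φ x).1) h))
    (toLC_injective (LocallyConstant.ext fun x =>
      congrArg (fun φ : LocallyConstant 𝔛 (A × B) => (φ x).2) h))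
  have hjr : ∀ p d, d ∈ orbRange (cls (j p)) ↔
      ∃ x, toLC (pullback.fst a b p) x = d.1 ∧ toLC (pullback.snd a b p) x = d.2 := fun p d =>
    (mem_orbRange _ d).trans (exists_congr fun x => Prod.ext_iff)
  let H : Finset ((A → Fin n) × (B → Fin n)) :=
    Finset.univ.filter fun h => h.1 ∈ factorSet a r ∧ h.2 ∈ factorSet b r
  let good : Finset (A × B) → (A → Fin n) × (B → Fin n) → Prop := fun R h =>
    (∀ p ∈ R, h.1 p.1 = h.2 p.2) ∧ R.image Prod.fst = Finset.univ ∧ R.image Prod.snd = Finset.univ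
  have hH : (H.card : ℚ) = Nat.card {χ // r χ = y} * Nat.card {χ // r χ = y} := by
    rw [← Nat.cast_mul]
    congr 1
    have e₁ : H = (Finset.univ.filter (· ∈ factorSet a r)) ×ˢ
        (Finset.univ.filter (· ∈ factorSet b r)) := by
      ext h
      simp [H]
    have e₂ := card_factorSet a r φ₀ (hfin _)
    have e₃ := card_factorSet b r ψ₀ (hfin _)
    rw [hcard, Nat.card_eq_fintype_card, Fintype.card_subtype] at e₂ e₃
    rw [e₁, Finset.card_product, e₂, e₃]
  have h₁ : ∑ h ∈ H, ∑ R : Finset (A × B) with good R h, (-2 : ℚ) ^ R.card =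
      H.card * ((-2) ^ Nat.card A * (-2) ^ Nat.card B / (-2) ^ n) := by
    rw [← nsmul_eq_mul, ← Finset.sum_const]
    refine Finset.sum_congr rfl fun h hh => ?_
    have hh' := (Finset.mem_filter.1 hh).2
    refine Eq.trans ?_ ((Finset.sum_neg_two_pow_fiberProd h.1 h.2
      (surjective_of_mem_factorSet hh'.1) (surjective_of_mem_factorSet hh'.2)).trans ?_)
    · exact Finset.sum_congr (by ext; simp [good]) fun _ _ => rfl
    · rw [Nat.card_eq_fintype_card, Nat.card_eq_fintype_card, Fintype.card_fin]
  have h₂ : ∀ R : Finset (A × B), ((H.filter fun h => good R h).card : ℚ) =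
      if ∃ p, orbRange (cls (j p)) = R then (Nat.card {χ // r χ = y} : ℚ) else 0 := by
    intro R
    split_ifs with hR
    · obtain ⟨p, rfl⟩ := hR
      have hab := pullback.condition p
      have hR := hjr p
      generalize orbRange (cls (j p)) = R at hR
      generalize pullback.fst a b p = φ at hab hR
      generalize pullback.snd a b p = ψ at hab hR
      rw [← hcard (a φ)]
      congr 1
      have hH' : ∀ h : {h // h ∈ H.filter fun h => good R h},
          (h.1.1 ∈ factorSet a r ∧ h.1.2 ∈ factorSet b r) ∧ good R h.1 := by
        intro h
        have := Finset.mem_filter.1 h.2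
        exact ⟨(Finset.mem_filter.1 this.1).2, this.2⟩
      have hagree : ∀ h : {h // h ∈ H.filter fun h => good R h}, ∀ x,
          h.1.1 (toLC φ x) = h.1.2 (toLC ψ x) := fun h x =>
        (hH' h).2.1 (toLC φ x, toLC ψ x) ((hR _).2 ⟨x, rfl, rfl⟩)
      -- If `R` is the set of values of `(φ, ψ)`, a good pair `(h, k)` amounts to a point `χ = h ∘ φ
      -- = k ∘ ψ` of the fibre of `r` over `a φ`.
      choose χ hχ hχ' using fun h => exists_of_mem_factorSet (hH' h).1.1 φ
      rw [← Fintype.card_coe, ← Nat.card_eq_fintype_card]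
      refine Nat.card_congr (Equiv.ofBijective (fun h => ⟨χ h, hχ h⟩) ⟨fun h h' e => ?_, fun c => ?_⟩)
      · have e' : ∀ x, toLC (χ h) x = toLC (χ h') x := fun x =>
          congrArg (fun c : {χ // r χ = a φ} => toLC c.1 x) e
        refine Subtype.ext (Prod.ext (funext fun c => ?_) (funext fun c => ?_))
        · obtain ⟨x, rfl⟩ := toLC_surjective φ c
          rw [← hχ', ← hχ', e']
        · obtain ⟨x, rfl⟩ := toLC_surjective ψ c
          rw [← hagree, ← hagree, ← hχ', ← hχ', e']
      · obtain ⟨h, hh, hh'⟩ := exists_mem_factorSet a r φ (hfin _) c.1 c.2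
        obtain ⟨k, hk, hk'⟩ := exists_mem_factorSet b r ψ (hfin _) c.1 (c.2.trans hab)
        have hmem : (h, k) ∈ H.filter fun h => good R h := by
          refine Finset.mem_filter.2 ⟨Finset.mem_filter.2 ⟨Finset.mem_univ _, hh, hk⟩,
            fun d hd => ?_, Finset.eq_univ_of_forall fun c => ?_,
            Finset.eq_univ_of_forall fun c => ?_⟩
          · obtain ⟨x, hx, hx'⟩ := (hR d).1 hd
            rw [← hx, ← hx']
            exact (hh' x).symm.trans (hk' x)
          · obtain ⟨x, rfl⟩ := toLC_surjective φ c
            exact Finset.mem_image.2 ⟨(toLC φ x, toLC ψ x), (hR _).2 ⟨x, rfl, rfl⟩, rfl⟩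
          · obtain ⟨x, rfl⟩ := toLC_surjective ψ c
            exact Finset.mem_image.2 ⟨(toLC φ x, toLC ψ x), (hR _).2 ⟨x, rfl, rfl⟩, rfl⟩
        refine ⟨⟨(h, k), hmem⟩, Subtype.ext (toLC_injective (LocallyConstant.ext fun x => ?_))⟩
        exact (hχ' ⟨(h, k), hmem⟩ x).trans (hh' x).symm
    · rw [Nat.cast_eq_zero, Finset.card_eq_zero]
      -- A good pair forces `R` to come from an orbit: the components of a continuous surjection
      -- onto `R` lie in `X(A)` and `X(B)`, and they have the same image in `Y` because `h` and `k`
      -- send them to the same point of `X(n)`. Such a surjection exists since `R` is non-empty, as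
      -- `A` is.
      refine Finset.eq_empty_of_forall_notMem fun h hh => hR ?_
      obtain ⟨hh₁, hgood, hfst, hsnd⟩ := Finset.mem_filter.1 hh
      obtain ⟨-, hh₁, hh₂⟩ := Finset.mem_filter.1 hh₁
      obtain ⟨e⟩ := IsCantorSpace.nonempty_homeomorph_nat 𝔛
      obtain ⟨d, hd, -⟩ := Finset.mem_image.1
        (hfst.symm ▸ Finset.mem_univ (toLC φ₀ (e.symm fun _ => true)))
      have : Nonempty R := ⟨⟨d, hd⟩⟩
      obtain ⟨ρ, hρ⟩ := exists_surjective 𝔛 R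
      have hφ : Function.Surjective (ρ.map fun d => d.1.1) := fun c => by
        obtain ⟨d, hd, rfl⟩ := Finset.mem_image.1 (hfst.symm ▸ Finset.mem_univ c)
        obtain ⟨x, hx⟩ := hρ ⟨d, hd⟩
        exact ⟨x, congrArg (fun d : R => d.1.1) hx⟩
      have hψ : Function.Surjective (ρ.map fun d => d.1.2) := fun c => by
        obtain ⟨d, hd, rfl⟩ := Finset.mem_image.1 (hsnd.symm ▸ Finset.mem_univ c)
        obtain ⟨x, hx⟩ := hρ ⟨d, hd⟩
        exact ⟨x, congrArg (fun d : R => d.1.2) hx⟩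
      obtain ⟨χ, hχ, hχ'⟩ := exists_of_mem_factorSet hh₁ (ofLC _ hφ)
      obtain ⟨χ', hχ₂, hχ₂'⟩ := exists_of_mem_factorSet hh₂ (ofLC _ hψ)
      have hχχ : χ = χ' := toLC_injective (LocallyConstant.ext fun x =>
        (hχ' x).trans ((hgood _ (ρ x).2).trans (hχ₂' x).symm))
      refine ⟨pullback.mk (ofLC _ hφ) (ofLC _ hψ) (hχ.symm.trans (hχχ ▸ hχ₂)), ?_⟩
      ext d
      rw [hjr]
      constructor
      · rintro ⟨x, hx, hx'⟩
        rw [← show (ρ x).1 = d from Prod.ext hx hx']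
        exact (ρ x).2
      · intro hd
        obtain ⟨x, hx⟩ := hρ ⟨d, hd⟩
        exact ⟨x, congrArg (fun d : R => d.1.1) hx, congrArg (fun d : R => d.1.2) hx⟩
  have h₃ : ∑ h ∈ H, ∑ R : Finset (A × B) with good R h, (-2 : ℚ) ^ R.card =
      Nat.card {χ // r χ = y} * total (pullback a b) := by
    rw [total_of_injective j hj, Finset.mul_sum]
    simp only [Finset.sum_filter]
    rw [Finset.sum_comm]
    refine Finset.sum_congr rfl fun R _ => ?_
    rw [← Finset.sum_filter, Finset.sum_const, nsmul_eq_mul, h₂]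
    split_ifs <;> simp
  have hc : (Nat.card {χ // r χ = y} : ℚ) ≠ 0 := Nat.cast_ne_zero.2 hr
  have hn : ((-2 : ℚ) ^ n) ≠ 0 := pow_ne_zero _ (by norm_num)
  rw [hy]
  rw [h₃, hH] at h₁
  field_simp
  field_simp at h₁
  linarith

end

open scoped Classical in
theorem total_eq_sum_over {P W : FinGSet 𝔾} (f : P →[𝔾] W) :
    total P = ∑ O : W.Orb, ∑ Q : P.Orb with orbMap f Q = O, orbWeight Q :=
  (Finset.sum_fiberwise _ _ _).symm

theorem total_pullback_comm {X Y Z : FinGSet 𝔾} (f : X →[𝔾] Z) (g : Y →[𝔾] Z) :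
    total (pullback f g) = total (pullback g f) := by
  refine total_eq_of_bijective
    (pullback.lift (pullback.snd f g) (pullback.fst f g) fun p => (pullback.condition p).symm)
    (Function.bijective_iff_has_inverse.2
      ⟨pullback.lift (pullback.snd g f) (pullback.fst g f) fun p => (pullback.condition p).symm,
        fun _ => rfl, fun _ => rfl⟩)

/-- The map of fibre products induced by a map of the first factors. -/
def _root_.FinGSet.pullback.mapLeft {X X' Y Z : FinGSet 𝔾} (f : X →[𝔾] Z) (g : Y →[𝔾] Z)
    (p : X' →[𝔾] X) : pullback (f.comp p) g →[𝔾] pullback f g :=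
  pullback.lift (p.comp (pullback.fst _ _)) (pullback.snd _ _) pullback.condition

/-- The fibres of a map of fibre products are those of the map of factors. -/
def _root_.FinGSet.pullback.fiberEquiv {X X' Y Z : FinGSet 𝔾} (f : X →[𝔾] Z) (g : Y →[𝔾] Z)
    (p : X' →[𝔾] X) (w : pullback f g) :
    {v // pullback.mapLeft f g p v = w} ≃ {x // p x = pullback.fst f g w} where
  toFun v := ⟨pullback.fst _ _ v.1, congrArg (pullback.fst f g) v.2⟩
  invFun x := ⟨pullback.mk x.1 (pullback.snd f g w)
    ((congrArg f x.2).trans (pullback.condition w)), pullback.ext x.2 rfl⟩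
  left_inv v := Subtype.ext (pullback.ext rfl (congrArg (pullback.snd f g) v.2).symm)
  right_inv _ := rfl

open scoped Classical in
/-- The total weight of a fibre product with `X(B)` over a transitive `G`-set. -/
theorem total_pullback_right {B : Type} [Fintype B] {X Y : FinGSet 𝔾} (hY : Y.IsTransitive)
    (f : X →[𝔾] Y) (b : surjSet 𝔛 B →[𝔾] Y) (ψ₀ : surjSet 𝔛 B) (y : Y) :
    total (pullback f b) * weight y = total X * (-2) ^ Nat.card B := by
  -- The identity is proved for one orbit of `X` at a time. Replacing the orbit of `x` by a cover
  -- `X(n)` multiplies the weight of the part of the fibre product above it by the size of the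
  -- fibre, and leads to the case of two sets of surjections.
  rw [total_eq_sum_over (pullback.fst f b), total, Finset.sum_mul, Finset.sum_mul]
  refine Finset.sum_congr rfl fun O _ => ?_
  obtain ⟨x, rfl⟩ := cls_surj O
  obtain ⟨n, p, hp, hx⟩ := exists_weight_eq x
  obtain ⟨φ₀, hφ₀⟩ := (Nat.card_ne_zero.1 hp).1
  have h := total_pullback_surjSet hY (f.comp p) b φ₀ ψ₀ y
  have hfib : ∀ w : pullback f b, cls (pullback.fst f b w) = cls x →
      Nat.card {v // pullback.mapLeft f b p v = w} = Nat.card {φ // p φ = x} := by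
    intro w hw
    obtain ⟨g, hg⟩ := cls_eq.1 hw
    rw [Nat.card_congr (pullback.fiberEquiv f b p w), ← hg, card_fiber_smul]
  have e : total (pullback (f.comp p) b) = Nat.card {φ // p φ = x} *
      ∑ Q : (pullback f b).Orb with orbMap (pullback.fst f b) Q = cls x, orbWeight Q := by
    rw [total_eq_sum_over (pullback.mapLeft f b p), Finset.mul_sum, Finset.sum_filter]
    refine Finset.sum_congr rfl fun Q _ => ?_
    obtain ⟨w, rfl⟩ := cls_surj Q
    rw [orbMap_cls]
    split_ifs with hw
    · rw [sum_orbWeight_over _ w (Nat.card_ne_zero.1 ((hfib w hw).trans_ne hp)).2, hfib w hw,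
        orbWeight_cls]
    · refine Finset.sum_eq_zero fun T hT => (hw ?_).elim
      obtain ⟨v, rfl, -⟩ := exists_cls_eq_of_orbMap _ (Finset.mem_filter.1 hT).2
      obtain ⟨g, hg⟩ := surjSet_pretransitive.exists_smul_eq φ₀ (pullback.fst _ _ v)
      change cls (p (pullback.fst _ _ v)) = cls x
      rw [← hg, map_smul, cls_smul, hφ₀]
  rw [e, Nat.card_fin] at h
  rw [orbWeight_cls, hx]
  have hc : (Nat.card {φ // p φ = x} : ℚ) ≠ 0 := Nat.cast_ne_zero.2 hp
  field_simp
  linarith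

/-- The total weight of a fibre product over a transitive `G`-set. -/
theorem total_pullback {X Y Y' : FinGSet 𝔾} (hY : Y.IsTransitive) (hY' : Y'.IsTransitive)
    (f : X →[𝔾] Y) (g : Y' →[𝔾] Y) (y : Y) (y' : Y') :
    total (pullback f g) * weight y = total X * weight y' := by
  -- The same comparison is made in the second factor, with a cover of `Y'`.
  obtain ⟨n, q, hq, hy'⟩ := exists_weight_eq y'
  obtain ⟨ψ₀, -⟩ := (Nat.card_ne_zero.1 hq).1
  have h := total_pullback_right hY f (g.comp q) ψ₀ y
  have hfib : ∀ w : pullback g f,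
      Nat.card {v // pullback.mapLeft g f q v = w} = Nat.card {φ // q φ = y'} := by
    intro w
    obtain ⟨a, ha⟩ := hY'.2.exists_smul_eq y' (pullback.fst g f w)
    rw [Nat.card_congr (pullback.fiberEquiv g f q w), ← ha, card_fiber_smul]
  have e : total (pullback (g.comp q) f) = Nat.card {φ // q φ = y'} * total (pullback g f) := by
    classical
    rw [total_eq_sum_over (pullback.mapLeft g f q), total, Finset.mul_sum]
    refine Finset.sum_congr rfl fun Q _ => ?_
    obtain ⟨w, rfl⟩ := cls_surj Q
    rw [sum_orbWeight_over _ w (Nat.card_ne_zero.1 ((hfib w).trans_ne hq)).2, hfib w, orbWeight_cls]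
  rw [total_pullback_comm, e, Nat.card_fin, total_pullback_comm g f] at h
  rw [hy']
  have hc : (Nat.card {φ // q φ = y'} : ℚ) ≠ 0 := Nat.cast_ne_zero.2 hq
  field_simp
  linarith

variable (𝔛) in
/-- The regular measure for which `X(n)` has measure `(-2)^(n-1)`. -/
noncomputable def measure : GMeasure 𝔾 ℚ where
  val {X Y} _ hY := total X / weight hY.1.some
  iso {X Y} f hY hf := by
    rw [total_eq_of_bijective f hf, total_of_transitive hY hY.1.some,
      div_self (weight_ne_zero _)]
  add f hY i₁ i₂ h₁ h₂ h := by rw [total_add i₁ i₂ h₁ h₂ h, add_div]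
  comp f g hY hZ := by
    rw [total_of_transitive hY hY.1.some, div_mul_div_comm, mul_comm (weight _) (total _),
      mul_div_mul_right _ _ (weight_ne_zero _)]
  base_change {X Y X' Y'} f g f' g' hY hY' h₁ h₂ := by
    -- The hypotheses say that the square is cartesian, so `X'` may be replaced by the fibre
    -- product.
    have hb : Function.Bijective (pullback.lift g' f' h₁) := by
      refine ⟨fun a b h => ?_, fun p => ?_⟩
      · obtain ⟨c, -, hc⟩ := h₂ (g' a) (f' a) (h₁ a)
        exact (hc a ⟨rfl, rfl⟩).trans (hc b ⟨(congrArg (pullback.fst f g) h).symm,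
          (congrArg (pullback.snd f g) h).symm⟩).symm
      · obtain ⟨c, hc, -⟩ := h₂ _ _ (pullback.condition p)
        exact ⟨c, pullback.ext hc.1 hc.2⟩
    rw [total_eq_of_bijective _ hb, div_eq_div_iff (weight_ne_zero _) (weight_ne_zero _)]
    exact total_pullback hY hY' f g _ _

/-- All points of a transitive `G`-set have the same weight, so the point chosen in the definition
of `measure` is irrelevant. -/
theorem measure_val {X Y : FinGSet 𝔾} (f : X →[𝔾] Y) (hY : Y.IsTransitive) (y : Y) :
    (measure 𝔛).val f hY = total X / weight y := by
  rw [← total_of_transitive hY y, total_of_transitive hY hY.1.some]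
  rfl

theorem measure_isRegular : (measure 𝔛).IsRegular := by
  intro X Y f hY hX
  obtain ⟨x⟩ := hX.1
  rw [measure_val f hY (f x), total_of_transitive hX x]
  exact (div_ne_zero (weight_ne_zero _) (weight_ne_zero _)).isUnit

theorem surjSet_transitive (A : Type) [Finite A] [Nonempty A] : (surjSet 𝔛 A).IsTransitive := by
  obtain ⟨φ, hφ⟩ := exists_surjective 𝔛 A
  exact ⟨⟨ofLC φ hφ⟩, surjSet_pretransitive⟩

theorem weight_surjSet {A : Type} [Finite A] (φ : surjSet 𝔛 A) :
    weight φ = (-2) ^ Nat.card A := by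
  have hc : Nat.card {ψ // MulActionHom.id 𝔾 ψ = φ} = 1 :=
    Nat.card_eq_one_iff_unique.2 ⟨⟨fun a b => Subtype.ext (a.2.trans b.2.symm)⟩, ⟨⟨φ, rfl⟩⟩⟩
  rw [weight_eq (MulActionHom.id 𝔾) (by rw [hc]; exact one_ne_zero), hc, Nat.cast_one, div_one]

/-- The one-point set is `X(1)`, of weight `-2`. This accounts for the difference between the weight
`(-2)^n` and the mass `(-2)^(n-1)` of `X(n)`. -/
theorem weight_pt (x : (pt : FinGSet 𝔾)) : weight x = -2 := by
  have h := surjSet_transitive (𝔛 := 𝔛) PUnit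
  obtain ⟨φ⟩ := h.1
  have e : (surjSet 𝔛 PUnit).toPt φ = x := rfl
  rw [← e, weight_map _ (fun a b _ => toLC_injective (LocallyConstant.ext fun x => rfl)),
    weight_surjSet]
  simp

theorem measure_mass_surjSet (n : ℕ) (hn : 1 ≤ n) :
    (measure 𝔛).mass (surjSet 𝔛 (Fin n)) = (-2) ^ (n - 1) := by
  have : Nonempty (Fin n) := ⟨⟨0, hn⟩⟩
  have h := surjSet_transitive (𝔛 := 𝔛) (Fin n)
  obtain ⟨φ⟩ := h.1
  rw [GMeasure.mass, measure_val _ _ ((surjSet 𝔛 (Fin n)).toPt φ), weight_pt, total_of_transitive h φ, weight_surjSet,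
    Nat.card_fin]
  obtain ⟨m, rfl⟩ := Nat.exists_eq_add_of_le' hn
  rw [Nat.add_sub_cancel, pow_succ]
  field_simp

end

end HomeoGroup

/-! ### Uniqueness of the measure -/

namespace GMeasure

open FinGSet

section

variable {G : Type u} [Group G] [TopologicalSpace G] {k : Type v} [CommRing k] (μ : GMeasure G k)

/-- The image of an orbit is all of the transitive set `Y`, so the two maps are related by base
change along its inclusion in `Y`. -/
theorem orbVal_eq {X Y : FinGSet G} (f : X →[G] Y) (hY : Y.IsTransitive) (O : X.Orb) :
    μ.orbVal f O = μ.val (f.comp (X.incl {O})) hY := by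
  refine μ.base_change (f.comp (X.incl {O})) (Y.incl {orbMap f O}) _ (MulActionHom.id G) hY _
    (fun _ => rfl) fun x y h => ⟨x, ⟨rfl, Subtype.ext h⟩, fun z hz => hz.1⟩

/-- A measure is the sum of its values on the orbits. -/
theorem val_eq_sum {X Y : FinGSet G} (f : X →[G] Y) (hY : Y.IsTransitive) :
    μ.val f hY = ∑ O : X.Orb, μ.val (f.comp (X.incl {O})) hY := by
  obtain ⟨y⟩ := hY.1
  have hP : ∀ O : X.Orb, orbMap f O = cls y := fun O => by
    obtain ⟨x, rfl⟩ := cls_surj O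
    exact cls_eq.2 (hY.2.exists_smul_eq y (f x))
  have h := μ.val_sub f (cls y) Finset.univ fun O _ => hP O
  rw [Finset.sum_congr rfl fun O _ => μ.orbVal_eq f hY O] at h
  rw [← h]
  refine (μ.base_change f (Y.incl {cls y}) _ (X.incl _) hY _ (fun _ => rfl) fun x y' e =>
    ⟨⟨x, Finset.mem_coe.2 (Finset.mem_univ _)⟩, ⟨rfl, Subtype.ext e⟩, fun z hz =>
      Subtype.ext hz.1⟩).symm

theorem mass_eq_mul {X Y : FinGSet G} (f : X →[G] Y) (hY : Y.IsTransitive) :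
    μ.mass X = μ.mass Y * μ.val f hY :=
  μ.comp f Y.toPt hY pt_transitive

theorem mass_eq_sum (X : FinGSet G) : μ.mass X = ∑ O : X.Orb, μ.mass (X.sub {O}) :=
  μ.val_eq_sum X.toPt pt_transitive

theorem push_map {k' : Type w} [CommRing k'] (φ : k →+* k') {X Y : FinGSet G} (f : X →[G] Y)
    (a : InvFun k X) : (μ.map φ).push f (fun O => φ (a O)) = fun O => φ (μ.push f a O) := by
  funext P
  simp only [push, map_sum]
  refine Finset.sum_congr rfl fun O _ => ?_
  split_ifs
  · rw [map_mul]
    rfl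
  · rw [map_zero]

end

end GMeasure

namespace HomeoGroup

open FinGSet

section

variable {𝔛 : Type u} [TopologicalSpace 𝔛] [IsCantorSpace 𝔛]

local notation "𝔾" => HomeoGroup 𝔛

/-- The value of a measure on a map from `X(A)` with finite fibres is the same for all measures. -/
theorem val_cover {k : Type v} [CommRing k] (μ : GMeasure 𝔾 k) {A : Type} [Fintype A] [Nonempty A]
    {X : FinGSet 𝔾} (hX : X.IsTransitive) (p : surjSet 𝔛 A →[𝔾] X) (hp : ∀ x, Finite {φ // p φ = x}) :
    μ.val p hX = Fintype.card (pullback p p).Orb := by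
  -- `p` is base changed along itself. In a point of the fibre product the first component is a
  -- function of the second, so every orbit maps isomorphically onto `X(A)` and contributes `1`: the
  -- value counts orbits, and does not involve `μ`.
  have h := μ.base_change p p (pullback.snd p p) (pullback.fst p p) hX (surjSet_transitive A)
    pullback.condition fun x y e => ⟨pullback.mk x y e, ⟨rfl, rfl⟩, fun z hz =>
      pullback.ext hz.1 hz.2⟩
  rw [← h, μ.val_eq_sum]
  rw [Finset.sum_congr rfl (g := fun _ => (1 : k)), Finset.sum_const, Finset.card_univ, nsmul_one]
  intro O _
  refine μ.iso _ _ ⟨?_, fun φ => ?_⟩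
  · rintro ⟨v, hv⟩ ⟨w, hw⟩ e
    change pullback.snd p p v = pullback.snd p p w at e
    obtain ⟨g, rfl⟩ := cls_eq.1 (hv.trans (show cls w = O from hw).symm)
    refine Subtype.ext (pullback.ext (toLC_injective (LocallyConstant.ext fun x => ?_)) e)
    have e' : g • toLC (pullback.snd p p w) = toLC (pullback.snd p p w) := congrArg toLC e
    obtain ⟨h, -, hh⟩ := exists_mem_factorSet p p (pullback.snd p p w) (hp _)
      (pullback.fst p p w) (pullback.condition w)
    change toLC (pullback.fst p p w) ((toHomeo g).symm x) = toLC (pullback.fst p p w) x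
    rw [hh, hh, smul_eq_iff.1 e' x]
  · obtain ⟨v, rfl⟩ := cls_surj O
    obtain ⟨g, hg⟩ := surjSet_pretransitive.exists_smul_eq (pullback.snd p p v) φ
    exact ⟨⟨g • v, cls_smul g v⟩, hg⟩

/-- The mass of `X(n)` is the mass of `X` times the value of a cover `X(n) → X`, which is common to
all measures and non-zero because `measure` is regular. So the masses of transitive sets agree, then
all masses by additivity, and finally all values, by division by the mass of the target. -/
theorem measure_unique (μ : GMeasure 𝔾 ℚ)
    (h : ∀ n : ℕ, 1 ≤ n → μ.mass (surjSet 𝔛 (Fin n)) = (-2) ^ (n - 1)) : μ = measure 𝔛 := by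
  have h₁ : ∀ X : FinGSet 𝔾, X.IsTransitive → μ.mass X = (measure 𝔛).mass X := by
    intro X hX
    obtain ⟨x⟩ := hX.1
    obtain ⟨n, p, hp, -⟩ := exists_weight_eq x
    obtain ⟨φ, -⟩ := (Nat.card_ne_zero.1 hp).1
    have hfin : ∀ x, Finite {φ // p φ = x} := by
      intro y
      obtain ⟨g, rfl⟩ := hX.2.exists_smul_eq x y
      exact (Nat.card_ne_zero.1 ((card_fiber_smul p g x).trans_ne hp)).2
    -- `X(0)` is empty because `𝔛` is not.
    have hn : 1 ≤ n := Nat.one_le_iff_ne_zero.2 fun e => by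
      subst e
      obtain ⟨e⟩ := IsCantorSpace.nonempty_homeomorph_nat 𝔛
      exact (toLC φ (e.symm fun _ => true)).elim0
    have : Nonempty (Fin n) := ⟨⟨0, hn⟩⟩
    have e₁ := μ.mass_eq_mul p hX
    have e₂ := (measure 𝔛).mass_eq_mul p hX
    have hr := (measure_isRegular p hX (surjSet_transitive _)).ne_zero
    rw [h n hn, val_cover μ hX p hfin] at e₁
    rw [measure_mass_surjSet n hn, e₁, val_cover _ hX p hfin] at e₂
    rw [val_cover _ hX p hfin] at hr
    exact mul_right_cancel₀ hr e₂
  have h₂ : ∀ X : FinGSet 𝔾, μ.mass X = (measure 𝔛).mass X := by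
    intro X
    rw [μ.mass_eq_sum, (measure 𝔛).mass_eq_sum]
    exact Finset.sum_congr rfl fun O _ => h₁ _ (X.sub_transitive O)
  refine GMeasure.ext ?_
  funext X Y f hY
  have e₁ := μ.mass_eq_mul f hY
  have e₂ := (measure 𝔛).mass_eq_mul f hY
  rw [h₂, h₂ Y, e₂] at e₁
  have hr : (measure 𝔛).mass Y ≠ 0 := (measure_isRegular Y.toPt pt_transitive hY).ne_zero
  exact (mul_left_cancel₀ hr e₁).symm

/-! ### The push-forward along `Y(f)` -/

theorem measure_orbVal {X Y : FinGSet 𝔾} (f : X →[𝔾] Y) (O : X.Orb) :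
    (measure 𝔛).orbVal f O = orbWeight O / orbWeight (orbMap f O) := by
  obtain ⟨x, rfl⟩ := cls_surj O
  have hx : weight (X := X.sub {cls x}) ⟨x, rfl⟩ = weight x :=
    (weight_map (X.incl {cls x}) Subtype.val_injective (⟨x, rfl⟩ : X.sub {cls x})).symm
  have hy : weight (X := Y.sub {cls (f x)}) ⟨f x, rfl⟩ = weight (f x) :=
    (weight_map (Y.incl {cls (f x)}) Subtype.val_injective
      (⟨f x, rfl⟩ : Y.sub {cls (f x)})).symm
  rw [GMeasure.orbVal, measure_val _ _ (⟨f x, rfl⟩ : Y.sub {orbMap f (cls x)}),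
    total_of_transitive (X.sub_transitive _) (⟨x, rfl⟩ : X.sub {cls x}), hx]
  exact congrArg (weight x / ·) hy

variable {A B : Type} [Fintype A] [Fintype B]

/-- The locally constant map underlying an element of `Y(A)`. -/
def toMap (φ : mapSet 𝔛 A) : LocallyConstant 𝔛 A := φ

theorem orbRange_nonempty (O : (mapSet 𝔛 A).Orb) : (orbRange O).Nonempty := by
  obtain ⟨φ, rfl⟩ := cls_surj O
  obtain ⟨e⟩ := IsCantorSpace.nonempty_homeomorph_nat 𝔛
  exact ⟨_, (mem_orbRange φ _).2 ⟨e.symm fun _ => true, rfl⟩⟩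

theorem exists_orbRange_eq {T : Finset A} (hT : T.Nonempty) :
    ∃ O : (mapSet 𝔛 A).Orb, orbRange O = T := by
  have : Nonempty T := hT.to_subtype
  obtain ⟨φ, hφ⟩ := exists_surjective 𝔛 T
  refine ⟨cls (X := mapSet 𝔛 A) (φ.map Subtype.val), ?_⟩
  ext a
  rw [mem_orbRange]
  constructor
  · rintro ⟨x, rfl⟩
    exact (φ x).2
  · intro ha
    obtain ⟨x, hx⟩ := hφ ⟨a, ha⟩
    exact ⟨x, congrArg Subtype.val hx⟩

theorem orbRange_orbMap [DecidableEq B] (f : A → B) (O : (mapSet 𝔛 A).Orb) :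
    orbRange (orbMap (mapSetMap 𝔛 f) O) = (orbRange O).image f := by
  obtain ⟨φ, rfl⟩ := cls_surj O
  ext b
  rw [orbMap_cls, Finset.mem_image]
  refine (mem_orbRange _ b).trans ⟨?_, ?_⟩
  · rintro ⟨x, rfl⟩
    exact ⟨_, (mem_orbRange φ _).2 ⟨x, rfl⟩, rfl⟩
  · rintro ⟨a, ha, rfl⟩
    obtain ⟨x, rfl⟩ := (mem_orbRange φ _).1 ha
    exact ⟨x, rfl⟩

/-- At a map `ψ` with image `S`, the push-forward is the sum of `(-2)^|T| / (-2)^|S|` over the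
images `T` of orbits with `f(T) = S`, and `sum_neg_two_pow_image` evaluates it as one or zero
according to the parity of the fibres over `S`. -/
theorem measure_push_mapSetMap (f : A → B) :
    (measure 𝔛).push (mapSetMap 𝔛 f) 1 = mapSetInd 𝔛 ℚ (oddFiber f) := by
  classical
  refine invFun_ext fun ψ => ?_
  have h₁ : ∀ O : (mapSet 𝔛 A).Orb, orbMap (mapSetMap 𝔛 f) O = cls ψ ↔
      (orbRange O).image f = orbRange (cls ψ) := fun O => by
    rw [← orbRange_orbMap]
    exact ⟨congrArg _, fun h => orbRange_injective h⟩
  have h₂ : (measure 𝔛).push (mapSetMap 𝔛 f) 1 (cls ψ) =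
      (∑ O : (mapSet 𝔛 A).Orb with (orbRange O).image f = orbRange (cls ψ),
        (-2 : ℚ) ^ (orbRange O).card) / (-2) ^ (orbRange (cls ψ)).card := by
    rw [GMeasure.push, Finset.sum_div, Finset.sum_filter]
    refine Finset.sum_congr rfl fun O _ => ?_
    rw [if_congr (h₁ O) rfl rfl]
    split_ifs with h
    · rw [measure_orbVal, (h₁ O).2 h, orbWeight_eq, orbWeight_eq]
      exact mul_one _
    · rfl
  have h₃ : ∑ O : (mapSet 𝔛 A).Orb with (orbRange O).image f = orbRange (cls ψ),
      (-2 : ℚ) ^ (orbRange O).card =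
      ∑ T ∈ (Finset.univ : Finset A).powerset with T.image f = orbRange (cls ψ), (-2) ^ T.card := by
    refine Finset.sum_bij (fun O _ => orbRange O) (fun O hO => ?_)
      (fun O _ P _ e => orbRange_injective e) (fun T hT => ?_) fun _ _ => rfl
    · exact Finset.mem_filter.2 ⟨Finset.mem_powerset.2 (Finset.subset_univ _),
        (Finset.mem_filter.1 hO).2⟩
    · have hT' := (Finset.mem_filter.1 hT).2
      -- The empty set is the only subset that is not the image of an orbit; it does not occur here
      -- because `ψ` has a non-empty image.
      have hne : T.Nonempty := Finset.image_nonempty.1 (hT' ▸ orbRange_nonempty (cls ψ))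
      obtain ⟨O, rfl⟩ := exists_orbRange_eq (𝔛 := 𝔛) hne
      exact ⟨O, Finset.mem_filter.2 ⟨Finset.mem_univ _, hT'⟩, rfl⟩
  rw [h₂, h₃, Finset.sum_neg_two_pow_image]
  have h₄ : (∀ c ∈ orbRange (cls ψ), Odd (Finset.univ.filter fun a => f a = c).card) ↔
      ∀ x, toMap ψ x ∈ oddFiber f := by
    have e : ∀ c, Odd (Finset.univ.filter fun a => f a = c).card ↔ c ∈ oddFiber f := fun c => by
      rw [oddFiber, Set.mem_ofPred_eq, Nat.card_eq_fintype_card, Fintype.card_subtype]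
    simp only [e]
    exact ⟨fun h x => h _ ((mem_orbRange _ _).2 ⟨x, rfl⟩), fun h c hc => by
      obtain ⟨x, rfl⟩ := (mem_orbRange _ _).1 hc
      exact h x⟩
  have h₅ : mapSetInd 𝔛 ℚ (oddFiber f) (cls ψ) =
      if ∀ x, toMap ψ x ∈ oddFiber f then 1 else 0 := ind_cls _ _ _
  rw [h₅]
  by_cases h : ∀ x, toMap ψ x ∈ oddFiber f
  · rw [if_pos (h₄.2 h), if_pos h, div_self (pow_ne_zero _ (by norm_num))]
  · rw [if_neg (mt h₄.1 h), if_neg h, zero_div]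

/-- The push-forward of the constant function `1` along `Y(f)`. -/
theorem push_mapSetMap {k : Type v} [Field k] [CharZero k] (A B : Type) [Finite A] [Finite B]
    (f : A → B) : ((measure 𝔛).map (Rat.castHom k)).push (mapSetMap 𝔛 f) 1 =
      mapSetInd 𝔛 k (oddFiber f) := by
  have := Fintype.ofFinite A
  have := Fintype.ofFinite B
  have h := (measure 𝔛).push_map (Rat.castHom k) (mapSetMap 𝔛 f) 1
  have h₁ : (fun O : (mapSet 𝔛 A).Orb => Rat.castHom k ((1 : InvFun ℚ (mapSet 𝔛 A)) O)) = 1 :=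
    funext fun O => map_one _
  rw [h₁, measure_push_mapSetMap] at h
  rw [h]
  classical
  refine invFun_ext fun ψ => ?_
  change Rat.castHom k (if ∀ x, toMap ψ x ∈ oddFiber f then 1 else 0) =
    if ∀ x, toMap ψ x ∈ oddFiber f then 1 else 0
  split_ifs <;> simp

end

end HomeoGroup

/-! ### Matrices over the field with two elements as invariant functions -/

namespace HomeoGroup

open FinGSet

section

variable {𝔛 : Type u} [TopologicalSpace 𝔛] [IsCantorSpace 𝔛] {k : Type v} [Field k]

local notation "𝔾" => HomeoGroup 𝔛

variable {A B C A' B' : Type} [Fintype A] [Fintype B] [Fintype C] [Fintype A'] [Fintype B']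

theorem mapSet_ext {φ ψ : mapSet 𝔛 A} (h : ∀ x, toMap φ x = toMap ψ x) : φ = ψ :=
  LocallyConstant.ext h

/-- The bijection `Y(B) × Y(A) ≅ Y(B × A)`. -/
def pairMap (B A : Type) [Fintype A] [Fintype B] :
    (mapSet 𝔛 B).prod (mapSet 𝔛 A) →[𝔾] mapSet 𝔛 (B × A) :=
  ⟨fun p => pairLC (toMap (fst p)) (toMap (snd p)), fun _ _ => rfl⟩

/-- The inverse bijection `Y(B × A) ≅ Y(B) × Y(A)`. -/
def unpairMap (B A : Type) [Fintype A] [Fintype B] :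
    mapSet 𝔛 (B × A) →[𝔾] (mapSet 𝔛 B).prod (mapSet 𝔛 A) :=
  pair (mapSetMap 𝔛 Prod.fst) (mapSetMap 𝔛 Prod.snd)

theorem unpairMap_pairMap (p : (mapSet 𝔛 B).prod (mapSet 𝔛 A)) :
    unpairMap B A (pairMap B A p) = p := rfl

theorem pairMap_unpairMap (φ : mapSet 𝔛 (B × A)) : pairMap B A (unpairMap B A φ) = φ := rfl

variable (k) in
/-- The invariant function attached to a matrix over the field with two elements: the indicator
function of the set of pairs `(ψ, φ)` with all values in the support of the matrix. -/
noncomputable def matFn (f : Matrix B A (ZMod 2)) : InvFun k ((mapSet 𝔛 B).prod (mapSet 𝔛 A)) :=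
  ind k (fun p => ∀ x, f (toMap (fst p) x) (toMap (snd p) x) ≠ 0) fun g p =>
    ((toHomeo g).symm.surjective.forall
      (p := fun x => f (toMap (fst p) x) (toMap (snd p) x) ≠ 0)).symm

open scoped Classical in
theorem matFn_cls (f : Matrix B A (ZMod 2)) (p : (mapSet 𝔛 B).prod (mapSet 𝔛 A)) :
    matFn k f (cls p) = if ∀ x, f (toMap (fst p) x) (toMap (snd p) x) ≠ 0 then 1 else 0 := rfl

/-- Identities and the constraints of the tensor structure of `𝒱` are matrices of maps of bases, so
this case governs everything apart from composition and the Kronecker product of general matrices.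
-/
theorem matFn_ofMap {V W : VObj} (e : V.A → W.A) :
    matFn (𝔛 := 𝔛) k (VObj.ofMap e : Matrix W.A V.A (ZMod 2)) = graph k (mapSetMap 𝔛 e) := by
  classical
  refine invFun_ext fun p => ?_
  rw [matFn_cls]
  refine Eq.trans (if_congr ?_ rfl rfl) (GMeasure.graph_cls (k := k) (mapSetMap 𝔛 e) (fst p) (snd p)).symm
  have h : ∀ x, (VObj.ofMap e : Matrix W.A V.A (ZMod 2)) (toMap (fst p) x) (toMap (snd p) x) ≠ 0 ↔
      e (toMap (snd p) x) = toMap (fst p) x := fun x => by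
    change (if _ then _ else _) ≠ _ ↔ _
    split_ifs with h <;> simp [h]
  simp only [h]
  exact ⟨fun h => mapSet_ext fun x => (h x).symm, fun h x => by rw [h]; rfl⟩

/-- No pair of maps has all its values in the empty set, since `𝔛` is non-empty. This is why `[0]`
has to be split off from `k[𝒱]`. -/
theorem matFn_zero : matFn (𝔛 := 𝔛) k (0 : Matrix B A (ZMod 2)) = 0 := by
  obtain ⟨e⟩ := IsCantorSpace.nonempty_homeomorph_nat 𝔛
  refine invFun_ext fun p => ?_
  rw [matFn_cls, if_neg fun h => h (e.symm fun _ => true) rfl]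
  rfl

/-- A product in a field is non-zero exactly when both factors are, so the support of a Kronecker
product is the product of the supports. -/
theorem matFn_kronecker (f : Matrix B A (ZMod 2)) (g : Matrix B' A' (ZMod 2))
    (ψ : (mapSet 𝔛 B).prod (mapSet 𝔛 B')) (φ : (mapSet 𝔛 A).prod (mapSet 𝔛 A')) :
    matFn k (Matrix.kroneckerMap (· * ·) f g) (cls (pr (pairMap B B' ψ) (pairMap A A' φ))) =
      matFn k f (cls (pr (fst ψ) (fst φ))) * matFn k g (cls (pr (snd ψ) (snd φ))) := by
  classical
  rw [matFn_cls, matFn_cls, matFn_cls]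
  have h : (∀ x, f (toMap (fst ψ) x) (toMap (fst φ) x) * g (toMap (snd ψ) x) (toMap (snd φ) x) ≠ 0) ↔
      (∀ x, f (toMap (fst ψ) x) (toMap (fst φ) x) ≠ 0) ∧
        ∀ x, g (toMap (snd ψ) x) (toMap (snd φ) x) ≠ 0 := by
    simp only [mul_ne_zero_iff, forall_and]
  refine (if_congr h rfl rfl).trans ?_
  refine Eq.trans ?_ (congrArg₂ (· * ·) (if_congr Iff.rfl rfl rfl) (if_congr Iff.rfl rfl rfl))
  rw [ite_and, ite_mul, one_mul, zero_mul]
  rfl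

/-- The support of a matrix over the field with two elements. -/
def matSupp (f : Matrix B A (ZMod 2)) : Finset (B × A) := Finset.univ.filter fun p => f p.1 p.2 ≠ 0

theorem mem_matSupp (f : Matrix B A (ZMod 2)) (p : B × A) : p ∈ matSupp f ↔ f p.1 p.2 ≠ 0 :=
  Finset.mem_filter.trans (and_iff_right (Finset.mem_univ p))

theorem matSupp_injective : Function.Injective (matSupp (A := A) (B := B)) := by
  have hz : ∀ y z : ZMod 2, (y ≠ 0 ↔ z ≠ 0) → y = z := by decide
  exact fun f g h => Matrix.ext fun b a => hz _ _ ((mem_matSupp f (b, a)).symm.trans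
    ((Finset.ext_iff.1 h _).trans (mem_matSupp g (b, a))))

theorem exists_matSupp_eq (S : Finset (B × A)) : ∃ f : Matrix B A (ZMod 2), matSupp f = S := by
  classical
  refine ⟨Matrix.of fun b a => if (b, a) ∈ S then 1 else 0, ?_⟩
  ext p
  rw [mem_matSupp]
  change (if p ∈ S then (1 : ZMod 2) else 0) ≠ 0 ↔ p ∈ S
  split_ifs with h <;> simp [h]

/-- With orbits regarded as non-empty subsets of `B × A`, the functions of the non-zero matrices
form the incidence matrix of inclusion, which is unitriangular. The next two results rest on this.
-/
theorem matFn_eq_ite [DecidableEq (B × A)] (f : Matrix B A (ZMod 2))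
    (O : ((mapSet 𝔛 B).prod (mapSet 𝔛 A)).Orb) :
    matFn k f O = if orbRange (orbMap (pairMap B A) O) ⊆ matSupp f then 1 else 0 := by
  classical
  obtain ⟨p, rfl⟩ := cls_surj O
  rw [matFn_cls]
  refine if_congr ⟨fun h q hq => ?_, fun h x => ?_⟩ rfl rfl
  · obtain ⟨x, rfl⟩ := (mem_orbRange _ q).1 hq
    exact (mem_matSupp _ _).2 (h x)
  · exact (mem_matSupp f _).1 (h ((mem_orbRange _ _).2 ⟨x, rfl⟩))

theorem orbMap_pairMap_injective : Function.Injective (orbMap (pairMap (𝔛 := 𝔛) B A)) :=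
  orbMap_injective _ (Function.LeftInverse.injective unpairMap_pairMap)

/-- The functions attached to the non-zero matrices are linearly independent. -/
theorem eq_zero_of_linearCombination_matFn {c : Matrix B A (ZMod 2) →₀ k}
    (hc : Finsupp.linearCombination k (matFn (𝔛 := 𝔛) k) c = 0) {f : Matrix B A (ZMod 2)}
    (hf : f ≠ 0) : c f = 0 := by
  classical
  by_contra hcf
  -- Take `g` with largest support among the non-zero matrices that occur, and evaluate at the orbit
  -- whose set of values is the support of `g`. Any matrix contributing there has a support
  -- containing that of `g`, so it is `g`.
  obtain ⟨g, hg, hmax⟩ := Finset.exists_max_image (c.support.filter (· ≠ 0))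
    (fun g => (matSupp g).card) ⟨f, Finset.mem_filter.2 ⟨Finsupp.mem_support_iff.2 hcf, hf⟩⟩
  obtain ⟨hg₁, hg₂⟩ := Finset.mem_filter.1 hg
  have hne : (matSupp g).Nonempty := by
    rw [Finset.nonempty_iff_ne_empty]
    intro h
    refine hg₂ (matSupp_injective (h.trans ?_))
    ext p
    simp [mem_matSupp]
  obtain ⟨O, hO⟩ := exists_orbRange_eq (𝔛 := 𝔛) hne
  obtain ⟨φ, rfl⟩ := cls_surj O
  have h := congrFun hc (cls (unpairMap B A φ))
  rw [Finsupp.linearCombination_apply, Finsupp.sum, Finset.sum_apply,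
    Finset.sum_eq_single g] at h
  · rw [Pi.smul_apply, matFn_eq_ite, orbMap_cls, pairMap_unpairMap, hO,
      if_pos subset_rfl, smul_eq_mul, mul_one] at h
    exact Finsupp.mem_support_iff.1 hg₁ h
  · intro g' hg' hne'
    rw [Pi.smul_apply, matFn_eq_ite, orbMap_cls, pairMap_unpairMap, hO, if_neg, smul_zero]
    intro hs
    refine hne' (matSupp_injective (Finset.eq_of_subset_of_card_le hs (hmax g' ?_)).symm)
    refine Finset.mem_filter.2 ⟨hg', ?_⟩
    rintro rfl
    obtain ⟨p, hp⟩ := hne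
    exact (mem_matSupp _ p).1 (hs hp) rfl
  · exact fun h' => absurd hg₁ h'

/-- The functions attached to matrices span. -/
theorem linearCombination_matFn_surjective :
    Function.Surjective (Finsupp.linearCombination k (matFn (𝔛 := 𝔛) k (A := A) (B := B))) := by
  classical
  choose m hm using fun O : ((mapSet 𝔛 B).prod (mapSet 𝔛 A)).Orb =>
    exists_matSupp_eq (orbRange (orbMap (pairMap B A) O))
  have hinj : Function.Injective m := fun O P h => orbMap_pairMap_injective
    (orbRange_injective ((hm O).symm.trans ((congrArg matSupp h).trans (hm P))))
  have hne : ∀ O, m O ≠ 0 := fun O h => by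
    obtain ⟨p, hp⟩ := orbRange_nonempty (orbMap (pairMap B A) O)
    rw [← hm, h] at hp
    exact (mem_matSupp _ p).1 hp rfl
  -- `T` maps the indicator function of an orbit to the function of the matrix supported on its set
  -- of values. It is an injective endomorphism of a finite-dimensional space, hence surjective.
  let T : InvFun k ((mapSet 𝔛 B).prod (mapSet 𝔛 A)) →ₗ[k] InvFun k _ :=
    Finsupp.linearCombination k (matFn (𝔛 := 𝔛) k) ∘ₗ Finsupp.lmapDomain k k m ∘ₗ
      (Finsupp.linearEquivFunOnFinite k k _).symm.toLinearMap
  have hT : Function.Injective T := by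
    refine (injective_iff_map_eq_zero T).2 fun c hc => ?_
    funext O
    have h := eq_zero_of_linearCombination_matFn hc (hne O)
    exact (Finsupp.mapDomain_apply hinj _ O).symm.trans h
  intro a
  obtain ⟨c, hc⟩ := LinearMap.injective_iff_surjective.1 hT a
  exact ⟨_, hc⟩

variable [CharZero k]

/-- The product of the two pulled back functions is the indicator function of `Y(Q)`, where `Q`
consists of the `(c, b, a)` with `g c b` and `f b a` non-zero. Pushing it forward along `Q → C × A`
keeps the pairs `(c, a)` that have an odd number of intermediate `b`, and that number modulo 2 is
the entry of the matrix product. -/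
theorem matFn_mul (g : Matrix C B (ZMod 2)) (f : Matrix B A (ZMod 2)) :
    ((measure 𝔛).map (Rat.castHom k)).matMul (matFn k g) (matFn k f) = matFn k (g * f) := by
  classical
  let ν := (measure 𝔛).map (Rat.castHom k)
  let Q := {q : C × B × A // g q.1 q.2.1 ≠ 0 ∧ f q.2.1 q.2.2 ≠ 0}
  let j : mapSet 𝔛 Q →[𝔾] (mapSet 𝔛 C).prod ((mapSet 𝔛 B).prod (mapSet 𝔛 A)) :=
    pair (mapSetMap 𝔛 fun q : Q => q.1.1) (pair (mapSetMap 𝔛 fun q : Q => q.1.2.1)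
      (mapSetMap 𝔛 fun q : Q => q.1.2.2))
  have hj : Function.Injective j := fun φ ψ h => mapSet_ext fun x => Subtype.ext (Prod.ext
    (congrArg (fun φ : mapSet 𝔛 C => toMap φ x) (fst_eq h))
    (Prod.ext (congrArg (fun φ : mapSet 𝔛 B => toMap φ x) (fst_eq (snd_eq h)))
      (congrArg (fun φ : mapSet 𝔛 A => toMap φ x) (snd_eq (snd_eq h)))))
  let P : (mapSet 𝔛 C).prod ((mapSet 𝔛 B).prod (mapSet 𝔛 A)) → Prop := fun p =>
    (∀ x, g (toMap (fst p) x) (toMap (fst (snd p)) x) ≠ 0) ∧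
      ∀ x, f (toMap (fst (snd p)) x) (toMap (snd (snd p)) x) ≠ 0
  have hP : ∀ (a : 𝔾) p, P (a • p) ↔ P p := fun a p => and_congr
    ((toHomeo a).symm.surjective.forall
      (p := fun x => g (toMap (fst p) x) (toMap (fst (snd p)) x) ≠ 0)).symm
    ((toHomeo a).symm.surjective.forall
      (p := fun x => f (toMap (fst (snd p)) x) (toMap (snd (snd p)) x) ≠ 0)).symm
  have h₁ : pull (pair fst (fst.comp snd)) (matFn k g) * pull snd (matFn k f) =
      ν.push j 1 := by
    rw [← ν.push_one_injective j hj P hP]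
    · refine invFun_ext fun p => ?_
      refine Eq.trans ?_ (ind_cls P hP p).symm
      refine (congrArg₂ (· * ·) (matFn_cls (k := k) g (pr (fst p) (fst (snd p))))
        (matFn_cls (k := k) f (snd p))).trans ?_
      rw [ite_mul, one_mul, zero_mul, ← ite_and]
      by_cases h : P p
      · rw [if_pos h]
        exact if_pos h
      · rw [if_neg h]
        exact if_neg h
    · refine fun p => ⟨fun h => ?_, ?_⟩
      · refine ⟨(⟨fun x => ⟨(toMap (fst p) x, toMap (fst (snd p)) x, toMap (snd (snd p)) x),
          h.1 x, h.2 x⟩, ?_⟩ : LocallyConstant 𝔛 Q), rfl⟩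
        have hc := ((toMap (fst p)).isLocallyConstant.prodMk
          ((toMap (fst (snd p))).isLocallyConstant.prodMk (toMap (snd (snd p))).isLocallyConstant))
        refine (IsLocallyConstant.iff_eventually_eq _).2 fun x => ?_
        filter_upwards [(IsLocallyConstant.iff_eventually_eq _).1 hc x] with y hy
        exact Subtype.ext hy
      · rintro ⟨φ, rfl⟩
        exact ⟨fun x => (toMap φ x).2.1, fun x => (toMap φ x).2.2⟩
  let r : Q → C × A := fun q => (q.1.1, q.1.2.2)
  -- The projection to `Y(C) × Y(A)`, restricted to `Y(Q)`, is `Y(r)` followed by the bijection `Y(C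
  -- × A) ≅ Y(C) × Y(A)`, so `push_mapSetMap` applies.
  have h₂ : ν.matMul (matFn k g) (matFn k f) =
      ν.push (unpairMap C A) (mapSetInd 𝔛 k (oddFiber r)) := by
    rw [GMeasure.matMul, h₁, GMeasure.push_push, ← push_mapSetMap, GMeasure.push_push]
    rfl
  rw [h₂]
  refine invFun_ext fun p => ?_
  refine (ν.push_injective (unpairMap C A) (Function.LeftInverse.injective pairMap_unpairMap) _
    (cls (pairMap C A p))).trans ?_
  rw [matFn_cls]
  refine (ind_cls _ _ _).trans (if_congr (forall_congr' fun x => ?_) rfl rfl)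
  change Odd (Nat.card {q : Q // r q = (toMap (fst p) x, toMap (snd p) x)}) ↔ _
  rw [Matrix.mul_apply]
  generalize toMap (fst p) x = c
  generalize toMap (snd p) x = a
  have hz : ∀ y z : ZMod 2, y * z = if y ≠ 0 ∧ z ≠ 0 then 1 else 0 := by decide
  simp only [hz]
  rw [Finset.sum_boole, Ne, ZMod.natCast_eq_zero_iff_even, Nat.not_even_iff_odd]
  refine iff_of_eq (congrArg Odd ?_)
  rw [← Fintype.card_subtype, ← Nat.card_eq_fintype_card]
  refine Nat.card_congr ⟨fun q => ⟨q.1.1.2.1, ?_⟩, fun b => ⟨⟨(c, b.1, a), b.2⟩, rfl⟩, ?_,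
    fun _ => rfl⟩
  · have h₁ : q.1.1.1 = c := congrArg Prod.fst q.2
    have h₂ : q.1.1.2.2 = a := congrArg Prod.snd q.2
    have h := q.1.2
    rwa [h₁, h₂] at h
  · rintro ⟨⟨⟨c', b, a'⟩, h⟩, h'⟩
    obtain ⟨rfl, rfl⟩ := Prod.ext_iff.1 h'
    rfl

end

end HomeoGroup

/-! ### Disjoint unions and block matrices -/

namespace FinGSet

section

variable {G : Type u} [Group G] [TopologicalSpace G] {ι κ : Type} [Finite ι] [Finite κ]

/-- The disjoint union of a finite family of finitary smooth `G`-sets. -/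
def sigma (X : ι → FinGSet G) : FinGSet G where
  carrier := Σ i, X i
  smooth p := by
    have h : (MulAction.stabilizer G p : Set G) = MulAction.stabilizer G p.2 :=
      Set.ext fun g => ⟨fun h => eq_of_heq (Sigma.ext_iff.1 h).2,
        fun h => Sigma.ext rfl (heq_of_eq h)⟩
    rw [h]
    exact (X p.1).smooth p.2
  finitary := by
    refine Finite.of_surjective (α := Σ i, (X i).Orb) (fun O => Quotient.lift
      (fun x : X O.1 => (Quotient.mk _ ⟨O.1, x⟩ : MulAction.orbitRel.Quotient G (Σ i, X i)))
      (fun x y h => ?_) O.2) ?_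
    · obtain ⟨g, rfl⟩ := MulAction.orbitRel_apply.1 h
      exact Quotient.sound (MulAction.orbitRel_apply.2 ⟨g, rfl⟩)
    · intro O
      obtain ⟨⟨i, x⟩, rfl⟩ := Quotient.exists_rep O
      exact ⟨⟨i, cls x⟩, rfl⟩

/-- The inclusion of a member of the family in the disjoint union. -/
def inj (X : ι → FinGSet G) (i : ι) : X i →[G] sigma X := ⟨fun x => (⟨i, x⟩ : Σ i, X i), fun _ _ => rfl⟩

/-- The index of a point of a disjoint union. -/
def idx {X : ι → FinGSet G} (p : sigma X) : ι := Sigma.fst p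

/-- The underlying point of a point of a disjoint union. -/
def point {X : ι → FinGSet G} (p : sigma X) : X (idx p) := Sigma.snd p

theorem inj_injective (X : ι → FinGSet G) (i : ι) : Function.Injective (inj X i) :=
  fun _ _ h => eq_of_heq (Sigma.ext_iff.1 h).2

/-- The map of disjoint unions given by a map of index sets and maps of the members. -/
def sigmaMap {X : ι → FinGSet G} {Y : κ → FinGSet G} (e : ι → κ) (t : ∀ i, X i →[G] Y (e i)) :
    sigma X →[G] sigma Y :=
  ⟨fun p => inj Y (e (idx p)) (t _ (point p)), fun g p => by
    change inj Y (e (idx p)) (t _ (g • point p)) = _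
    rw [map_smul, map_smul]
    rfl⟩

variable [RoelckePrecompact G] {k : Type v} {X : ι → FinGSet G} {Y : κ → FinGSet G}

/-- The inclusion of a block of a matrix with rows and columns indexed by disjoint unions. -/
def blockIncl (X : ι → FinGSet G) (Y : κ → FinGSet G) (i : ι) (j : κ) :
    (Y j).prod (X i) →[G] (sigma Y).prod (sigma X) :=
  pair ((inj Y j).comp fst) ((inj X i).comp snd)

/-- A block of a matrix. -/
def block (a : InvFun k ((sigma Y).prod (sigma X))) (i : ι) (j : κ) : InvFun k ((Y j).prod (X i)) :=
  pull (blockIncl X Y i j) a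

/-- The matrix with given blocks. -/
def ofBlocks (c : ∀ i j, InvFun k ((Y j).prod (X i))) : InvFun k ((sigma Y).prod (sigma X)) :=
  Quotient.lift (fun p : (sigma Y).prod (sigma X) =>
    c (idx (snd p)) (idx (fst p)) (cls (pr (point (fst p)) (point (snd p))))) fun x p h => by
      obtain ⟨g, rfl⟩ := MulAction.orbitRel_apply.1 h
      exact congrArg (c (idx (snd p)) (idx (fst p)))
        (cls_smul g (pr (point (fst p)) (point (snd p))))

theorem block_ofBlocks (c : ∀ i j, InvFun k ((Y j).prod (X i))) (i : ι) (j : κ) :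
    block (ofBlocks c) i j = c i j :=
  invFun_ext fun _ => rfl

theorem block_ext {a b : InvFun k ((sigma Y).prod (sigma X))} (h : ∀ i j, block a i j = block b i j) :
    a = b :=
  invFun_ext fun p => congrFun (h (idx (snd p)) (idx (fst p)))
    (cls (pr (point (fst p)) (point (snd p))))

end

end FinGSet

namespace GMeasure

open FinGSet

section

variable {G : Type u} [Group G] [TopologicalSpace G] {k : Type v} [CommRing k] (μ : GMeasure G k)

theorem push_sum {ι : Type*} (s : Finset ι) {X Y : FinGSet G} (f : X →[G] Y)
    (a : ι → InvFun k X) : μ.push f (∑ i ∈ s, a i) = ∑ i ∈ s, μ.push f (a i) :=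
  map_sum (AddMonoidHom.mk' (μ.push f) (μ.push_add f)) a s

/-- Push-forward along an injective map is extension by zero, so this decomposes a function into its
restrictions to the members of a partition. -/
theorem sum_push_pull {ι : Type*} [Fintype ι] {X : FinGSet G} {X' : ι → FinGSet G}
    (i : ∀ j, X' j →[G] X) (hi : ∀ j, Function.Injective (i j))
    (hd : ∀ j j' x x', i j x = i j' x' → j = j') (hc : ∀ x, ∃ j x', i j x' = x)
    (a : InvFun k X) : ∑ j, μ.push (i j) (pull (i j) a) = a := by
  refine invFun_ext fun x => ?_
  obtain ⟨j, x', rfl⟩ := hc x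
  rw [Finset.sum_apply, Finset.sum_eq_single j]
  · exact μ.push_injective (i j) (hi j) _ (cls x')
  · intro j' _ hj
    refine Finset.sum_eq_zero fun O _ => if_neg fun hO => hj ?_
    obtain ⟨y, rfl⟩ := cls_surj O
    obtain ⟨g, hg⟩ := cls_eq.1 hO
    exact (hd j j' (g • x') y ((map_smul (i j) g x').trans hg)).symm
  · exact fun h => absurd (Finset.mem_univ j) h

theorem push_eq_sum {ι : Type*} [Fintype ι] {X Y : FinGSet G} {X' : ι → FinGSet G}
    (i : ∀ j, X' j →[G] X) (hi : ∀ j, Function.Injective (i j))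
    (hd : ∀ j j' x x', i j x = i j' x' → j = j') (hc : ∀ x, ∃ j x', i j x' = x)
    (f : X →[G] Y) (a : InvFun k X) :
    μ.push f a = ∑ j, μ.push (f.comp (i j)) (pull (i j) a) := by
  conv_lhs => rw [← μ.sum_push_pull i hi hd hc a, push_sum]
  simp only [push_push]

variable [RoelckePrecompact G]

theorem matMul_zero {X Y Z : FinGSet G} (C : InvFun k (Z.prod Y)) :
    μ.matMul C (0 : InvFun k (Y.prod X)) = 0 := by
  have h := μ.matMul_smul 0 C (0 : InvFun k (Y.prod X))
  rwa [zero_smul, zero_smul] at h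

theorem zero_matMul {X Y Z : FinGSet G} (A : InvFun k (Y.prod X)) :
    μ.matMul (0 : InvFun k (Z.prod Y)) A = 0 := by
  have h := μ.smul_matMul 0 (0 : InvFun k (Z.prod Y)) A
  rwa [zero_smul, zero_smul] at h

/-- Base change restricts the outer indices to one block, and the middle set is then partitioned by
its index `j`. -/
theorem block_matMul {ι κ l : Type} [Finite ι] [Fintype κ] [Finite l] {X : ι → FinGSet G}
    {Y : κ → FinGSet G} {Z : l → FinGSet G} (B : InvFun k ((sigma Z).prod (sigma Y)))
    (A : InvFun k ((sigma Y).prod (sigma X))) (i : ι) (m : l) :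
    block (μ.matMul B A) i m = ∑ j, μ.matMul (block B j m) (block A i j) := by
  have h := μ.push_base_change
    (pair fst (snd.comp snd) : (sigma Z).prod ((sigma Y).prod (sigma X)) →[G] _)
    (blockIncl X Z i m)
    (pair fst (snd.comp snd) : (Z m).prod ((sigma Y).prod (X i)) →[G] (Z m).prod (X i))
    (pair ((inj Z m).comp fst) (pair (fst.comp snd) ((inj X i).comp (snd.comp snd))))
    (fun _ => rfl)
    (fun x y h => ⟨pr (fst y) (pr (fst (snd x)) (snd y)), ⟨prod_ext (fst_eq h :).symm
      (prod_ext rfl (snd_eq h :).symm), rfl⟩, fun z hz => prod_ext (fst_eq hz.2 :)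
        (prod_ext (fst_eq (snd_eq hz.1) :) (snd_eq hz.2 :))⟩)
    (pull (pair fst (fst.comp snd)) B * pull snd A)
  refine h.trans ?_
  rw [μ.push_eq_sum (fun j => (pair fst (pair ((inj Y j).comp (fst.comp snd)) (snd.comp snd)) :
    (Z m).prod ((Y j).prod (X i)) →[G] (Z m).prod ((sigma Y).prod (X i))))]
  · refine Finset.sum_congr rfl fun j _ => ?_
    simp only [pull_mul, pull_pull, matMul, block]
    rfl
  · exact fun j x y h => prod_ext (fst_eq h :) (prod_ext
      (inj_injective Y j (fst_eq (snd_eq h) :)) (snd_eq (snd_eq h) :))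
  · exact fun j j' x x' h => congrArg idx (fst_eq (snd_eq h) :)
  · exact fun x => ⟨idx (fst (snd x)), pr (fst x) (pr (point (fst (snd x))) (snd (snd x))), rfl⟩

end

end GMeasure

/-! ### The functor on the additive envelope of `k[𝒱]` -/

namespace HomeoGroup

open FinGSet

section

variable (𝔛 : Type u) [TopologicalSpace 𝔛] [IsCantorSpace 𝔛] {k : Type v} [Field k]

local notation "𝔾" => HomeoGroup 𝔛

/-- The object of `𝒱` underlying an object of its linearization. -/
def unfree (X : Free k VObj) : VObj := X

/-- The invariant function attached to a linear combination of matrices. -/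
noncomputable def linFn {X Y : Free k VObj} :
    (X ⟶ Y) →ₗ[k] InvFun k ((mapSet 𝔛 (unfree Y).A).prod (mapSet 𝔛 (unfree X).A)) :=
  (Finsupp.linearCombination k (matFn (𝔛 := 𝔛) k) :
    (Matrix (unfree Y).A (unfree X).A (ZMod 2) →₀ k) →ₗ[k] _)

theorem linFn_bas {V W : VObj} (f : V ⟶ W) : linFn 𝔛 (Free.bas k f) = matFn k f :=
  (Finsupp.linearCombination_single k (1 : k) f).trans (one_smul k _)

/-- The `G`-set attached to a formal direct sum of objects `[V(A)]`. -/
def sumSet (M : Mat_ (Free k VObj)) : FinGSet 𝔾 :=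
  sigma fun i => mapSet 𝔛 (unfree (M.X i)).A

/-- The invariant function attached to a matrix of linear combinations of matrices. -/
noncomputable def sumFn {M N : Mat_ (Free k VObj)} (f : M ⟶ N) :
    InvFun k ((sumSet 𝔛 N).prod (sumSet 𝔛 M)) :=
  ofBlocks (X := fun i => mapSet 𝔛 (unfree (M.X i)).A) (Y := fun i => mapSet 𝔛 (unfree (N.X i)).A)
    fun i j => linFn 𝔛 (f i j)

/-- A block of a matrix with rows and columns indexed by formal direct sums. -/
def sumBlock {M N : Mat_ (Free k VObj)} (a : InvFun k ((sumSet 𝔛 N).prod (sumSet 𝔛 M)))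
    (i : M.ι) (j : N.ι) :
    InvFun k ((mapSet 𝔛 (unfree (N.X j)).A).prod (mapSet 𝔛 (unfree (M.X i)).A)) :=
  block (X := fun i => mapSet 𝔛 (unfree (M.X i)).A) (Y := fun i => mapSet 𝔛 (unfree (N.X i)).A) a i j

theorem sumBlock_ext {M N : Mat_ (Free k VObj)} {a b : InvFun k ((sumSet 𝔛 N).prod (sumSet 𝔛 M))}
    (h : ∀ i j, sumBlock 𝔛 a i j = sumBlock 𝔛 b i j) : a = b :=
  block_ext h

theorem sumBlock_sumFn {M N : Mat_ (Free k VObj)} (f : M ⟶ N) (i : M.ι) (j : N.ι) :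
    sumBlock 𝔛 (sumFn 𝔛 f) i j = linFn 𝔛 (f i j) :=
  block_ofBlocks _ i j

variable (k) in
/-- The morphism of the linearization given by a map of bases. -/
noncomputable def basMap {X Y : Free k VObj} (h : (unfree X).A → (unfree Y).A) : X ⟶ Y :=
  Free.bas (C := VObj) k (VObj.ofMap (V := unfree X) (W := unfree Y) h)

theorem linFn_basMap {X Y : Free k VObj} (h : (unfree X).A → (unfree Y).A) :
    linFn 𝔛 (basMap k h : X ⟶ Y) = graph k (mapSetMap 𝔛 h) :=
  (linFn_bas 𝔛 _).trans (matFn_ofMap h)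

theorem id_eq_basMap (X : Free k VObj) : 𝟙 X = basMap k fun a => a :=
  (Free.bas_id (R := k) (unfree X)).symm.trans
    (congrArg (Free.bas (C := VObj) k) (VObj.id_eq_ofMap (unfree X)))

theorem sumFn_ofMap {M N : Mat_ (Free k VObj)} (e : M.ι → N.ι)
    (h : ∀ i, (unfree (M.X i)).A → (unfree (N.X (e i))).A) :
    sumFn 𝔛 (Mat_.ofMap e fun i => basMap k (h i)) =
      graph k (sigmaMap e fun i => mapSetMap 𝔛 (h i) : sumSet 𝔛 M →[𝔾] sumSet 𝔛 N) := by
  classical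
  refine sumBlock_ext 𝔛 fun i j => ?_
  rw [sumBlock_sumFn]
  by_cases hij : e i = j
  · subst hij
    rw [Mat_.ofMap_apply, linFn_basMap]
    refine invFun_ext fun p => ?_
    refine Eq.trans (if_congr ?_ rfl rfl) (GMeasure.graph_cls (k := k) _ _ _).symm
    exact (inj_injective (fun i => mapSet 𝔛 (unfree (N.X i)).A) (e i)).eq_iff.symm
  · rw [Mat_.ofMap_apply_ne _ _ hij, map_zero]
    refine invFun_ext fun p => ?_
    refine Eq.trans (if_neg ?_).symm (GMeasure.graph_cls (k := k) _ _ _).symm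
    exact fun h => hij (congrArg idx h).symm

theorem linFn_surjective (X Y : Free k VObj) :
    Function.Surjective (linFn 𝔛 : (X ⟶ Y) →ₗ[k] _) :=
  linearCombination_matFn_surjective

/-- The functions of the non-zero matrices are independent, so `f` is a multiple of the class of the
zero matrix. The form `f = f ≫ [0]` passes to direct sums entry by entry and shows at once that `f`
dies on objects where `[0]` vanishes. -/
theorem eq_smul_zero_of_linFn {V W : VObj} (f : Free.of k V ⟶ Free.of k W) (hf : linFn 𝔛 f = 0) :
    f = f ≫ Free.bas k (VObj.zeroHom W W) := by
  have key : ∀ c : Matrix W.A V.A (ZMod 2) →₀ k,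
      Finsupp.linearCombination k (matFn (𝔛 := 𝔛) k) c = 0 → c = c 0 • Finsupp.single 0 1 := by
    refine fun c hc => Finsupp.ext fun m => ?_
    rw [Finsupp.smul_single, smul_eq_mul, mul_one, Finsupp.single_apply]
    split_ifs with h
    · rw [h]
    · exact eq_zero_of_linearCombination_matFn hc (Ne.symm h)
  obtain ⟨r, hr⟩ : ∃ r : k, f = r • Free.bas k (VObj.zeroHom V W) := ⟨_, key f hf⟩
  rw [hr, Linear.smul_comp, Free.bas_comp, VObj.comp_zeroHom]

variable [CharZero k]

variable (k) in
/-- The `k`-valued extension of the measure. -/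
noncomputable abbrev scalarMeasure : GMeasure 𝔾 k := (measure 𝔛).map (Rat.castHom k)

/-- Both sides are bilinear, and for classes of matrices the claim is `matFn_mul`. -/
theorem linFn_comp_of {U V W : VObj} (f : Free.of k U ⟶ Free.of k V)
    (g : Free.of k V ⟶ Free.of k W) :
    linFn 𝔛 (f ≫ g) = (scalarMeasure 𝔛 k).matMul (linFn 𝔛 g) (linFn 𝔛 f) := by
  induction f using Free.hom_induction with
  | zero => rw [Limits.zero_comp, map_zero, map_zero, GMeasure.matMul_zero]
  | add f g hf hg => rw [Preadditive.add_comp, map_add, map_add, hf, hg, GMeasure.matMul_add]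
  | smul r f =>
  induction g using Free.hom_induction with
  | zero => rw [Limits.comp_zero, map_zero, map_zero, GMeasure.zero_matMul]
  | add f g hf hg => rw [Preadditive.comp_add, map_add, map_add, hf, hg, GMeasure.add_matMul]
  | smul s g =>
  rw [Linear.comp_smul, Linear.smul_comp, Free.bas_comp]
  simp only [map_smul, linFn_bas]
  refine Eq.trans ?_ ((GMeasure.smul_matMul _ s _ _).trans
    (congrArg (s • ·) (GMeasure.matMul_smul _ r _ _))).symm
  exact congrArg (s • ·) (congrArg (r • ·) (matFn_mul _ _).symm)

theorem linFn_comp {X Y Z : Free k VObj} (f : X ⟶ Y) (g : Y ⟶ Z) :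
    linFn 𝔛 (f ≫ g) = (scalarMeasure 𝔛 k).matMul (linFn 𝔛 g) (linFn 𝔛 f) :=
  linFn_comp_of 𝔛 (U := unfree X) (V := unfree Y) (W := unfree Z) f g

variable (k) in
/-- The functor from the additive envelope of `k[𝒱]` to the category of permutation modules that
maps `[V(A)]` to `Vec_{Y(A)}` and the class of a matrix to its invariant function. -/
noncomputable def sumFunctor : Mat_ (Free k VObj) ⥤ PermObj (scalarMeasure 𝔛 k) where
  obj M := ⟨sumSet 𝔛 M⟩
  map f := sumFn 𝔛 f
  map_id M := by
    rw [Mat_.id_eq_ofMap]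
    simp only [id_eq_basMap]
    exact sumFn_ofMap 𝔛 (M := M) (N := M) (fun i => i) fun i a => a
  map_comp {L M N} f g := by
    refine sumBlock_ext 𝔛 fun i j => (sumBlock_sumFn 𝔛 _ i j).trans ?_
    refine Eq.trans ?_ (GMeasure.block_matMul (scalarMeasure 𝔛 k) (sumFn 𝔛 g) (sumFn 𝔛 f) i j).symm
    rw [Mat_.comp_apply, map_sum]
    refine Finset.sum_congr rfl fun m _ => (linFn_comp 𝔛 _ _).trans ?_
    exact congrArg₂ (GMeasure.matMul _) (sumBlock_sumFn 𝔛 g m j).symm (sumBlock_sumFn 𝔛 f i m).symm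

instance : (sumFunctor 𝔛 k).Additive where
  map_add {_ _ f g} := sumBlock_ext 𝔛 fun i j => (sumBlock_sumFn 𝔛 _ i j).trans
    ((map_add (linFn 𝔛) (f i j) (g i j)).trans
      (congrArg₂ (· + ·) (sumBlock_sumFn 𝔛 f i j).symm (sumBlock_sumFn 𝔛 g i j).symm))

instance : (sumFunctor 𝔛 k).Linear k where
  map_smul f r := sumBlock_ext 𝔛 fun i j => (sumBlock_sumFn 𝔛 _ i j).trans
    ((map_smul (linFn 𝔛) r (f i j)).trans (congrArg (r • ·) (sumBlock_sumFn 𝔛 f i j).symm))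

theorem sumFunctor_map_zeroMat (M : Mat_ (Free k VObj)) : (sumFunctor 𝔛 k).map (zeroMat M) = 0 := by
  refine sumBlock_ext 𝔛 fun i j => (sumBlock_sumFn 𝔛 _ i j).trans ?_
  change linFn 𝔛 (zeroMat M i j) = 0
  by_cases hij : i = j
  · subst hij
    have h : zeroMat M i i = zeroFree (M.X i) := Mat_.ofMap_apply (M := M) (N := M) (fun i => i) _ i
    rw [h]
    exact (linFn_bas 𝔛 (VObj.zeroHom (unfree (M.X i)) (unfree (M.X i)))).trans matFn_zero
  · have h : zeroMat M i j = 0 := Mat_.ofMap_apply_ne (M := M) (N := M) (fun i => i) _ hij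
    rw [h, map_zero]

instance : (sumFunctor 𝔛 k).Full where
  map_surjective {M N} a := by
    choose f hf using fun i j => linFn_surjective 𝔛 (M.X i) (N.X j)
      (sumBlock 𝔛 (M := M) (N := N) a i j)
    exact ⟨f, sumBlock_ext 𝔛 fun i j => (sumBlock_sumFn 𝔛 (M := M) (N := N) f i j).trans (hf i j)⟩

/-- A morphism which is mapped to zero is a multiple of `[0]`. -/
theorem eq_comp_zeroMat {M N : Mat_ (Free k VObj)} (f : M ⟶ N) (hf : (sumFunctor 𝔛 k).map f = 0) :
    f = f ≫ zeroMat N := by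
  ext i j
  refine Eq.trans ?_ (Mat_.comp_ofMap (M := N) (N := N) (fun i => i) (fun _ _ h => h)
    (fun i => zeroFree (N.X i)) f i j).symm
  refine eq_smul_zero_of_linFn 𝔛 (V := unfree (M.X i)) (W := unfree (N.X j)) (f i j) ?_
  exact (sumBlock_sumFn 𝔛 f i j).symm.trans (congrArg (sumBlock 𝔛 · i j) hf)

end

end HomeoGroup

/-! ### The tensor structure of the functor -/

namespace PermObj

open FinGSet

section

variable {G : Type u} [Group G] [TopologicalSpace G] [RoelckePrecompact G]
variable {k : Type v} [CommRing k] {μ : GMeasure G k}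

/-- This and the next two lemmas collapse a side of a coherence diagram into the morphism of a
single map of `G`-sets. -/
theorem tensHom_ofMap_comp {X X' Y Y' Z : PermObj μ} (a : X.set →[G] Y.set) (b : X'.set →[G] Y'.set)
    (c : Y.set.prod Y'.set →[G] Z.set) :
    tensHom (ofMap a) (ofMap b) ≫ ofMap (X := tensObj Y Y') (Y := Z) c =
      ofMap (X := tensObj X X') (Y := Z) (c.comp (pair (a.comp fst) (b.comp snd))) := by
  rw [tensHom_ofMap]
  exact ofMap_comp_ofMap (X := tensObj X X') (Y := tensObj Y Y') _ c

theorem tensHom_ofMap_comp_comp {X X' Y Y' Z W : PermObj μ} (a : X.set →[G] Y.set)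
    (b : X'.set →[G] Y'.set) (c : Y.set.prod Y'.set →[G] Z.set) (d : Z.set →[G] W.set) :
    tensHom (ofMap a) (ofMap b) ≫ ofMap (X := tensObj Y Y') (Y := Z) c ≫ ofMap d =
      ofMap (X := tensObj X X') (Y := W)
        (d.comp (c.comp (pair (a.comp fst) (b.comp snd)))) := by
  rw [← Category.assoc, tensHom_ofMap_comp]
  exact ofMap_comp_ofMap (X := tensObj X X') _ d

theorem ofMap_comp_tensHom_comp {X X' Y Y' Z W : PermObj μ} (a : X.set →[G] Y.set)
    (b : X'.set →[G] Y'.set) (c : Y.set.prod Y'.set →[G] Z.set)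
    (d : W.set →[G] X.set.prod X'.set) :
    ofMap (Y := tensObj X X') d ≫ tensHom (ofMap a) (ofMap b) ≫ ofMap (X := tensObj Y Y') c =
      ofMap (X := W) (Y := Z) ((c.comp (pair (a.comp fst) (b.comp snd))).comp d) := by
  rw [tensHom_ofMap_comp]
  exact ofMap_comp_ofMap (Y := tensObj X X') d _

end

end PermObj

namespace HomeoGroup

open FinGSet

section

variable (𝔛 : Type u) [TopologicalSpace 𝔛] [IsCantorSpace 𝔛] {k : Type v} [Field k]

local notation "𝔾" => HomeoGroup 𝔛

/-- Both sides are bilinear, and for classes of matrices the claim is `matFn_kronecker`. -/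
theorem linFn_tens_of {V W V' W' : VObj} (f : Free.of k V ⟶ Free.of k W)
    (g : Free.of k V' ⟶ Free.of k W') (ψ : (mapSet 𝔛 W.A).prod (mapSet 𝔛 W'.A))
    (φ : (mapSet 𝔛 V.A).prod (mapSet 𝔛 V'.A)) :
    linFn 𝔛 (Free.tens f g) (cls (pr (pairMap W.A W'.A ψ) (pairMap V.A V'.A φ))) =
      linFn 𝔛 f (cls (pr (fst ψ) (fst φ))) * linFn 𝔛 g (cls (pr (snd ψ) (snd φ))) := by
  induction f using Free.hom_induction with
  | zero =>
    rw [LinearMap.map_zero₂, map_zero, map_zero]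
    exact (zero_mul _).symm
  | add f₁ f₂ h₁ h₂ =>
    rw [LinearMap.map_add₂, map_add, map_add]
    exact (congrArg₂ (· + ·) h₁ h₂).trans (add_mul _ _ _).symm
  | smul r f =>
  induction g using Free.hom_induction with
  | zero =>
    rw [map_zero, map_zero, map_zero]
    exact (mul_zero _).symm
  | add g₁ g₂ h₁ h₂ =>
    rw [map_add, map_add, map_add]
    exact (congrArg₂ (· + ·) h₁ h₂).trans (mul_add _ _ _).symm
  | smul s g =>
  have e₁ : linFn 𝔛 (Free.tens (r • Free.bas k f) (s • Free.bas k g)) =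
      r • s • matFn (𝔛 := 𝔛) k (f ⊗ₘ g) := by
    rw [LinearMap.map_smul₂, map_smul, map_smul, map_smul, Free.tens_bas, linFn_bas]
    rfl
  have e₂ : linFn 𝔛 (r • Free.bas k f) = r • matFn (𝔛 := 𝔛) k f := by
    rw [map_smul, linFn_bas]
    rfl
  have e₃ : linFn 𝔛 (s • Free.bas k g) = s • matFn (𝔛 := 𝔛) k g := by
    rw [map_smul, linFn_bas]
    rfl
  refine (congrFun e₁ _).trans (Eq.trans ?_
    (congrArg₂ (· * ·) (congrFun e₂ (cls (pr (fst ψ) (fst φ))))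
      (congrFun e₃ (cls (pr (snd ψ) (snd φ))))).symm)
  have h := matFn_kronecker (k := k) (𝔛 := 𝔛) f g ψ φ
  refine (congrArg (fun z => r * (s * z)) h).trans ?_
  exact (mul_assoc r s _).symm.trans (mul_mul_mul_comm _ _ _ _)

theorem linFn_tens {X Y X' Y' : Free k VObj} (f : X ⟶ Y) (g : X' ⟶ Y')
    (ψ : (mapSet 𝔛 (unfree Y).A).prod (mapSet 𝔛 (unfree Y').A))
    (φ : (mapSet 𝔛 (unfree X).A).prod (mapSet 𝔛 (unfree X').A)) :
    linFn 𝔛 (f ⊗ₘ g) (cls (pr (pairMap (unfree Y).A (unfree Y').A ψ)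
      (pairMap (unfree X).A (unfree X').A φ))) =
      linFn 𝔛 f (cls (pr (fst ψ) (fst φ))) * linFn 𝔛 g (cls (pr (snd ψ) (snd φ))) :=
  linFn_tens_of 𝔛 (V := unfree X) (W := unfree Y) (V' := unfree X') (W' := unfree Y') f g ψ φ

/-- The bijection between the product of two disjoint unions of the `Y(A)` and the disjoint union
attached to the tensor product. -/
noncomputable def sumProd (M N : Mat_ (Free k VObj)) : (sumSet 𝔛 M).prod (sumSet 𝔛 N) →[𝔾] sumSet 𝔛 (M ⊗ N) :=
  ⟨fun p => inj (fun i => mapSet 𝔛 (unfree ((M ⊗ N).X i)).A) (idx (fst p), idx (snd p))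
    (pairMap (unfree (M.X (idx (fst p)))).A (unfree (N.X (idx (snd p)))).A
      (pr (point (fst p)) (point (snd p)))), fun _ _ => rfl⟩

/-- The inverse bijection. -/
noncomputable def sumProdInv (M N : Mat_ (Free k VObj)) :
    sumSet 𝔛 (M ⊗ N) →[𝔾] (sumSet 𝔛 M).prod (sumSet 𝔛 N) :=
  pair (sigmaMap (fun i : M.ι × N.ι => i.1) fun _ => mapSetMap 𝔛 Prod.fst)
    (sigmaMap (fun i : M.ι × N.ι => i.2) fun _ => mapSetMap 𝔛 Prod.snd)

variable (k) in
/-- The map from the one-point set to the set attached to the unit object. -/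
noncomputable def sumUnit : (pt : FinGSet 𝔾) →[𝔾] sumSet 𝔛 (𝟙_ (Mat_ (Free k VObj))) :=
  ⟨fun _ => inj (fun i => mapSet 𝔛 (unfree ((𝟙_ (Mat_ (Free k VObj))).X i)).A) PUnit.unit
    (LocallyConstant.const 𝔛 PUnit.unit), fun _ _ => rfl⟩

variable [CharZero k]

theorem sumFunctor_map_ofMap {M N : Mat_ (Free k VObj)} (e : M.ι → N.ι)
    (h : ∀ i, (unfree (M.X i)).A → (unfree (N.X (e i))).A) :
    (sumFunctor 𝔛 k).map (Mat_.ofMap e fun i => basMap k (h i)) =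
      PermObj.ofMap (X := (sumFunctor 𝔛 k).obj M) (Y := (sumFunctor 𝔛 k).obj N)
        (sigmaMap e fun i => mapSetMap 𝔛 (h i)) :=
  sumFn_ofMap 𝔛 e h

theorem sumProd_natural {M N M' N' : Mat_ (Free k VObj)} (f : M ⟶ N) (g : M' ⟶ N') :
    PermObj.tensHom ((sumFunctor 𝔛 k).map f) ((sumFunctor 𝔛 k).map g) ≫
      PermObj.ofMap (X := PermObj.tensObj ((sumFunctor 𝔛 k).obj N) ((sumFunctor 𝔛 k).obj N'))
        (Y := (sumFunctor 𝔛 k).obj (N ⊗ N')) (sumProd 𝔛 N N') =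
    PermObj.ofMap (X := PermObj.tensObj ((sumFunctor 𝔛 k).obj M) ((sumFunctor 𝔛 k).obj M'))
        (Y := (sumFunctor 𝔛 k).obj (M ⊗ M')) (sumProd 𝔛 M M') ≫ (sumFunctor 𝔛 k).map (f ⊗ₘ g) := by
  refine PermObj.ofMap_natural
    (X := PermObj.tensObj ((sumFunctor 𝔛 k).obj M) ((sumFunctor 𝔛 k).obj M'))
    (Y := PermObj.tensObj ((sumFunctor 𝔛 k).obj N) ((sumFunctor 𝔛 k).obj N'))
    (Y' := (sumFunctor 𝔛 k).obj (N ⊗ N')) (X' := (sumFunctor 𝔛 k).obj (M ⊗ M')) _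
    (Function.bijective_iff_has_inverse.2 ⟨sumProdInv 𝔛 N N', fun _ => rfl, fun _ => rfl⟩) _ _ _
    fun y x => ?_
  exact (linFn_tens 𝔛 (f (idx (fst x)) (idx (fst y))) (g (idx (snd x)) (idx (snd y)))
    (pr (point (fst y)) (point (snd y))) (pr (point (fst x)) (point (snd x)))).symm

variable (k) in
/-- The tensor structure of the functor. -/
noncomputable def sumCore : (sumFunctor 𝔛 k).CoreMonoidal where
  εIso := PermObj.isoOfMaps (X := PermObj.tensUnit) (Y := (sumFunctor 𝔛 k).obj (𝟙_ _))
    (sumUnit 𝔛 k) (toPt _) (fun _ => rfl) (fun _ => rfl)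
  μIso M N := PermObj.isoOfMaps
    (X := PermObj.tensObj ((sumFunctor 𝔛 k).obj M) ((sumFunctor 𝔛 k).obj N))
    (Y := (sumFunctor 𝔛 k).obj (M ⊗ N)) (sumProd 𝔛 M N) (sumProdInv 𝔛 M N) (fun _ => rfl)
    (fun _ => rfl)
  μIso_hom_natural_left f M' := (congrArg (fun z => PermObj.tensHom ((sumFunctor 𝔛 k).map f) z ≫ _)
    ((sumFunctor 𝔛 k).map_id M').symm).trans (sumProd_natural 𝔛 f (𝟙 M'))
  μIso_hom_natural_right M' f := (congrArg (fun z => PermObj.tensHom z ((sumFunctor 𝔛 k).map f) ≫ _)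
    ((sumFunctor 𝔛 k).map_id M').symm).trans (sumProd_natural 𝔛 (𝟙 M') f)
  -- All arrows of the coherence diagrams come from maps of `G`-sets, so each diagram reduces to an
  -- equality of two such maps, which holds by definition at every point.
  associativity L M N := by
    refine (congrArg (fun z => _ ≫ _ ≫ z) (sumFunctor_map_ofMap 𝔛 (k := k)
      (M := (L ⊗ M) ⊗ N) (N := L ⊗ (M ⊗ N)) (fun i => (i.1.1, (i.1.2, i.2)))
      fun i => Equiv.prodAssoc _ _ _)).trans ?_
    refine (PermObj.tensHom_ofMap_comp_comp
      (X := PermObj.tensObj ((sumFunctor 𝔛 k).obj L) ((sumFunctor 𝔛 k).obj M))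
      (X' := (sumFunctor 𝔛 k).obj N) (Y := (sumFunctor 𝔛 k).obj (L ⊗ M))
      (Y' := (sumFunctor 𝔛 k).obj N) (Z := (sumFunctor 𝔛 k).obj ((L ⊗ M) ⊗ N))
      (W := (sumFunctor 𝔛 k).obj (L ⊗ (M ⊗ N)))
      (sumProd 𝔛 L M) (MulActionHom.id 𝔾) (sumProd 𝔛 (L ⊗ M) N) _).trans (Eq.trans ?_
      (PermObj.ofMap_comp_tensHom_comp
      (X := (sumFunctor 𝔛 k).obj L)
      (X' := PermObj.tensObj ((sumFunctor 𝔛 k).obj M) ((sumFunctor 𝔛 k).obj N))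
      (Y := (sumFunctor 𝔛 k).obj L)
      (Y' := (sumFunctor 𝔛 k).obj (M ⊗ N)) (Z := (sumFunctor 𝔛 k).obj (L ⊗ (M ⊗ N)))
      (MulActionHom.id 𝔾) (sumProd 𝔛 M N) (sumProd 𝔛 L (M ⊗ N))
      (PermObj.assocMap (sumSet 𝔛 L) (sumSet 𝔛 M) (sumSet 𝔛 N))).symm)
    exact congrArg PermObj.ofMap (MulActionHom.ext fun _ => rfl)
  left_unitality M := by
    refine Eq.symm ((congrArg (fun z => _ ≫ _ ≫ z) (sumFunctor_map_ofMap 𝔛 (k := k)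
      (M := 𝟙_ _ ⊗ M) (N := M) (fun i => i.2) fun i => Equiv.punitProd _)).trans ?_)
    refine (PermObj.tensHom_ofMap_comp_comp (X := PermObj.tensUnit) (X' := (sumFunctor 𝔛 k).obj M)
      (Y := (sumFunctor 𝔛 k).obj (𝟙_ _)) (Y' := (sumFunctor 𝔛 k).obj M)
      (Z := (sumFunctor 𝔛 k).obj (𝟙_ _ ⊗ M)) (W := (sumFunctor 𝔛 k).obj M)
      (sumUnit 𝔛 k) (MulActionHom.id 𝔾) (sumProd 𝔛 (𝟙_ _) M) _).trans ?_
    exact congrArg PermObj.ofMap (MulActionHom.ext fun _ => rfl)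
  right_unitality M := by
    refine Eq.symm ((congrArg (fun z => _ ≫ _ ≫ z) (sumFunctor_map_ofMap 𝔛 (k := k)
      (M := M ⊗ 𝟙_ _) (N := M) (fun i => i.1) fun i => Equiv.prodPUnit _)).trans ?_)
    refine (PermObj.tensHom_ofMap_comp_comp (X := (sumFunctor 𝔛 k).obj M) (X' := PermObj.tensUnit)
      (Y := (sumFunctor 𝔛 k).obj M) (Y' := (sumFunctor 𝔛 k).obj (𝟙_ _))
      (Z := (sumFunctor 𝔛 k).obj (M ⊗ 𝟙_ _)) (W := (sumFunctor 𝔛 k).obj M)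
      (MulActionHom.id 𝔾) (sumUnit 𝔛 k) (sumProd 𝔛 M (𝟙_ _)) _).trans ?_
    exact congrArg PermObj.ofMap (MulActionHom.ext fun _ => rfl)

noncomputable instance : (sumFunctor 𝔛 k).Monoidal := (sumCore 𝔛 k).toMonoidal

noncomputable instance : (sumFunctor 𝔛 k).Braided where
  braided M N := by
    refine (congrArg (fun z => _ ≫ z) (sumFunctor_map_ofMap 𝔛 (k := k)
      (M := M ⊗ N) (N := N ⊗ M) (fun i => (i.2, i.1)) fun i => Equiv.prodComm _ _)).trans ?_
    refine (PermObj.ofMap_comp_ofMap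
      (X := PermObj.tensObj ((sumFunctor 𝔛 k).obj M) ((sumFunctor 𝔛 k).obj N))
      (Y := (sumFunctor 𝔛 k).obj (M ⊗ N)) (Z := (sumFunctor 𝔛 k).obj (N ⊗ M))
      (sumProd 𝔛 M N) _).trans (Eq.trans ?_ (PermObj.ofMap_comp_ofMap
      (X := PermObj.tensObj ((sumFunctor 𝔛 k).obj M) ((sumFunctor 𝔛 k).obj N))
      (Y := PermObj.tensObj ((sumFunctor 𝔛 k).obj N) ((sumFunctor 𝔛 k).obj M))
      (Z := (sumFunctor 𝔛 k).obj (N ⊗ M))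
      (PermObj.swapMap (sumSet 𝔛 M) (sumSet 𝔛 N)) (sumProd 𝔛 N M)).symm)
    exact congrArg PermObj.ofMap (MulActionHom.ext fun _ => rfl)

end

end HomeoGroup

/-! ### Monoidal functors between Karoubi envelopes -/

namespace CategoryTheory.Idempotents.Karoubi

open Functor.LaxMonoidal Functor.OplaxMonoidal Functor.Monoidal

section

variable {C D : Type*} [Category* C] [Category* D]

/-- The functor between Karoubi envelopes induced by a functor. -/
def mapFunctor (F : C ⥤ D) : Karoubi C ⥤ Karoubi D where
  obj P := ⟨F.obj P.X, F.map P.p, by rw [← F.map_comp, P.idem]⟩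
  map f := ⟨F.map f.f, by
    change F.map _ ≫ F.map f.f ≫ F.map _ = F.map f.f
    rw [← F.map_comp, ← F.map_comp, f.comm]⟩
  map_id P := rfl
  map_comp f g := hom_ext _ _ (F.map_comp f.f g.f)

variable [MonoidalCategory C] (F : C ⥤ D)

theorem map_p_tens_idem (P Q : Karoubi C) :
    F.map (P.p ⊗ₘ Q.p) ≫ F.map (P.p ⊗ₘ Q.p) = F.map (P.p ⊗ₘ Q.p) := by
  rw [← F.map_comp, tensorHom_comp_tensorHom, P.idem, Q.idem]

variable [MonoidalCategory D] [F.Monoidal]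

theorem map_p_tens_μ (P Q : Karoubi C) :
    (F.map P.p ⊗ₘ F.map Q.p) ≫ μ F P.X Q.X = μ F P.X Q.X ≫ F.map (P.p ⊗ₘ Q.p) :=
  μ_natural F P.p Q.p

theorem δ_map_p_tens (P Q : Karoubi C) :
    δ F P.X Q.X ≫ (F.map P.p ⊗ₘ F.map Q.p) = F.map (P.p ⊗ₘ Q.p) ≫ δ F P.X Q.X :=
  δ_natural F P.p Q.p

/-- The tensor structure on the functor between Karoubi envelopes induced by a monoidal functor. -/
def mapCore : (mapFunctor F).CoreMonoidal where
  εIso :=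
    { hom := ⟨ε F, by
        change 𝟙 _ ≫ ε F ≫ F.map (𝟙 _) = _
        simp⟩
      inv := ⟨η F, by
        change F.map (𝟙 _) ≫ η F ≫ 𝟙 _ = _
        simp⟩
      hom_inv_id := hom_ext _ _ (ε_η F)
      inv_hom_id := hom_ext _ _ ((η_ε F).trans (F.map_id _).symm) }
  -- Morphisms of the envelope must absorb the idempotents, so `μ` and `δ` are cut down by the image
  -- of `P.p ⊗ₘ Q.p`; by naturality it can be moved to either side.
  μIso P Q :=
    { hom := ⟨μ F P.X Q.X ≫ F.map (P.p ⊗ₘ Q.p), by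
        change (F.map P.p ⊗ₘ F.map Q.p) ≫ (_ ≫ _) ≫ F.map (P.p ⊗ₘ Q.p) = _
        rw [Category.assoc, map_p_tens_idem, ← Category.assoc, map_p_tens_μ, Category.assoc,
          map_p_tens_idem]
        rfl⟩
      inv := ⟨F.map (P.p ⊗ₘ Q.p) ≫ δ F P.X Q.X, by
        change F.map (P.p ⊗ₘ Q.p) ≫ (_ ≫ _) ≫ (F.map P.p ⊗ₘ F.map Q.p) = _
        rw [Category.assoc, δ_map_p_tens, reassoc_of% (map_p_tens_idem F P Q),
          reassoc_of% (map_p_tens_idem F P Q)]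
        rfl⟩
      hom_inv_id := hom_ext _ _ (by
        change (μ F P.X Q.X ≫ F.map (P.p ⊗ₘ Q.p)) ≫ F.map (P.p ⊗ₘ Q.p) ≫ δ F P.X Q.X =
          F.map P.p ⊗ₘ F.map Q.p
        rw [Category.assoc, ← Category.assoc (F.map _), map_p_tens_idem, ← δ_map_p_tens, μ_δ_assoc])
      inv_hom_id := hom_ext _ _ (by
        change (F.map (P.p ⊗ₘ Q.p) ≫ δ F P.X Q.X) ≫ μ F P.X Q.X ≫ F.map (P.p ⊗ₘ Q.p) =
          F.map (P.p ⊗ₘ Q.p)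
        rw [Category.assoc, δ_μ_assoc, map_p_tens_idem]) }
  μIso_hom_natural_left {P Q} f R := hom_ext _ _ (by
    change (F.map f.f ⊗ₘ F.map R.p) ≫ μ F Q.X R.X ≫ F.map (Q.p ⊗ₘ R.p) =
      (μ F P.X R.X ≫ F.map (P.p ⊗ₘ R.p)) ≫ F.map (f.f ⊗ₘ R.p)
    rw [μ_natural_assoc, Category.assoc, ← F.map_comp, ← F.map_comp, tensorHom_comp_tensorHom,
      tensorHom_comp_tensorHom, comp_p, p_comp])
  μIso_hom_natural_right {P Q} R f := hom_ext _ _ (by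
    change (F.map R.p ⊗ₘ F.map f.f) ≫ μ F R.X Q.X ≫ F.map (R.p ⊗ₘ Q.p) =
      (μ F R.X P.X ≫ F.map (R.p ⊗ₘ P.p)) ≫ F.map (R.p ⊗ₘ f.f)
    rw [μ_natural_assoc, Category.assoc, ← F.map_comp, ← F.map_comp, tensorHom_comp_tensorHom,
      tensorHom_comp_tensorHom, comp_p, p_comp])
  associativity P Q R := hom_ext _ _ (by
    change ((μ F P.X Q.X ≫ F.map (P.p ⊗ₘ Q.p)) ⊗ₘ F.map R.p) ≫
      (μ F (P.X ⊗ Q.X) R.X ≫ F.map ((P.p ⊗ₘ Q.p) ⊗ₘ R.p)) ≫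
        F.map ((α_ P.X Q.X R.X).hom ≫ (P.p ⊗ₘ (Q.p ⊗ₘ R.p))) =
      ((α_ _ _ _).hom ≫ (F.map P.p ⊗ₘ (F.map Q.p ⊗ₘ F.map R.p))) ≫
        (F.map P.p ⊗ₘ (μ F Q.X R.X ≫ F.map (Q.p ⊗ₘ R.p))) ≫
          μ F P.X (Q.X ⊗ R.X) ≫ F.map (P.p ⊗ₘ (Q.p ⊗ₘ R.p))
    have h₁ : (μ F P.X Q.X ≫ F.map (P.p ⊗ₘ Q.p)) ⊗ₘ F.map R.p =
        μ F P.X Q.X ▷ _ ≫ (F.map (P.p ⊗ₘ Q.p) ⊗ₘ F.map R.p) := by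
      rw [← tensorHom_id, tensorHom_comp_tensorHom, Category.id_comp]
    have h₂ : F.map P.p ⊗ₘ (μ F Q.X R.X ≫ F.map (Q.p ⊗ₘ R.p)) =
        F.obj P.X ◁ μ F Q.X R.X ≫ (F.map P.p ⊗ₘ F.map (Q.p ⊗ₘ R.p)) := by
      rw [← id_tensorHom, tensorHom_comp_tensorHom, Category.id_comp]
    have h₃ : (F.map P.p ⊗ₘ (F.map Q.p ⊗ₘ F.map R.p)) ≫ (F.obj P.X ◁ μ F Q.X R.X) =
        F.obj P.X ◁ μ F Q.X R.X ≫ (F.map P.p ⊗ₘ F.map (Q.p ⊗ₘ R.p)) := by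
      rw [← id_tensorHom, tensorHom_comp_tensorHom, tensorHom_comp_tensorHom, μ_natural,
        Category.id_comp, Category.comp_id]
    rw [h₁, h₂]
    simp only [Category.assoc, μ_natural_assoc, ← F.map_comp, reassoc_of% h₃,
      tensorHom_comp_tensorHom, associator_naturality_assoc, idem]
    simp only [F.map_comp, Functor.LaxMonoidal.associativity_assoc])
  left_unitality P := hom_ext _ _ (by
    change (λ_ _).hom ≫ F.map P.p = (ε F ⊗ₘ F.map P.p) ≫
      (μ F (𝟙_ C) P.X ≫ F.map (𝟙 _ ⊗ₘ P.p)) ≫ F.map ((λ_ P.X).hom ≫ P.p)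
    have h : ε F ⊗ₘ F.map P.p = ε F ▷ _ ≫ F.obj (𝟙_ C) ◁ F.map P.p := by
      rw [← tensorHom_id, ← id_tensorHom, tensorHom_comp_tensorHom, Category.id_comp,
        Category.comp_id]
    rw [h, id_tensorHom, Functor.LaxMonoidal.left_unitality]
    simp only [Category.assoc, Functor.LaxMonoidal.μ_natural_right_assoc, ← F.map_comp]
    simp)
  right_unitality P := hom_ext _ _ (by
    change (ρ_ _).hom ≫ F.map P.p = (F.map P.p ⊗ₘ ε F) ≫
      (μ F P.X (𝟙_ C) ≫ F.map (P.p ⊗ₘ 𝟙 _)) ≫ F.map ((ρ_ P.X).hom ≫ P.p)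
    have h : F.map P.p ⊗ₘ ε F = _ ◁ ε F ≫ F.map P.p ▷ F.obj (𝟙_ C) := by
      rw [← tensorHom_id, ← id_tensorHom, tensorHom_comp_tensorHom, Category.id_comp,
        Category.comp_id]
    rw [h, tensorHom_id, Functor.LaxMonoidal.right_unitality]
    simp only [Category.assoc, Functor.LaxMonoidal.μ_natural_left_assoc, ← F.map_comp]
    simp)

instance : (mapFunctor F).Monoidal := (mapCore F).toMonoidal

end

section

variable {C D : Type*} [Category* C] [Category* D] [MonoidalCategory C] [MonoidalCategory D]
  [SymmetricCategory C] [SymmetricCategory D] (F : C ⥤ D) [F.Braided]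

instance : (mapFunctor F).Braided where
  braided P Q := hom_ext _ _ (by
    change (μ F P.X Q.X ≫ F.map (P.p ⊗ₘ Q.p)) ≫ F.map ((β_ P.X Q.X).hom ≫ (Q.p ⊗ₘ P.p)) =
      ((β_ _ _).hom ≫ (F.map Q.p ⊗ₘ F.map P.p)) ≫ μ F Q.X P.X ≫ F.map (Q.p ⊗ₘ P.p)
    rw [Category.assoc, Category.assoc, ← F.map_comp, BraidedCategory.braiding_naturality_assoc,
      tensorHom_comp_tensorHom, Q.idem, P.idem, μ_natural_assoc, map_p_tens_idem, F.map_comp,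
      Functor.LaxBraided.braided_assoc])

end

section

variable {C D : Type*} [Category* C] [Category* D] [Preadditive C] [Preadditive D] (F : C ⥤ D)

instance [F.Additive] : (mapFunctor F).Additive where
  map_add := hom_ext _ _ F.map_add

instance (R : Type*) [Semiring R] [Linear R C] [Linear R D] [F.Linear R] :
    (mapFunctor F).Linear R where
  map_smul f r := hom_ext _ _ (F.map_smul r f.f)

end

end CategoryTheory.Idempotents.Karoubi

/-! ### Restriction to a subcategory with its own unit -/

namespace TensorCorner

section

variable {D E : Type*} [Category* D] [Category* E] [MonoidalCategory D] [MonoidalCategory E]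
  {P : ObjectProperty D} (T : TensorCorner P) (K : D ⥤ E) [K.Monoidal]
  (hK : K.map (T.proj ≫ T.incl) = 𝟙 _)

open Functor.LaxMonoidal Functor.OplaxMonoidal Functor.Monoidal

/-- A monoidal functor that maps the new unit object isomorphically to the unit object restricts to
a monoidal functor on the subcategory. -/
def restrictCore :
    letI := T.monoidal
    (P.ι ⋙ K).CoreMonoidal :=
  letI := T.monoidal
  -- The new unit is only a direct factor of the ambient one, but `hK` says that `K` makes the
  -- complementary factor vanish, so `K` maps it isomorphically to the image of the ambient unit.
  { εIso :=
      { hom := ε K ≫ K.map T.proj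
        inv := K.map T.incl ≫ η K
        hom_inv_id := by rw [Category.assoc, ← K.map_comp_assoc, hK, Category.id_comp, ε_η]
        inv_hom_id := by
          rw [Category.assoc, η_ε_assoc, ← K.map_comp, T.incl_proj]
          exact K.map_id _ }
    μIso := fun X Y => μIso K X.obj Y.obj
    μIso_hom_natural_left := fun f Z => μ_natural_left K f.hom Z.obj
    μIso_hom_natural_right := fun Z f => μ_natural_right K Z.obj f.hom
    associativity := fun X Y Z => Functor.LaxMonoidal.associativity K X.obj Y.obj Z.obj
    left_unitality := fun X => by
      change (λ_ (K.obj X.obj)).hom = (ε K ≫ K.map T.proj) ▷ K.obj X.obj ≫ μ K T.one X.obj ≫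
        K.map (T.incl ▷ X.obj ≫ (λ_ X.obj).hom)
      rw [comp_whiskerRight, Category.assoc, μ_natural_left_assoc, ← K.map_comp,
        ← comp_whiskerRight_assoc, T.left X.obj X.property, Category.id_comp,
        Functor.LaxMonoidal.left_unitality]
    right_unitality := fun X => by
      change (ρ_ (K.obj X.obj)).hom = K.obj X.obj ◁ (ε K ≫ K.map T.proj) ≫ μ K X.obj T.one ≫
        K.map (X.obj ◁ T.incl ≫ (ρ_ X.obj).hom)
      rw [whiskerLeft_comp, Category.assoc, μ_natural_right_assoc, ← K.map_comp,
        ← whiskerLeft_comp_assoc, T.right X.obj X.property, Category.id_comp,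
        Functor.LaxMonoidal.right_unitality] }

end

section

variable {D E : Type*} [Category* D] [Category* E] [MonoidalCategory D] [MonoidalCategory E]
  [SymmetricCategory D] [SymmetricCategory E]
  {P : ObjectProperty D} (T : TensorCorner P) (K : D ⥤ E) [K.Braided]
  (hK : K.map (T.proj ≫ T.incl) = 𝟙 _)

/-- The restriction of a braided functor to the subcategory. -/
@[reducible] def restrictBraided :
    letI := T.monoidal
    letI := T.symmetric
    (P.ι ⋙ K).Braided :=
  letI := T.monoidal
  letI := T.symmetric
  letI := (T.restrictCore K hK).toMonoidal
  { braided := fun X Y => Functor.LaxBraided.braided (F := K) X.obj Y.obj }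

end

end TensorCorner

/-! ### The inverse of a braided equivalence -/

namespace CategoryTheory.Equivalence

section

variable {C D : Type*} [Category* C] [Category* D] [MonoidalCategory C] [MonoidalCategory D]
  [BraidedCategory C] [BraidedCategory D] (e : C ≌ D) [e.functor.Braided]

open Functor.LaxMonoidal Functor.OplaxMonoidal Functor.Monoidal

/-- The inverse of a braided equivalence is braided. -/
@[reducible] noncomputable def inverseBraided : e.inverse.Braided :=
  letI := e.inverseMonoidal
  { braided := fun X Y => by
      -- The tensor structure of the inverse is the mate of `δ` of the given functor, so
      -- compatibility with the symmetry follows from `hβ`, the corresponding property of `δ`, and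
      -- from naturality.
      have h : ∀ X Y, μ e.inverse X Y = e.unit.app _ ≫ e.inverse.map
          (δ e.functor _ _ ≫ (e.counit.app X ⊗ₘ e.counit.app Y)) := fun X Y =>
        (e.toAdjunction.rightAdjointLaxMonoidal_μ X Y).trans (e.toAdjunction.homEquiv_unit _ _ _)
      have hβ : ∀ X Y, δ e.functor X Y ≫ (β_ _ _).hom =
          e.functor.map (β_ X Y).hom ≫ δ e.functor Y X := fun X Y => by
        rw [Functor.map_braiding, Category.assoc, Category.assoc, μ_δ, Category.comp_id]
      have hn : (e.counit.app X ⊗ₘ e.counit.app Y) ≫ (β_ X Y).hom =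
          (β_ (e.functor.obj (e.inverse.obj X)) (e.functor.obj (e.inverse.obj Y))).hom ≫
            (e.counit.app Y ⊗ₘ e.counit.app X) :=
        BraidedCategory.braiding_naturality _ _
      rw [h, h, Category.assoc, ← e.inverse.map_comp, Category.assoc, hn, reassoc_of% hβ, e.inverse.map_comp]
      exact (e.unit.naturality_assoc _ _).symm }

end

end CategoryTheory.Equivalence

/-! ### Direct factors and the equivalence -/

namespace PermObj

open FinGSet

section

variable {G : Type u} [Group G] [TopologicalSpace G] [RoelckePrecompact G]
variable {k : Type v} [Field k] {μ : GMeasure G k}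

/-- The morphism given by an injective map of `G`-sets has a retraction. -/
theorem exists_retraction {X Y : PermObj μ} (j : X.set →[G] Y.set) (hj : Function.Injective j) :
    ∃ r : Y ⟶ X, ofMap j ≫ r = 𝟙 X := by
  classical
  -- The retraction is the transpose of the graph of `j`.
  refine ⟨ind k (X := X.set.prod Y.set) (fun p => snd p = j (fst p)) fun g p => by
    rw [map_smul, map_smul, map_smul, smul_left_cancel_iff], ?_⟩
  refine (μ.matMul_graph _ j).trans (invFun_ext fun p => ?_)
  refine (ind_cls _ _ _).trans (Eq.trans (if_congr ?_ rfl rfl)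
    (GMeasure.graph_cls (MulActionHom.id G) (fst p) (snd p)).symm)
  exact hj.eq_iff.trans eq_comm

/-- The morphism given by a map of `G`-sets has a section if the push-forward of the function `1`
does not vanish anywhere. -/
theorem exists_section {X Y : PermObj μ} (q : X.set →[G] Y.set) (hq : ∀ O, μ.push q 1 O ≠ 0) :
    ∃ s : Y ⟶ X, s ≫ ofMap q = 𝟙 Y := by
  -- The section is the transposed graph of `q` with the entry at `(x, q x)` divided by the value of
  -- `q_* 1` at `q x`; by the projection formula the composite is then the identity.
  refine ⟨μ.push (pair (MulActionHom.id G) q) (pull q fun O => (μ.push q 1 O)⁻¹), ?_⟩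
  refine (μ.graph_matMul q _).trans ?_
  have h : μ.push q (pull q fun O => (μ.push q 1 O)⁻¹) = 1 := by
    have h := μ.push_mul_pull q 1 fun O => (μ.push q 1 O)⁻¹
    rw [one_mul] at h
    rw [h]
    exact funext fun O => mul_inv_cancel₀ (hq O)
  rw [GMeasure.push_push]
  refine Eq.trans ?_ (μ.graph_eq_push (MulActionHom.id G : Y.set →[G] Y.set)).symm
  rw [← h, GMeasure.push_push]
  rfl

end

end PermObj

namespace HomeoGroup

open FinGSet Idempotents

section

variable (𝔛 : Type u) [TopologicalSpace 𝔛] [IsCantorSpace 𝔛] {k : Type v} [Field k] [CharZero k]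

local notation "𝔾" => HomeoGroup 𝔛

theorem scalarMeasure_orbVal_ne_zero {X Y : FinGSet 𝔾} (f : X →[𝔾] Y) (O : X.Orb) :
    (scalarMeasure 𝔛 k).orbVal f O ≠ 0 :=
  ((measure_isRegular _ (Y.sub_transitive _) (X.sub_transitive O)).map (Rat.castHom k)).ne_zero

variable (k) in
/-- Every permutation module is a direct factor of one attached to a formal direct sum. -/
theorem exists_retract (X : PermObj (scalarMeasure 𝔛 k)) :
    ∃ (M : Mat_ (Free k VObj)) (i : X ⟶ (sumFunctor 𝔛 k).obj M) (r : (sumFunctor 𝔛 k).obj M ⟶ X),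
      i ≫ r = 𝟙 X := by
  classical
  let e := Fintype.equivFin X.set.Orb
  choose x hx using fun O : X.set.Orb => cls_surj O
  choose n p hp using fun i => exists_cover X.set (x (e.symm i))
  -- `S` contains one cover `X(n)` for each orbit of `X`. It maps onto `X` by `q` and is a
  -- `G`-subset, by `j`, of the disjoint union of the corresponding `Y(n)`.
  let S : FinGSet 𝔾 := sigma fun i => surjSet 𝔛 (Fin (n i))
  let M : Mat_ (Free k VObj) := ⟨Fin (Fintype.card X.set.Orb), fun i => Free.of k ⟨Fin (n i)⟩⟩
  let j : S →[𝔾] sumSet 𝔛 M := sigmaMap (fun i => i) fun i => ⟨toLC, fun _ _ => rfl⟩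
  have hj : Function.Injective j := by
    rintro ⟨i, φ⟩ ⟨i', φ'⟩ h
    obtain rfl : i = i' := congrArg idx h
    exact congrArg (inj (fun i => surjSet 𝔛 (Fin (n i))) i) (toLC_injective
      (inj_injective (fun i => mapSet 𝔛 (unfree (M.X i)).A) i h))
  let q : S →[𝔾] X.set := ⟨fun s => p (idx s) (point s), fun g s => map_smul (p (idx s)) g (point s)⟩
  have hcls : ∀ i φ, cls (p i φ) = e.symm i := fun i φ => by
    obtain ⟨φ₀, h₀⟩ := (hp i).2
    obtain ⟨g, rfl⟩ := surjSet_pretransitive.exists_smul_eq φ₀ φ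
    rw [map_smul, cls_smul, h₀, hx]
  -- Exactly one orbit of `S` lies above `O`, so the value is a single measure of a map of
  -- transitive sets, which is non-zero by regularity; no cancellation is possible.
  have hq : ∀ O, (scalarMeasure 𝔛 k).push q 1 O ≠ 0 := by
    intro O
    obtain ⟨φ, hφ⟩ := (hp (e O)).2
    rw [GMeasure.push, Finset.sum_eq_single (cls (inj (fun i => surjSet 𝔛 (Fin (n i))) (e O) φ))]
    · have h : orbMap q (cls (inj (fun i => surjSet 𝔛 (Fin (n i))) (e O) φ)) = O :=
        (hcls (e O) φ).trans (e.symm_apply_apply O)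
      rw [if_pos h]
      exact mul_ne_zero (scalarMeasure_orbVal_ne_zero 𝔛 _ _) one_ne_zero
    · intro P _ hP
      refine if_neg fun h => hP ?_
      obtain ⟨⟨i, φ'⟩, rfl⟩ := cls_surj P
      obtain rfl : e O = i := by
        rw [← h]
        exact (congrArg e (hcls i φ')).trans (e.apply_symm_apply i)
      obtain ⟨g, rfl⟩ := surjSet_pretransitive.exists_smul_eq φ φ'
      exact cls_smul g (inj (fun i => surjSet 𝔛 (Fin (n i))) (e O) φ)
    · exact fun h => absurd (Finset.mem_univ _) h
  obtain ⟨r, hr⟩ := PermObj.exists_retraction (X := (⟨S⟩ : PermObj (scalarMeasure 𝔛 k)))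
    (Y := (sumFunctor 𝔛 k).obj M) j hj
  obtain ⟨s, hs⟩ := PermObj.exists_section (X := (⟨S⟩ : PermObj (scalarMeasure 𝔛 k))) (Y := X) q hq
  exact ⟨M, s ≫ PermObj.ofMap (Y := (sumFunctor 𝔛 k).obj M) j, r ≫ PermObj.ofMap q, by
    rw [Category.assoc, reassoc_of% hr, hs]⟩

/-- The functor kills `[0]`, so it does not distinguish an object from its direct factor `X_1`. -/
theorem sumFunctor_map_one_sub (M : Mat_ (Free k VObj)) :
    (sumFunctor 𝔛 k).map (𝟙 M - zeroMat M) = 𝟙 _ := by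
  rw [Functor.map_sub, sumFunctor_map_zeroMat, sub_zero, CategoryTheory.Functor.map_id]

variable (k) in
/-- The functor from `k[𝒱]^♯_1` to the Karoubi envelope of the category of permutation modules. -/
noncomputable def sharpFunctor : VSharpOne k ⥤ Karoubi (PermObj (scalarMeasure 𝔛 k)) :=
  (isSharpOne k).ι ⋙ Karoubi.mapFunctor (sumFunctor 𝔛 k)

noncomputable instance : (sharpFunctor 𝔛 k).Braided :=
  (sharpOneCorner k).restrictBraided (Karoubi.mapFunctor (sumFunctor 𝔛 k))
    (Karoubi.hom_ext _ _
      ((congrArg (sumFunctor 𝔛 k).map (one_sub_zeroMat_idem (𝟙_ (Mat_ (Free k VObj))))).trans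
        ((sumFunctor_map_one_sub 𝔛 _).trans ((sumFunctor 𝔛 k).map_id _).symm)))

instance : (sharpFunctor 𝔛 k).Additive :=
  inferInstanceAs ((isSharpOne k).ι ⋙ Karoubi.mapFunctor (sumFunctor 𝔛 k)).Additive

instance : (sharpFunctor 𝔛 k).Linear k :=
  inferInstanceAs (((isSharpOne k).ι ⋙ Karoubi.mapFunctor (sumFunctor 𝔛 k)).Linear k)

/-- A difference that is mapped to zero equals its composite with `[0]`, by `eq_comp_zeroMat`, and
`[0]` vanishes on the target. -/
instance : (sharpFunctor 𝔛 k).Faithful where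
  map_injective {X Y f g} h := by
    have h₁ : (sumFunctor 𝔛 k).map (f.hom.f - g.hom.f) = 0 := by
      rw [Functor.map_sub]
      exact sub_eq_zero.2 (congrArg Karoubi.Hom.f h)
    have h₂ := congrArg (· ≫ Y.obj.p) (eq_comp_zeroMat 𝔛 _ h₁)
    rw [Category.assoc, (isSharpOne_iff Y.obj).1 Y.property, Limits.comp_zero,
      Preadditive.sub_comp, Karoubi.comp_p, Karoubi.comp_p] at h₂
    exact ObjectProperty.hom_ext _ (Karoubi.hom_ext _ _ (sub_eq_zero.1 h₂))

instance : (sharpFunctor 𝔛 k).Full where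
  map_surjective {X Y} g := by
    obtain ⟨a, ha⟩ := (sumFunctor 𝔛 k).map_surjective g.f
    refine ⟨ObjectProperty.homMk ⟨X.obj.p ≫ a ≫ Y.obj.p, by simp⟩, Karoubi.hom_ext _ _ ?_⟩
    change (sumFunctor 𝔛 k).map (X.obj.p ≫ a ≫ Y.obj.p) = g.f
    rw [Functor.map_comp, Functor.map_comp, ha]
    exact g.comm

/-- The object is the image of an idempotent on some `Vec` of a formal direct sum. A preimage `a` of
this idempotent need not be idempotent, but the defect lies in the kernel of the functor and is
annihilated by `1 - [0]`. Composing `a` with `1 - [0]` therefore gives an idempotent with the same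
image under the functor, and one on whose image `[0]` vanishes. -/
instance : (sharpFunctor 𝔛 k).EssSurj where
  mem_essImage Z := by
    obtain ⟨M, i, r, hir⟩ := exists_retract 𝔛 k Z.X
    obtain ⟨a, ha⟩ := (sumFunctor 𝔛 k).map_surjective (r ≫ Z.p ≫ i)
    have hz : zeroMat M ≫ (𝟙 M - zeroMat M) = 0 := by
      rw [Preadditive.comp_sub, zeroMat_idem, Category.comp_id, sub_self]
    have hp : (sumFunctor 𝔛 k).map (a ≫ (𝟙 M - zeroMat M)) = r ≫ Z.p ≫ i := by
      rw [Functor.map_comp, sumFunctor_map_one_sub, ha, Category.comp_id]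
    have hidem : (a ≫ (𝟙 M - zeroMat M)) ≫ (a ≫ (𝟙 M - zeroMat M)) = a ≫ (𝟙 M - zeroMat M) := by
      have h : (sumFunctor 𝔛 k).map ((a ≫ (𝟙 M - zeroMat M)) ≫ a - a) = 0 := by
        rw [Functor.map_sub, Functor.map_comp, hp, ha]
        simp only [Category.assoc, reassoc_of% hir, Karoubi.idem_assoc, sub_self]
      have h' : ((a ≫ (𝟙 M - zeroMat M)) ≫ a - a) ≫ (𝟙 M - zeroMat M) = 0 :=
        (congrArg (· ≫ (𝟙 M - zeroMat M)) (eq_comp_zeroMat 𝔛 _ h)).trans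
          ((Category.assoc _ _ _).trans ((congrArg (_ ≫ ·) hz).trans Limits.comp_zero))
      rw [Preadditive.sub_comp] at h'
      exact (Category.assoc _ _ _).symm.trans (sub_eq_zero.1 h')
    have hr : (r ≫ Z.p ≫ i) ≫ (r ≫ Z.p) ≫ Z.p = r ≫ Z.p := by
      simp only [Category.assoc, reassoc_of% hir, Karoubi.idem]
    have hi : Z.p ≫ (Z.p ≫ i) ≫ r ≫ Z.p ≫ i = Z.p ≫ i := by
      simp only [Category.assoc, reassoc_of% hir, Karoubi.idem_assoc]
    let X : VSharpOne k := ⟨⟨M, a ≫ (𝟙 M - zeroMat M), hidem⟩, by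
      rw [isSharpOne_iff]
      change zeroMat M ≫ a ≫ (𝟙 M - zeroMat M) = 0
      rw [← Category.assoc, ← zeroMat_comm, Category.assoc, hz, Limits.comp_zero]⟩
    refine ⟨X, ⟨⟨⟨r ≫ Z.p, ?_⟩, ⟨Z.p ≫ i, ?_⟩, Karoubi.hom_ext _ _ ?_, Karoubi.hom_ext _ _ ?_⟩⟩⟩
    · exact (congrArg (· ≫ (r ≫ Z.p) ≫ Z.p) hp).trans hr
    · exact (congrArg (fun t => Z.p ≫ (Z.p ≫ i) ≫ t) hp).trans hi
    · change (r ≫ Z.p) ≫ Z.p ≫ i = (sumFunctor 𝔛 k).map (a ≫ (𝟙 M - zeroMat M))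
      rw [hp]
      simp only [Category.assoc, Karoubi.idem_assoc]
    · change (Z.p ≫ i) ≫ r ≫ Z.p = Z.p
      simp only [Category.assoc, reassoc_of% hir, Karoubi.idem]

instance : (sharpFunctor 𝔛 k).IsEquivalence where

variable (k) in
/-- The object `[V(A)]_1` is mapped to `Vec_{Y(A)}`. -/
noncomputable def sharpFunctorObjIso (A : Type) [Fintype A] [DecidableEq A] :
    (sharpFunctor 𝔛 k).obj (vOne k A) ≅
      (toKaroubi (PermObj (scalarMeasure 𝔛 k))).obj ⟨mapSet 𝔛 A⟩ :=
  let M := (Mat_.embedding (Free k VObj)).obj (Free.of k ⟨A⟩)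
  have hp : ((sharpFunctor 𝔛 k).obj (vOne k A)).p = 𝟙 _ := sumFunctor_map_one_sub 𝔛 M
  let Y : M.ι → FinGSet 𝔾 := fun i => mapSet 𝔛 (unfree (M.X i)).A
  let e : (sumFunctor 𝔛 k).obj M ≅ ⟨mapSet 𝔛 A⟩ :=
    PermObj.isoOfMaps (X := (sumFunctor 𝔛 k).obj M) (Y := ⟨mapSet 𝔛 A⟩)
      ⟨fun s : sigma Y => (point s : mapSet 𝔛 A), fun _ _ => rfl⟩ (inj Y PUnit.unit)
      (fun _ => rfl) (fun _ => rfl)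
  { hom := ⟨e.hom, by
      rw [hp]
      exact (Category.id_comp _).trans (Category.comp_id _)⟩
    inv := ⟨e.inv, by
      rw [hp]
      exact (Category.id_comp _).trans (Category.comp_id _)⟩
    hom_inv_id := Karoubi.hom_ext _ _ (e.hom_inv_id.trans hp.symm)
    inv_hom_id := Karoubi.hom_ext _ _ e.inv_hom_id }

end

end HomeoGroup

/-- The functor is constructed on the side of `k[𝒱]^♯_1`, where the classes of matrices span the
morphism spaces; the required equivalence is its inverse, which inherits linearity and the symmetric
monoidal structure. -/
theorem mainTheorem3 (𝔛 : Type u) [TopologicalSpace 𝔛] [IsCantorSpace 𝔛]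
    (k : Type v) [Field k] [CharZero k] :
    ∃ μ : GMeasure (HomeoGroup 𝔛) ℚ,
      (μ.IsRegular ∧ ∀ n : ℕ, 1 ≤ n → μ.mass (surjSet 𝔛 (Fin n)) = (-2) ^ (n - 1)) ∧
      (∀ μ' : GMeasure (HomeoGroup 𝔛) ℚ, μ'.IsRegular →
        (∀ n : ℕ, 1 ≤ n → μ'.mass (surjSet 𝔛 (Fin n)) = (-2) ^ (n - 1)) → μ' = μ) ∧
      (∃ F : Idempotents.Karoubi (PermObj (μ.map (Rat.castHom k))) ⥤ VSharpOne k,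
        F.IsEquivalence ∧ Nonempty F.Braided ∧ F.Additive ∧ F.Linear k ∧
        ∀ (A : Type) [Fintype A] [DecidableEq A],
          Nonempty (F.obj ((Idempotents.toKaroubi _).obj ⟨mapSet 𝔛 A⟩) ≅ vOne k A)) ∧
      (∀ (A B : Type) [Finite A] [Finite B] (f : A → B),
        (μ.map (Rat.castHom k)).push (mapSetMap 𝔛 f) 1 = mapSetInd 𝔛 k (oddFiber f)) := by
  let e := (HomeoGroup.sharpFunctor 𝔛 k).asEquivalence
  let hb : e.functor.Braided := (inferInstance : (HomeoGroup.sharpFunctor 𝔛 k).Braided)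
  have ha : e.functor.Additive := (inferInstance : (HomeoGroup.sharpFunctor 𝔛 k).Additive)
  have hl : e.functor.Linear k := (inferInstance : (HomeoGroup.sharpFunctor 𝔛 k).Linear k)
  exact ⟨HomeoGroup.measure 𝔛, ⟨HomeoGroup.measure_isRegular, HomeoGroup.measure_mass_surjSet⟩,
    fun μ' _ h => HomeoGroup.measure_unique μ' h,
    ⟨e.inverse, inferInstance, ⟨e.inverseBraided⟩, inferInstance, inferInstance, fun A _ _ =>
      ⟨e.inverse.mapIso (HomeoGroup.sharpFunctorObjIso 𝔛 k A).symm ≪≫ (e.unitIso.app _).symm⟩⟩,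
    HomeoGroup.push_mapSetMap⟩
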